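/- Let $p\ge 2$ be an integer, $\mathfrak q=e^{i\pi/p}$, $[n]=\frac{\mathfrak q^n-\mathfrak q^{-n}}{\mathfrak q-\mathfrak q^{-1}}$, $[n]!=[1][2]\cdots[n]$. Let $U=\overline{\mathcal U}_{\mathfrak q}s\ell(2)$ be the restricted quantum group: the $\mathbb C$-algebra generated by $E,F,K^{\pm1}$ with $$KEK^{-1}=\mathfrak q^2E,\quad KFK^{-1}=\mathfrak q^{-2}F,\quad [E,F]=\frac{K-K^{-1}}{\mathfrak q-\mathfrak q^{-1}},\quad E^p=F^p=0,\quad K^{2p}=1,$$ and coproduct $\Delta(E)=1\otimes E+E\otimes K$, $\Delta(F)=K^{-1}\otimes F+F\otimes 1$, $\Delta(K)=K\otimes K$. **Modules.** For $1\le s\le p$ and a sign $\pm$, $X^\pm_s$ is the irreducible module with basis $a_0,\dots,a_{s-1}$, $Ka_n=\pm\mathfrak q^{s-1-2n}a_n$, $Ea_n=\pm[n][s-n]a_{n-1}$, $Fa_n=a_{n+1}$ (where $a_{-1}=a_s=0$). For a sign $\varepsilon$ and integers $a,c\ge1$ with $a+c=p$, the projective module $P^{\varepsilon}_{a}$ has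 basis $t_n,b_n$ ($0\le n<a$), $l_k,r_k$ ($0\le k<c$), where $K$ acts on $t_n,b_n$ by $\varepsilon\mathfrak q^{a-1-2n}$ and on $l_k,r_k$ by $-\varepsilon\mathfrak q^{c-1-2k}$, and (vectors with index out of range being $0$, unless specified) $$Et_0=l_{c-1},\quad Et_n=\varepsilon[n][a-n]t_{n-1}+b_{n-1}\ (n\ge1),\quad Eb_n=\varepsilon[n][a-n]b_{n-1},\quad El_k=-\varepsilon[k][c-k]l_{k-1},$$ $$Er_0=b_{a-1},\quad Er_k=-\varepsilon[k][c-k]r_{k-1}\ (k\ge1),$$ $$Ft_n=t_{n+1}\ (n<a-1),\quad Ft_{a-1}=r_0,\quad Fb_n=b_{n+1},\quad Fl_k=l_{k+1}\ (k<c-1),\quad Fl_{c-1}=b_0,\quad Fr_k=r_{k+1}.$$ **Pseudotraces.** Fix $a_0\in\mathbb C$. For $1\le s\le p-1$ let $\sigma_s$ be the linear endomorphism of $P^+_s\oplus P^-_{p-s}$ with $\sigma_s(b_n)=\alpha_s t_n$ in both summands, zero on all other basis vectors, where $\alpha_s=-a_0\frac{[s]}{p(\mathfrak q-\mathfrak q^{-1})}$,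 and put $\gamma(s)(x)=\mathrm{Tr}_{P^+_s\oplus P^-_{p-s}}(K^{p-1}x\,\sigma_s)$ for $x\in U$. **Radford map.** Let $\mathbf c=\sqrt{\tfrac p2}\,\frac1{([p-1]!)^2}F^{p-1}E^{p-1}\sum_{j=0}^{2p-1}K^j$ (a two-sided cointegral), $\Delta(\mathbf c)=\sum\mathbf c'\otimes\mathbf c''$, and for $\beta\in U^*$ put $\phi(\beta)=\sum\beta(\mathbf c')\mathbf c''$; write $\phi(s)=\phi(\gamma(s))$. **Canonical central elements.** These are elements $e_s$ ($0\le s\le p$) and $w^\pm_s$ ($1\le s\le p-1$) of the centre of $U$ such that the $e_s$ are primitive idempotents of the centre, $e_se_{s'}=\delta_{s,s'}e_s$, $e_sw^\pm_{s'}=\delta_{s,s'}w^\pm_{s'}$, all products of two of the $w$'s vanish, $e_s$ acts as the identity on $X^+_s$ for $1\le s\le p$, $e_0$ acts as the identity on $X^-_p$, and, for $1\le s\le p-1$: in $P^+_s$, $w^+_st_n=b_n$ and $w^-_st_n=0$; in $P^-_{p-s}$, $w^-_st_k=b_k$ and $w^+_st_k=0$. **Proposition.** The canonical central elements exist and are unique,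 and for $1\le s\le p-1$, with $w_s=w^+_s+w^-_s$, $$\phi(s)=a_0(-1)^{p-s}\frac{\sqrt{2p}}{\mathfrak q^s-\mathfrak q^{-s}}\Bigl(e_s-\frac{\mathfrak q^s+\mathfrak q^{-s}}{[s]^2}\,w_s\Bigr).$$ -/

import Mathlib

open scoped TensorProduct

noncomputable section

namespace RestrictedQuantumGroup

/-! ## `q`-numbers at `q = exp (iπ / p)` -/

/-- The root of unity `q = exp (iπ / p)`. -/
def qq (p : ℕ) : ℂ := Complex.exp (Complex.I * Real.pi / p)

/-- The `q`-integer `[n] = (q ^ n - q ^ (-n)) / (q - q⁻¹)`. -/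
def qInt (p : ℕ) (n : ℤ) : ℂ := (qq p ^ n - qq p ^ (-n)) / (qq p - (qq p)⁻¹)

/-- The `q`-factorial `[n]! = [1][2]⋯[n]`. -/
def qFactorial (p n : ℕ) : ℂ := ∏ i ∈ Finset.range n, qInt p ((i : ℤ) + 1)

theorem qq_ne_zero (p : ℕ) : qq p ≠ 0 := Complex.exp_ne_zero _

theorem qq_pow (p : ℕ) (hp : 0 < p) : qq p ^ p = -1 := by
  have h : (p : ℂ) ≠ 0 := by exact_mod_cast hp.ne'
  rw [qq, ← Complex.exp_nat_mul, mul_div_cancel₀ _ h, mul_comm, Complex.exp_pi_mul_I]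

theorem qq_sq_primitive (p : ℕ) (hp : 0 < p) : IsPrimitiveRoot (qq p ^ 2) p := by
  have h := Complex.isPrimitiveRoot_exp p hp.ne'
  have e : qq p ^ 2 = Complex.exp (2 * Real.pi * Complex.I / p) := by
    rw [qq, ← Complex.exp_nat_mul]
    congr 1
    push_cast
    ring
  rwa [e]

theorem qq_sub_inv_ne (p : ℕ) (hp : 2 ≤ p) : qq p - (qq p)⁻¹ ≠ 0 := by
  intro h
  have h0 := qq_ne_zero p
  have h1 : qq p ^ 2 = 1 := by
    field_simp at h
    linear_combination h
  have h2 := (qq_sq_primitive p (by omega)).pow_eq_one_iff_dvd 1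
  rw [pow_one] at h2
  have := Nat.le_of_dvd one_pos (h2.1 h1)
  omega

theorem qInt_zero (p : ℕ) : qInt p 0 = 0 := by simp [qInt]

/-! ## The algebra -/

/-- The generators `E`, `F`, `K`, `K⁻¹`. -/
inductive Gen
  | E | F | K | Ki

/-- The free algebra on a generator. -/
abbrev gen (x : Gen) : FreeAlgebra ℂ Gen := FreeAlgebra.ι ℂ x

/-- The defining relations of the restricted quantum `sl(2)` at `q = exp (iπ / p)`. -/
inductive Rel (p : ℕ) : FreeAlgebra ℂ Gen → FreeAlgebra ℂ Gen → Prop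
  | K_Ki : Rel p (gen .K * gen .Ki) 1
  | Ki_K : Rel p (gen .Ki * gen .K) 1
  | K_E : Rel p (gen .K * gen .E) (qq p ^ 2 • (gen .E * gen .K))
  | K_F : Rel p (gen .K * gen .F) ((qq p ^ 2)⁻¹ • (gen .F * gen .K))
  | E_F : Rel p (gen .E * gen .F - gen .F * gen .E)
      ((qq p - (qq p)⁻¹)⁻¹ • (gen .K - gen .Ki))
  | E_pow : Rel p (gen .E ^ p) 0
  | F_pow : Rel p (gen .F ^ p) 0
  | K_pow : Rel p (gen .K ^ (2 * p)) 1

/-- The restricted quantum group: the unital associative `ℂ`-algebra generated by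
`E`, `F`, `K`, `K⁻¹` subject to the relations above. -/
abbrev Uq (p : ℕ) : Type := RingQuot (Rel p)

/-- The class of a generator. -/
def cls (p : ℕ) (x : Gen) : Uq p := RingQuot.mkAlgHom ℂ (Rel p) (gen x)

/-- The generator `E`. -/
abbrev E (p : ℕ) : Uq p := cls p .E
/-- The generator `F`. -/
abbrev F (p : ℕ) : Uq p := cls p .F
/-- The generator `K`. -/
abbrev K (p : ℕ) : Uq p := cls p .K
/-- The inverse `K⁻¹` of the generator `K`. -/
abbrev Ki (p : ℕ) : Uq p := cls p .Ki

/-- The relations, for four elements of an arbitrary `ℂ`-algebra. -/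
structure Satisfies (p : ℕ) {A : Type*} [Ring A] [Algebra ℂ A] (f : Gen → A) : Prop where
  K_Ki : f .K * f .Ki = 1
  Ki_K : f .Ki * f .K = 1
  K_E : f .K * f .E = qq p ^ 2 • (f .E * f .K)
  K_F : f .K * f .F = (qq p ^ 2)⁻¹ • (f .F * f .K)
  E_F : f .E * f .F - f .F * f .E = (qq p - (qq p)⁻¹)⁻¹ • (f .K - f .Ki)
  E_pow : f .E ^ p = 0
  F_pow : f .F ^ p = 0
  K_pow : f .K ^ (2 * p) = 1

/-- The universal property: four elements that satisfy the relations define an algebra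
homomorphism. -/
def lift (p : ℕ) {A : Type*} [Ring A] [Algebra ℂ A] (f : Gen → A) (h : Satisfies p f) :
    Uq p →ₐ[ℂ] A :=
  RingQuot.liftAlgHom ℂ ⟨FreeAlgebra.lift ℂ f, by
    intro x y hxy
    cases hxy with
    | K_Ki => simpa using h.K_Ki
    | Ki_K => simpa using h.Ki_K
    | K_E => simpa using h.K_E
    | K_F => simpa using h.K_F
    | E_F => simpa using h.E_F
    | E_pow => simpa using h.E_pow
    | F_pow => simpa using h.F_pow
    | K_pow => simpa using h.K_pow⟩

@[simp]
theorem lift_cls (p : ℕ) {A : Type*} [Ring A] [Algebra ℂ A] (f : Gen → A) (h : Satisfies p f)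
    (x : Gen) : lift p f h (cls p x) = f x := by
  simp [lift, cls]

theorem hom_ext {p : ℕ} {A : Type*} [Semiring A] [Algebra ℂ A] {f g : Uq p →ₐ[ℂ] A}
    (h : ∀ x, f (cls p x) = g (cls p x)) : f = g := by
  apply RingQuot.ringQuot_ext'
  apply FreeAlgebra.hom_ext
  funext x
  exact h x

theorem cls_satisfies (p : ℕ) : Satisfies p (cls p) where
  K_Ki := by simpa [cls] using RingQuot.mkAlgHom_rel ℂ (Rel.K_Ki (p := p))
  Ki_K := by simpa [cls] using RingQuot.mkAlgHom_rel ℂ (Rel.Ki_K (p := p))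
  K_E := by simpa [cls] using RingQuot.mkAlgHom_rel ℂ (Rel.K_E (p := p))
  K_F := by simpa [cls] using RingQuot.mkAlgHom_rel ℂ (Rel.K_F (p := p))
  E_F := by simpa [cls] using RingQuot.mkAlgHom_rel ℂ (Rel.E_F (p := p))
  E_pow := by simpa [cls] using RingQuot.mkAlgHom_rel ℂ (Rel.E_pow (p := p))
  F_pow := by simpa [cls] using RingQuot.mkAlgHom_rel ℂ (Rel.F_pow (p := p))
  K_pow := by simpa [cls] using RingQuot.mkAlgHom_rel ℂ (Rel.K_pow (p := p))

/-! ## The comultiplication -/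

/-- The Gaussian binomial coefficients, with parameter `w`. -/
def gauss (w : ℂ) : ℕ → ℕ → ℂ
  | _, 0 => 1
  | 0, _ + 1 => 0
  | n + 1, k + 1 => gauss w n k + w ^ (k + 1) * gauss w n (k + 1)

theorem gauss_zero_right (w : ℂ) (n : ℕ) : gauss w n 0 = 1 := by cases n <;> rfl

theorem gauss_succ (w : ℂ) (n k : ℕ) :
    gauss w (n + 1) (k + 1) = gauss w n k + w ^ (k + 1) * gauss w n (k + 1) := rfl

theorem gauss_of_lt (w : ℂ) : ∀ n k : ℕ, n < k → gauss w n k = 0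
  | _, 0, h => absurd h (Nat.not_lt_zero _)
  | 0, _ + 1, _ => rfl
  | n + 1, k + 1, h => by
    rw [gauss_succ, gauss_of_lt w n k (by omega), gauss_of_lt w n (k + 1) (by omega)]
    ring

theorem gauss_mul (w : ℂ) (n : ℕ) : ∀ k : ℕ,
    gauss w (n + 1) (k + 1) * (1 - w ^ (k + 1)) = (1 - w ^ (n + 1)) * gauss w n k := by
  induction n with
  | zero =>
    intro k
    cases k with
    | zero => simp [gauss]
    | succ k => simp [gauss]
  | succ m ih =>
    intro k
    rw [gauss_succ w (m + 1) k]
    cases k with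
    | zero =>
      have h := ih 0
      simp only [gauss_zero_right] at h ⊢
      linear_combination w ^ 1 * h
    | succ j =>
      have h1 := ih (j + 1)
      have h2 := ih j
      have h3 := gauss_succ w m j
      linear_combination w ^ (j + 2) * h1 + w * h2 + w * (w ^ (m + 1) - 1) * h3

theorem add_pow_gauss {A : Type*} [Ring A] [Algebra ℂ A] (w : ℂ) (x y : A)
    (h : y * x = w • (x * y)) (n : ℕ) :
    (x + y) ^ n = ∑ k ∈ Finset.range (n + 1), gauss w n k • (x ^ k * y ^ (n - k)) := by
  have hk : ∀ k : ℕ, y * x ^ k = w ^ k • (x ^ k * y) := by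
    intro k
    induction k with
    | zero => simp
    | succ k ih =>
      rw [pow_succ, ← mul_assoc, ih, smul_mul_assoc, mul_assoc, h, mul_smul_comm, smul_smul,
        mul_assoc, pow_succ]
  induction n with
  | zero => simp [gauss]
  | succ n ih =>
    rw [pow_succ', ih, add_mul, Finset.mul_sum, Finset.mul_sum]
    rw [Finset.sum_range_succ' _ (n + 1)]
    have e1 : ∀ k ∈ Finset.range (n + 1),
        gauss w (n + 1) (k + 1) • (x ^ (k + 1) * y ^ (n + 1 - (k + 1))) =
        gauss w n k • (x ^ (k + 1) * y ^ (n - k)) +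
        (w ^ (k + 1) * gauss w n (k + 1)) • (x ^ (k + 1) * y ^ (n - k)) := by
      intro k _
      rw [gauss_succ, add_smul, Nat.add_sub_add_right]
    rw [Finset.sum_congr rfl e1, Finset.sum_add_distrib, add_assoc]
    congr 1
    · refine Finset.sum_congr rfl fun k _ => ?_
      rw [mul_smul_comm, ← mul_assoc, ← pow_succ']
    · rw [Finset.sum_range_succ' _ n, Finset.sum_range_succ _ n, gauss_of_lt w n (n + 1) (by omega)]
      simp only [mul_zero, zero_smul, add_zero]
      congr 1
      · refine Finset.sum_congr rfl fun k hk' => ?_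
        have hlt : k < n := Finset.mem_range.1 hk'
        have e2 : n - k = n - (k + 1) + 1 := by omega
        rw [mul_smul_comm, ← mul_assoc, hk, smul_mul_assoc, smul_smul, mul_comm (gauss _ _ _), e2,
          pow_succ' y, mul_assoc]
      · rw [gauss_zero_right, gauss_zero_right, mul_smul_comm]
        simp [pow_succ']

/-- The `q`-binomial formula at a primitive root of unity. -/
theorem add_pow_eq_zero {A : Type*} [Ring A] [Algebra ℂ A] (w : ℂ) (p : ℕ)
    (hw : 0 < p → IsPrimitiveRoot w p) (x y : A)
    (h : y * x = w • (x * y)) (hx : x ^ p = 0) (hy : y ^ p = 0) : (x + y) ^ p = 0 := by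
  rcases Nat.eq_zero_or_pos p with rfl | hp
  · simpa using hx
  replace hw := hw hp
  rw [add_pow_gauss w x y h]
  refine Finset.sum_eq_zero fun k hk => ?_
  rcases Nat.eq_zero_or_pos k with rfl | hk0
  · simp [hy]
  rcases (Nat.lt_succ_iff.1 (Finset.mem_range.1 hk)).lt_or_eq with hlt | rfl
  · obtain ⟨n, rfl⟩ : ∃ n, p = n + 1 := ⟨p - 1, by omega⟩
    obtain ⟨j, rfl⟩ : ∃ j, k = j + 1 := ⟨k - 1, by omega⟩
    have h1 := gauss_mul w n j
    rw [hw.pow_eq_one, sub_self, zero_mul] at h1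
    have h2 : 1 - w ^ (j + 1) ≠ 0 := by
      intro h3
      have h4 := Nat.le_of_dvd hk0 (hw.dvd_of_pow_eq_one _ (sub_eq_zero.1 h3).symm)
      omega
    rw [(mul_eq_zero.1 h1).resolve_right h2, zero_smul]
  · simp [hx]

/-- The coproducts of the generators:
`Δ(E) = 1 ⊗ E + E ⊗ K`, `Δ(F) = K⁻¹ ⊗ F + F ⊗ 1`, `Δ(K) = K ⊗ K`. -/
def comulGen (p : ℕ) : Gen → Uq p ⊗[ℂ] Uq p
  | .E => 1 ⊗ₜ E p + E p ⊗ₜ K p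
  | .F => Ki p ⊗ₜ F p + F p ⊗ₜ 1
  | .K => K p ⊗ₜ K p
  | .Ki => Ki p ⊗ₜ Ki p

theorem comulGen_satisfies (p : ℕ) : Satisfies p (comulGen p) := by
  have r := cls_satisfies p
  have hq := qq_ne_zero p
  have EKi : E p * Ki p = qq p ^ 2 • (Ki p * E p) := by
    calc E p * Ki p = Ki p * (K p * E p) * Ki p := by rw [← mul_assoc, r.Ki_K, one_mul]
      _ = qq p ^ 2 • (Ki p * E p) := by
        rw [r.K_E, mul_smul_comm, smul_mul_assoc, mul_assoc, mul_assoc, r.K_Ki, mul_one]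
  have FKi : F p * Ki p = (qq p ^ 2)⁻¹ • (Ki p * F p) := by
    calc F p * Ki p = Ki p * (K p * F p) * Ki p := by rw [← mul_assoc, r.Ki_K, one_mul]
      _ = (qq p ^ 2)⁻¹ • (Ki p * F p) := by
        rw [r.K_F, mul_smul_comm, smul_mul_assoc, mul_assoc, mul_assoc, r.K_Ki, mul_one]
  have hq2 : qq p ^ 2 ≠ 0 := pow_ne_zero _ hq
  constructor
  · simp only [comulGen, Algebra.TensorProduct.tmul_mul_tmul, r.K_Ki]
    rfl
  · simp only [comulGen, Algebra.TensorProduct.tmul_mul_tmul, r.Ki_K]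
    rfl
  · simp only [comulGen, mul_add, add_mul, Algebra.TensorProduct.tmul_mul_tmul, r.K_E, one_mul,
      mul_one, TensorProduct.tmul_smul, TensorProduct.smul_tmul', smul_add]
  · have hc : K p * Ki p = Ki p * K p := by rw [r.K_Ki, r.Ki_K]
    simp only [comulGen, mul_add, add_mul, Algebra.TensorProduct.tmul_mul_tmul, r.K_F, one_mul,
      mul_one, TensorProduct.tmul_smul, TensorProduct.smul_tmul', smul_add, hc]
  · have h1 : E p * F p = F p * E p + (qq p - (qq p)⁻¹)⁻¹ • (K p - Ki p) := by
      rw [← r.E_F]; abel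
    simp only [comulGen, mul_add, add_mul, Algebra.TensorProduct.tmul_mul_tmul, r.K_F, one_mul,
      mul_one, TensorProduct.tmul_smul, ← TensorProduct.smul_tmul', EKi, h1,
      TensorProduct.tmul_add, TensorProduct.add_tmul, smul_smul, smul_sub,
      TensorProduct.tmul_sub, TensorProduct.sub_tmul, inv_mul_cancel₀ hq2,
      one_smul]
    abel
  · refine add_pow_eq_zero (qq p ^ 2) p (qq_sq_primitive p)
      (1 ⊗ₜ[ℂ] E p) (E p ⊗ₜ[ℂ] K p) ?_ ?_ ?_
    · simp only [Algebra.TensorProduct.tmul_mul_tmul, r.K_E, one_mul, mul_one,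
        TensorProduct.tmul_smul]
    · simp only [Algebra.TensorProduct.tmul_pow, r.E_pow, TensorProduct.tmul_zero]
    · simp only [Algebra.TensorProduct.tmul_pow, r.E_pow, TensorProduct.zero_tmul]
  · refine add_pow_eq_zero (qq p ^ 2)⁻¹ p (fun hp => (qq_sq_primitive p hp).inv)
      (Ki p ⊗ₜ[ℂ] F p) (F p ⊗ₜ[ℂ] 1) ?_ ?_ ?_
    · simp only [Algebra.TensorProduct.tmul_mul_tmul, FKi, one_mul, mul_one,
        ← TensorProduct.smul_tmul']
    · simp only [Algebra.TensorProduct.tmul_pow, r.F_pow, TensorProduct.tmul_zero]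
    · simp only [Algebra.TensorProduct.tmul_pow, r.F_pow, TensorProduct.zero_tmul]
  · simp only [comulGen, Algebra.TensorProduct.tmul_pow, r.K_pow]
    rfl

/-- The counit on the generators. -/
def counitGen : Gen → ℂ
  | .E => 0
  | .F => 0
  | .K => 1
  | .Ki => 1

theorem counitGen_satisfies (p : ℕ) (hp : 0 < p) : Satisfies p counitGen := by
  constructor <;> simp [counitGen, hp.ne']

/-- The comultiplication `Δ`, as an algebra homomorphism. -/
def comulHom (p : ℕ) : Uq p →ₐ[ℂ] Uq p ⊗[ℂ] Uq p := lift p (comulGen p) (comulGen_satisfies p)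

/-- The counit, as an algebra homomorphism. -/
def counitHom (p : ℕ) (hp : 0 < p) : Uq p →ₐ[ℂ] ℂ := lift p counitGen (counitGen_satisfies p hp)

/-- The bialgebra structure of the restricted quantum group. -/
instance bialgebra (p : ℕ) [hp : NeZero p] : Bialgebra ℂ (Uq p) :=
  Bialgebra.ofAlgHom (comulHom p) (counitHom p hp.pos)
    (by
      apply hom_ext
      intro x
      cases x <;> simp [comulHom, comulGen, TensorProduct.tmul_add, TensorProduct.add_tmul,
        Algebra.TensorProduct.one_def, add_assoc])
    (by
      apply hom_ext
      intro x
      cases x <;> simp [comulHom, counitHom, comulGen, counitGen])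
    (by
      apply hom_ext
      intro x
      cases x <;> simp [comulHom, counitHom, comulGen, counitGen])

/-! ## Modules -/

/-- A linear map that lowers a height function bounded by `p` is nilpotent of order `p`. -/
theorem pow_eq_zero_of_height {I : Type*} (T : Module.End ℂ (I →₀ ℂ)) (h : I → ℕ) (p : ℕ)
    (hh : ∀ i, h i < p)
    (hT : ∀ i, T (Finsupp.single i 1) ∈
      Submodule.span ℂ {v | ∃ j, h j < h i ∧ v = Finsupp.single j 1}) : T ^ p = 0 := by
  have key : ∀ n, ∀ i, h i < n → (T ^ n) (Finsupp.single i 1) = 0 := by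
    intro n
    induction n with
    | zero => intro i hi; omega
    | succ n ih =>
      intro i hi
      rw [pow_succ, Module.End.mul_apply]
      have hle : Submodule.span ℂ {v : I →₀ ℂ | ∃ j, h j < h i ∧ v = Finsupp.single j 1} ≤
          LinearMap.ker (T ^ n) := by
        rw [Submodule.span_le]
        rintro v ⟨j, hj, rfl⟩
        exact ih j (by omega)
      exact hle (hT i)
  refine Finsupp.lhom_ext' fun i => LinearMap.ext_ring ?_
  simpa using key p i (hh i)

/-- Two linear maps on `I →₀ ℂ` that agree on the basis vectors are equal. -/
theorem end_ext {I : Type*} {S T : Module.End ℂ (I →₀ ℂ)}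
    (h : ∀ i, S (Finsupp.single i 1) = T (Finsupp.single i 1)) : S = T :=
  Finsupp.lhom_ext' fun i => LinearMap.ext_ring (by simpa using h i)

/-- The linear map with prescribed values on the basis vectors. -/
def onBasis {I : Type*} (f : I → (I →₀ ℂ)) : Module.End ℂ (I →₀ ℂ) :=
  Finsupp.linearCombination ℂ f

@[simp]
theorem onBasis_single {I : Type*} (f : I → (I →₀ ℂ)) (i : I) :
    onBasis f (Finsupp.single i 1) = f i := by simp [onBasis]

/-- The operators by which the generators act in a basis `(v_i)` of weight vectors:
`K v_i = d_i v_i`, `E v_i = e_i`, `F v_i = f_i`. -/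
def weightGen {I : Type*} (d : I → ℂ) (e f : I → (I →₀ ℂ)) : Gen → Module.End ℂ (I →₀ ℂ)
  | .K => onBasis fun i => d i • Finsupp.single i 1
  | .Ki => onBasis fun i => (d i)⁻¹ • Finsupp.single i 1
  | .E => onBasis e
  | .F => onBasis f

theorem weightGen_satisfies {I : Type*} (p : ℕ) (d : I → ℂ) (e f : I → (I →₀ ℂ))
    (hd0 : ∀ i, d i ≠ 0) (hd : ∀ i, d i ^ (2 * p) = 1)
    (hKE : ∀ i, weightGen d e f .K (e i) = (qq p ^ 2 * d i) • e i)
    (hKF : ∀ i, weightGen d e f .K (f i) = ((qq p ^ 2)⁻¹ * d i) • f i)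
    (hEF : ∀ i, weightGen d e f .E (f i) - weightGen d e f .F (e i) =
      ((qq p - (qq p)⁻¹)⁻¹ * (d i - (d i)⁻¹)) • Finsupp.single i 1)
    (hE : I → ℕ) (hE0 : ∀ i, hE i < p)
    (hE1 : ∀ i, e i ∈ Submodule.span ℂ {v | ∃ j, hE j < hE i ∧ v = Finsupp.single j 1})
    (hF : I → ℕ) (hF0 : ∀ i, hF i < p)
    (hF1 : ∀ i, f i ∈ Submodule.span ℂ {v | ∃ j, hF j < hF i ∧ v = Finsupp.single j 1}) :
    Satisfies p (weightGen d e f) := by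
  constructor
  · refine end_ext fun i => ?_
    rw [Module.End.mul_apply]
    simp only [weightGen, onBasis_single, map_smul]
    rw [smul_smul, inv_mul_cancel₀ (hd0 i), one_smul, Module.End.one_apply]
  · refine end_ext fun i => ?_
    rw [Module.End.mul_apply]
    simp only [weightGen, onBasis_single, map_smul]
    rw [smul_smul, mul_inv_cancel₀ (hd0 i), one_smul, Module.End.one_apply]
  · refine end_ext fun i => ?_
    rw [LinearMap.smul_apply, Module.End.mul_apply, Module.End.mul_apply]
    have h := hKE i
    simp only [weightGen, onBasis_single, map_smul] at h ⊢
    rw [h, smul_smul]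
  · refine end_ext fun i => ?_
    rw [LinearMap.smul_apply, Module.End.mul_apply, Module.End.mul_apply]
    have h := hKF i
    simp only [weightGen, onBasis_single, map_smul] at h ⊢
    rw [h, smul_smul]
  · refine end_ext fun i => ?_
    rw [LinearMap.smul_apply, LinearMap.sub_apply, LinearMap.sub_apply, Module.End.mul_apply,
      Module.End.mul_apply]
    have h := hEF i
    simp only [weightGen, onBasis_single] at h ⊢
    rw [h, ← sub_smul, smul_smul]
  · refine pow_eq_zero_of_height _ hE p hE0 fun i => ?_
    simpa only [weightGen, onBasis_single] using hE1 i
  · refine pow_eq_zero_of_height _ hF p hF0 fun i => ?_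
    simpa only [weightGen, onBasis_single] using hF1 i
  · have key : ∀ n i, (weightGen d e f .K ^ n) (Finsupp.single i 1) =
        d i ^ n • Finsupp.single i 1 := by
      intro n i
      induction n with
      | zero => simp
      | succ n ih =>
        rw [pow_succ, Module.End.mul_apply]
        simp only [weightGen, onBasis_single, map_smul] at ih ⊢
        rw [ih, smul_smul, pow_succ']
    refine end_ext fun i => ?_
    rw [key, hd i, one_smul, Module.End.one_apply]

/-- A sign, as a complex number. -/
def sgn (ε : ℤˣ) : ℂ := ((ε : ℤ) : ℂ)

theorem sgn_mul_self (ε : ℤˣ) : sgn ε * sgn ε = 1 := by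
  rcases Int.units_eq_one_or ε with rfl | rfl <;> simp [sgn]

theorem sgn_inv (ε : ℤˣ) : (sgn ε)⁻¹ = sgn ε :=
  inv_eq_of_mul_eq_one_left (sgn_mul_self ε)

/-! ### The irreducible modules -/

theorem weight_pow (p : ℕ) (hp : 0 < p) (ε : ℤˣ) (m : ℤ) :
    (sgn ε * qq p ^ m) ^ (2 * p) = 1 := by
  have h1 : (sgn ε) ^ 2 = 1 := by rw [sq, sgn_mul_self]
  have h2 : (qq p ^ m) ^ (2 * p) = 1 := by
    rw [← zpow_natCast, ← zpow_mul, mul_comm, zpow_mul, zpow_natCast, mul_comm 2 p, pow_mul,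
      qq_pow p hp]
    norm_num
  rw [mul_pow, pow_mul, h1, one_pow, one_mul, h2]

/-- The identity `[n + 1] [s - n - 1] - [n] [s - n] = [s - 1 - 2 n]`. -/
theorem qInt_identity (p : ℕ) (hp : 2 ≤ p) (s n : ℤ) :
    qInt p (n + 1) * qInt p (s - (n + 1)) - qInt p n * qInt p (s - n) =
      (qq p - (qq p)⁻¹)⁻¹ * (qq p ^ (s - 1 - 2 * n) - (qq p ^ (s - 1 - 2 * n))⁻¹) := by
  have h0 := qq_ne_zero p
  have h1 := qq_sub_inv_ne p hp
  have h2 : qq p ^ 2 - 1 ≠ 0 := by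
    intro h
    apply h1
    field_simp
    linear_combination h
  have hn : qq p ^ n ≠ 0 := zpow_ne_zero _ h0
  have hs : qq p ^ s ≠ 0 := zpow_ne_zero _ h0
  simp only [qInt, zpow_sub₀ h0, zpow_add₀ h0, zpow_neg, zpow_one, two_mul]
  field_simp
  ring

theorem weight_ne (p : ℕ) (ε : ℤˣ) (m : ℤ) : sgn ε * qq p ^ m ≠ 0 :=
  mul_ne_zero (left_ne_zero_of_mul_eq_one (sgn_mul_self ε)) (zpow_ne_zero _ (qq_ne_zero p))

/-- The `K`-eigenvalue `ε q ^ (s - 1 - 2 n)`. -/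
def wt (p : ℕ) (ε : ℤˣ) (s n : ℕ) : ℂ := sgn ε * qq p ^ ((s : ℤ) - 1 - 2 * n)

/-- The coefficient `ε [n] [s - n]`. -/
def co (p : ℕ) (ε : ℤˣ) (s n : ℕ) : ℂ := sgn ε * qInt p n * qInt p ((s : ℤ) - n)

theorem wt_succ (p : ℕ) (ε : ℤˣ) (s n : ℕ) : wt p ε s (n + 1) = (qq p ^ 2)⁻¹ * wt p ε s n := by
  have h0 := qq_ne_zero p
  have : ((s : ℤ) - 1 - 2 * ((n + 1 : ℕ) : ℤ)) = ((s : ℤ) - 1 - 2 * n) - 2 := by push_cast; ring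
  rw [wt, wt, this, zpow_sub₀ h0, zpow_ofNat]
  field_simp

theorem wt_pred (p : ℕ) (ε : ℤˣ) (s n : ℕ) : wt p ε s n = qq p ^ 2 * wt p ε s (n + 1) := by
  rw [wt_succ, ← mul_assoc, mul_inv_cancel₀ (pow_ne_zero _ (qq_ne_zero p)), one_mul]

theorem co_zero (p : ℕ) (ε : ℤˣ) (s : ℕ) : co p ε s 0 = 0 := by simp [co, qInt_zero]

theorem co_self (p : ℕ) (ε : ℤˣ) (s : ℕ) : co p ε s s = 0 := by simp [co, qInt_zero]

theorem co_sub (p : ℕ) (hp : 2 ≤ p) (ε : ℤˣ) (s n : ℕ) :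
    co p ε s (n + 1) - co p ε s n =
      (qq p - (qq p)⁻¹)⁻¹ * (wt p ε s n - (wt p ε s n)⁻¹) := by
  have h := qInt_identity p hp s n
  rw [co, co, wt, mul_inv, sgn_inv]
  push_cast
  linear_combination sgn ε * h

/-- The basis vector `a_n` of the irreducible module of dimension `s`, zero if `n ≥ s`. -/
def irrVec (s n : ℕ) : Fin s →₀ ℂ := if h : n < s then Finsupp.single ⟨n, h⟩ 1 else 0

/-- The action of the generators on the irreducible module of dimension `s` with highest weight
`ε q ^ (s - 1)`: `K a_n = ε q ^ (s - 1 - 2 n) a_n`, `E a_n = ε [n] [s - n] a_(n - 1)`, `F a_n = a_(n + 1)`,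
with `a_(-1) = a_s = 0`. -/
def irrGen (p : ℕ) (ε : ℤˣ) (s : ℕ) : Gen → Module.End ℂ (Fin s →₀ ℂ) :=
  weightGen (fun n => wt p ε s n) (fun n => co p ε s n • irrVec s (n - 1))
    (fun n => irrVec s (n + 1))

theorem irrVec_mem (s n m : ℕ) (h : Fin s → ℕ) (hh : ∀ j : Fin s, (j : ℕ) = n → h j < m) :
    irrVec s n ∈ Submodule.span ℂ {v | ∃ j, h j < m ∧ v = Finsupp.single j 1} := by
  rw [irrVec]
  split_ifs with hn
  · exact Submodule.subset_span ⟨_, hh ⟨n, hn⟩ rfl, rfl⟩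
  · exact Submodule.zero_mem _

theorem irrGen_satisfies (p : ℕ) (hp : 2 ≤ p) (ε : ℤˣ) (s : ℕ) (hs : s ≤ p) :
    Satisfies p (irrGen p ε s) := by
  have hK : ∀ n, irrGen p ε s .K (irrVec s n) = wt p ε s n • irrVec s n := by
    intro n
    rw [irrVec]
    split_ifs with h
    · simp only [irrGen, weightGen, onBasis_single]
    · simp
  have hE : ∀ n, n < s → irrGen p ε s .E (irrVec s n) = co p ε s n • irrVec s (n - 1) := by
    intro n h
    rw [irrVec, dif_pos h]
    simp only [irrGen, weightGen, onBasis_single]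
  have hF : ∀ n, irrGen p ε s .F (irrVec s n) = irrVec s (n + 1) := by
    intro n
    by_cases h : n < s
    · rw [irrVec, dif_pos h]
      simp only [irrGen, weightGen, onBasis_single]
    · rw [irrVec, dif_neg h, irrVec, dif_neg (by omega), map_zero]
  refine weightGen_satisfies p _ _ _ (fun n => weight_ne p ε _)
    (fun n => weight_pow p (by omega) ε _) ?_ ?_ ?_ (fun n => n) (fun n => by omega) ?_
    (fun n => s - 1 - n) (fun n => by omega) ?_
  · rintro ⟨n, hn⟩
    change irrGen p ε s .K (co p ε s n • irrVec s (n - 1)) = _ • (co p ε s n • irrVec s (n - 1))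
    rw [map_smul, hK]
    rcases n with _ | n
    · simp [co_zero]
    · rw [Nat.add_sub_cancel, wt_pred, smul_comm]
  · rintro ⟨n, hn⟩
    change irrGen p ε s .K (irrVec s (n + 1)) = _ • irrVec s (n + 1)
    rw [hK, wt_succ]
  · rintro ⟨n, hn⟩
    change irrGen p ε s .E (irrVec s (n + 1)) - irrGen p ε s .F (co p ε s n • irrVec s (n - 1)) =
      _ • (Finsupp.single ⟨n, hn⟩ 1 : Fin s →₀ ℂ)
    have h1 : irrGen p ε s .E (irrVec s (n + 1)) = co p ε s (n + 1) • irrVec s n := by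
      by_cases h : n + 1 < s
      · rw [hE _ h, Nat.add_sub_cancel]
      · obtain rfl : s = n + 1 := by omega
        rw [co_self, irrVec, dif_neg h, map_zero, zero_smul]
    have h2 : irrGen p ε s .F (co p ε s n • irrVec s (n - 1)) = co p ε s n • irrVec s n := by
      rw [map_smul, hF]
      rcases n with _ | n
      · simp [co_zero]
      · rfl
    have h3 : irrVec s n = Finsupp.single ⟨n, hn⟩ 1 := dif_pos hn
    rw [h1, h2, ← sub_smul, co_sub p hp, h3]
  · rintro ⟨n, hn⟩
    rcases n with _ | n
    · simp [co_zero]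
    · exact Submodule.smul_mem _ _ (irrVec_mem _ _ _ _ fun j hj => by simp_all)
  · rintro ⟨n, hn⟩
    refine irrVec_mem _ _ _ _ fun j hj => ?_
    have h1 := j.2
    change s - 1 - (j : ℕ) < s - 1 - n
    have h2 : (j : ℕ) = n + 1 := hj
    omega

/-- The irreducible module of dimension `s` and highest weight `ε q ^ (s - 1)`. -/
def irr (p : ℕ) (ε : ℤˣ) (s : ℕ) (hp : 2 ≤ p) (hs : s ≤ p) : Uq p →ₐ[ℂ] Module.End ℂ (Fin s →₀ ℂ) :=
  lift p (irrGen p ε s) (irrGen_satisfies p hp ε s hs)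

/-! ### The projective modules -/

/-- The basis of a projective module: `t_n`, `b_n` for `0 ≤ n < a` (top and bottom) and `l_k`,
`r_k` for `0 ≤ k < c` (left and right). -/
inductive ProjIdx (a c : ℕ)
  | t (n : Fin a) | b (n : Fin a) | l (k : Fin c) | r (k : Fin c)

instance projIdxFintype (a c : ℕ) : Fintype (ProjIdx a c) :=
  Fintype.ofEquiv ((Fin a ⊕ Fin a) ⊕ (Fin c ⊕ Fin c))
    { toFun := fun x => match x with
        | .inl (.inl n) => .t n
        | .inl (.inr n) => .b n
        | .inr (.inl k) => .l k
        | .inr (.inr k) => .r k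
      invFun := fun x => match x with
        | .t n => .inl (.inl n)
        | .b n => .inl (.inr n)
        | .l k => .inr (.inl k)
        | .r k => .inr (.inr k)
      left_inv := by rintro ((n | n) | (k | k)) <;> rfl
      right_inv := by rintro (n | n | k | k) <;> rfl }

/-- The underlying space of a projective module. -/
abbrev ProjSpace (a c : ℕ) : Type := ProjIdx a c →₀ ℂ

section projective
variable {a c : ℕ}

/-- The vector `t_n`, zero if `n ≥ a`. -/
def tVec (a c n : ℕ) : ProjSpace a c := if h : n < a then Finsupp.single (.t ⟨n, h⟩) 1 else 0
/-- The vector `b_n`, zero if `n ≥ a`. -/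
def bVec (a c n : ℕ) : ProjSpace a c := if h : n < a then Finsupp.single (.b ⟨n, h⟩) 1 else 0
/-- The vector `l_k`, zero if `k ≥ c`. -/
def lVec (a c k : ℕ) : ProjSpace a c := if h : k < c then Finsupp.single (.l ⟨k, h⟩) 1 else 0
/-- The vector `r_k`, zero if `k ≥ c`. -/
def rVec (a c k : ℕ) : ProjSpace a c := if h : k < c then Finsupp.single (.r ⟨k, h⟩) 1 else 0

/-- The `K`-eigenvalues: `ε q ^ (a - 1 - 2 n)` on `t_n`, `b_n` and `-ε q ^ (c - 1 - 2 k)` on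
`l_k`, `r_k`. -/
def projWt (p : ℕ) (ε : ℤˣ) (a c : ℕ) : ProjIdx a c → ℂ
  | .t n => wt p ε a n
  | .b n => wt p ε a n
  | .l k => wt p (-ε) c k
  | .r k => wt p (-ε) c k

/-- The action of `E` on the basis:
`E t_0 = l_(c - 1)` and `E t_n = ε [n] [a - n] t_(n - 1) + b_(n - 1)` for `n ≥ 1`;
`E b_n = ε [n] [a - n] b_(n - 1)`; `E l_k = -ε [k] [c - k] l_(k - 1)`;
`E r_0 = b_(a - 1)` and `E r_k = -ε [k] [c - k] r_(k - 1)` for `k ≥ 1`. -/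
def projE (p : ℕ) (ε : ℤˣ) (a c : ℕ) : ProjIdx a c → ProjSpace a c
  | .t n => if (n : ℕ) = 0 then lVec a c (c - 1)
      else co p ε a n • tVec a c (n - 1) + bVec a c (n - 1)
  | .b n => co p ε a n • bVec a c (n - 1)
  | .l k => co p (-ε) c k • lVec a c (k - 1)
  | .r k => if (k : ℕ) = 0 then bVec a c (a - 1) else co p (-ε) c k • rVec a c (k - 1)

/-- The action of `F` on the basis:
`F t_n = t_(n + 1)` for `n < a - 1` and `F t_(a - 1) = r_0`; `F b_n = b_(n + 1)`;
`F l_k = l_(k + 1)` for `k < c - 1` and `F l_(c - 1) = b_0`; `F r_k = r_(k + 1)`. -/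
def projF (a c : ℕ) : ProjIdx a c → ProjSpace a c
  | .t n => if (n : ℕ) + 1 < a then tVec a c (n + 1) else rVec a c 0
  | .b n => bVec a c (n + 1)
  | .l k => if (k : ℕ) + 1 < c then lVec a c (k + 1) else bVec a c 0
  | .r k => rVec a c (k + 1)

/-- The action of the generators on the projective module whose top and bottom are the irreducible
module of dimension `a` and highest weight `ε q ^ (a - 1)`, and whose left and right
constituents are irreducible of dimension `c = p - a` and highest weight `-ε q ^ (c - 1)`. -/
def projGen (p : ℕ) (ε : ℤˣ) (a c : ℕ) : Gen → Module.End ℂ (ProjSpace a c) :=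
  weightGen (projWt p ε a c) (projE p ε a c) (projF a c)

theorem wt_cross (p : ℕ) (hp : 0 < p) (ε : ℤˣ) (a c k : ℕ) (h : a + c = p) :
    wt p (-ε) c k = wt p ε a (a + k) := by
  have h1 : ((c : ℤ) - 1 - 2 * k) = (p : ℤ) + ((a : ℤ) - 1 - 2 * ((a + k : ℕ) : ℤ)) := by
    subst h; push_cast; ring
  have h2 : sgn (-ε) = -sgn ε := by simp [sgn]
  rw [wt, wt, h1, zpow_add₀ (qq_ne_zero p), zpow_natCast, qq_pow p hp, h2]
  ring

theorem wt_cross' (p : ℕ) (hp : 0 < p) (ε : ℤˣ) (a c n : ℕ) (h : a + c = p) :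
    wt p ε a n = wt p (-ε) c (c + n) := by
  have := wt_cross p hp (-ε) c a n (by omega)
  rwa [neg_neg] at this

section mem
variable (h : ProjIdx a c → ℕ) (n m : ℕ)

theorem tVec_mem (hh : ∀ j : Fin a, (j : ℕ) = n → h (.t j) < m) :
    tVec a c n ∈ Submodule.span ℂ {v | ∃ j, h j < m ∧ v = Finsupp.single j 1} := by
  rw [tVec]
  split_ifs with hn
  · exact Submodule.subset_span ⟨_, hh ⟨n, hn⟩ rfl, rfl⟩
  · exact Submodule.zero_mem _

theorem bVec_mem (hh : ∀ j : Fin a, (j : ℕ) = n → h (.b j) < m) :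
    bVec a c n ∈ Submodule.span ℂ {v | ∃ j, h j < m ∧ v = Finsupp.single j 1} := by
  rw [bVec]
  split_ifs with hn
  · exact Submodule.subset_span ⟨_, hh ⟨n, hn⟩ rfl, rfl⟩
  · exact Submodule.zero_mem _

theorem lVec_mem (hh : ∀ j : Fin c, (j : ℕ) = n → h (.l j) < m) :
    lVec a c n ∈ Submodule.span ℂ {v | ∃ j, h j < m ∧ v = Finsupp.single j 1} := by
  rw [lVec]
  split_ifs with hn
  · exact Submodule.subset_span ⟨_, hh ⟨n, hn⟩ rfl, rfl⟩
  · exact Submodule.zero_mem _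

theorem rVec_mem (hh : ∀ j : Fin c, (j : ℕ) = n → h (.r j) < m) :
    rVec a c n ∈ Submodule.span ℂ {v | ∃ j, h j < m ∧ v = Finsupp.single j 1} := by
  rw [rVec]
  split_ifs with hn
  · exact Submodule.subset_span ⟨_, hh ⟨n, hn⟩ rfl, rfl⟩
  · exact Submodule.zero_mem _

end mem

/-- The number of steps by which `E` can be applied to a basis vector. -/
def heightE : ProjIdx a c → ℕ
  | .t n => c + n
  | .b n => n
  | .l k => k
  | .r k => a + k

/-- The number of steps by which `F` can be applied to a basis vector. -/
def heightF : ProjIdx a c → ℕ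
  | .t n => c + (a - 1 - n)
  | .b n => a - 1 - n
  | .l k => a + (c - 1 - k)
  | .r k => c - 1 - k

theorem projE_mem (p : ℕ) (ε : ℤˣ) (hc : 0 < c) (i : ProjIdx a c) :
    projE p ε a c i ∈ Submodule.span ℂ {v | ∃ j, heightE j < heightE i ∧ v = Finsupp.single j 1} := by
  rcases i with ⟨n, hn⟩ | ⟨n, hn⟩ | ⟨k, hk⟩ | ⟨k, hk⟩
  · simp only [projE]
    split_ifs with h0
    · exact lVec_mem _ _ _ fun j hj => by simp only [heightE]; omega
    · refine Submodule.add_mem _ (Submodule.smul_mem _ _ ?_) ?_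
      · exact tVec_mem _ _ _ fun j hj => by simp only [heightE]; omega
      · exact bVec_mem _ _ _ fun j hj => by simp only [heightE]; omega
  · rcases n with _ | n
    · simp [projE, co_zero]
    · exact Submodule.smul_mem _ _ (bVec_mem _ _ _ fun j hj => by
        simp only [heightE, Nat.add_sub_cancel] at hj ⊢; omega)
  · rcases k with _ | k
    · simp [projE, co_zero]
    · exact Submodule.smul_mem _ _ (lVec_mem _ _ _ fun j hj => by
        simp only [heightE, Nat.add_sub_cancel] at hj ⊢; omega)
  · simp only [projE]
    split_ifs with h0
    · exact bVec_mem _ _ _ fun j hj => by simp only [heightE]; omega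
    · exact Submodule.smul_mem _ _ (rVec_mem _ _ _ fun j hj => by simp only [heightE]; omega)

theorem projF_mem (_ha : 0 < a) (i : ProjIdx a c) :
    projF a c i ∈ Submodule.span ℂ {v | ∃ j, heightF j < heightF i ∧ v = Finsupp.single j 1} := by
  rcases i with ⟨n, hn⟩ | ⟨n, hn⟩ | ⟨k, hk⟩ | ⟨k, hk⟩
  · simp only [projF]
    split_ifs with h0
    · exact tVec_mem _ _ _ fun j hj => by simp only [heightF]; omega
    · exact rVec_mem _ _ _ fun j hj => by simp only [heightF]; omega
  · exact bVec_mem _ _ _ fun j hj => by simp only [heightF] at hj ⊢; omega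
  · simp only [projF]
    split_ifs with h0
    · exact lVec_mem _ _ _ fun j hj => by simp only [heightF]; omega
    · exact bVec_mem _ _ _ fun j hj => by simp only [heightF]; omega
  · exact rVec_mem _ _ _ fun j hj => by simp only [heightF] at hj ⊢; omega

section act
variable (p : ℕ) (ε : ℤˣ)

theorem projK_t (n : ℕ) : projGen p ε a c .K (tVec a c n) = wt p ε a n • tVec a c n := by
  rw [tVec]
  split_ifs with h
  · simp only [projGen, weightGen, onBasis_single, projWt]
  · simp

theorem projK_b (n : ℕ) : projGen p ε a c .K (bVec a c n) = wt p ε a n • bVec a c n := by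
  rw [bVec]
  split_ifs with h
  · simp only [projGen, weightGen, onBasis_single, projWt]
  · simp

theorem projK_l (k : ℕ) : projGen p ε a c .K (lVec a c k) = wt p (-ε) c k • lVec a c k := by
  rw [lVec]
  split_ifs with h
  · simp only [projGen, weightGen, onBasis_single, projWt]
  · simp

theorem projK_r (k : ℕ) : projGen p ε a c .K (rVec a c k) = wt p (-ε) c k • rVec a c k := by
  rw [rVec]
  split_ifs with h
  · simp only [projGen, weightGen, onBasis_single, projWt]
  · simp

theorem projE_t_zero (ha : 0 < a) : projGen p ε a c .E (tVec a c 0) = lVec a c (c - 1) := by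
  rw [tVec, dif_pos ha]
  simp only [projGen, weightGen, onBasis_single, projE, if_true]

theorem projE_t (n : ℕ) (h : n + 1 < a) : projGen p ε a c .E (tVec a c (n + 1)) =
    co p ε a (n + 1) • tVec a c n + bVec a c n := by
  rw [tVec, dif_pos h]
  simp only [projGen, weightGen, onBasis_single, projE]
  rw [if_neg (Nat.succ_ne_zero n), Nat.add_sub_cancel]

theorem projE_b_zero : projGen p ε a c .E (bVec a c 0) = 0 := by
  rw [bVec]
  split_ifs with h
  · simp only [projGen, weightGen, onBasis_single, projE, co_zero, zero_smul]
  · simp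

theorem projE_b (n : ℕ) : projGen p ε a c .E (bVec a c (n + 1)) =
    co p ε a (n + 1) • bVec a c n := by
  by_cases h : n + 1 < a
  · rw [bVec, dif_pos h]
    simp only [projGen, weightGen, onBasis_single, projE, Nat.add_sub_cancel]
  · rw [bVec, dif_neg h, map_zero]
    rcases (Nat.le_of_not_lt h).lt_or_eq with h1 | h1
    · rw [bVec, dif_neg (by omega), smul_zero]
    · rw [h1, co_self, zero_smul]

theorem projE_l (k : ℕ) : projGen p ε a c .E (lVec a c (k + 1)) =
    co p (-ε) c (k + 1) • lVec a c k := by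
  by_cases h : k + 1 < c
  · rw [lVec, dif_pos h]
    simp only [projGen, weightGen, onBasis_single, projE, Nat.add_sub_cancel]
  · rw [lVec, dif_neg h, map_zero]
    rcases (Nat.le_of_not_lt h).lt_or_eq with h1 | h1
    · rw [lVec, dif_neg (by omega), smul_zero]
    · rw [h1, co_self, zero_smul]

theorem projE_r_zero (hc : 0 < c) : projGen p ε a c .E (rVec a c 0) = bVec a c (a - 1) := by
  rw [rVec, dif_pos hc]
  simp only [projGen, weightGen, onBasis_single, projE, if_true]

theorem projE_r (k : ℕ) : projGen p ε a c .E (rVec a c (k + 1)) =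
    co p (-ε) c (k + 1) • rVec a c k := by
  by_cases h : k + 1 < c
  · rw [rVec, dif_pos h]
    simp only [projGen, weightGen, onBasis_single, projE]
    rw [if_neg (Nat.succ_ne_zero k), Nat.add_sub_cancel]
  · rw [rVec, dif_neg h, map_zero]
    rcases (Nat.le_of_not_lt h).lt_or_eq with h1 | h1
    · rw [rVec, dif_neg (by omega), smul_zero]
    · rw [h1, co_self, zero_smul]

theorem projF_t (n : ℕ) (h : n + 1 < a) : projGen p ε a c .F (tVec a c n) = tVec a c (n + 1) := by
  rw [tVec, dif_pos (by omega)]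
  simp only [projGen, weightGen, onBasis_single, projF]
  rw [if_pos h]

theorem projF_t_last (n : ℕ) (h : n + 1 = a) : projGen p ε a c .F (tVec a c n) = rVec a c 0 := by
  rw [tVec, dif_pos (by omega)]
  simp only [projGen, weightGen, onBasis_single, projF]
  rw [if_neg (by omega)]

theorem projF_b (n : ℕ) : projGen p ε a c .F (bVec a c n) = bVec a c (n + 1) := by
  by_cases h : n < a
  · rw [bVec, dif_pos h]
    simp only [projGen, weightGen, onBasis_single, projF]
  · rw [bVec, dif_neg h, bVec, dif_neg (by omega), map_zero]

theorem projF_l (k : ℕ) (h : k + 1 < c) : projGen p ε a c .F (lVec a c k) = lVec a c (k + 1) := by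
  rw [lVec, dif_pos (by omega)]
  simp only [projGen, weightGen, onBasis_single, projF]
  rw [if_pos h]

theorem projF_l_last (k : ℕ) (h : k + 1 = c) : projGen p ε a c .F (lVec a c k) = bVec a c 0 := by
  rw [lVec, dif_pos (by omega)]
  simp only [projGen, weightGen, onBasis_single, projF]
  rw [if_neg (by omega)]

theorem projF_r (k : ℕ) : projGen p ε a c .F (rVec a c k) = rVec a c (k + 1) := by
  by_cases h : k < c
  · rw [rVec, dif_pos h]
    simp only [projGen, weightGen, onBasis_single, projF]
  · rw [rVec, dif_neg h, rVec, dif_neg (by omega), map_zero]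

end act

theorem projGen_satisfies (p : ℕ) (ε : ℤˣ) (a c : ℕ) (ha : 0 < a) (hc : 0 < c) (h : a + c = p) :
    Satisfies p (projGen p ε a c) := by
  have hp : 2 ≤ p := by omega
  have hp0 : 0 < p := by omega
  obtain ⟨a, rfl⟩ : ∃ a', a = a' + 1 := ⟨a - 1, by omega⟩
  obtain ⟨c, rfl⟩ : ∃ c', c = c' + 1 := ⟨c - 1, by omega⟩
  refine weightGen_satisfies p _ _ _ ?_ ?_ ?_ ?_ ?_ heightE ?_ (projE_mem p ε hc) heightF ?_
    (projF_mem ha)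
  · rintro (n | n | k | k) <;> exact weight_ne p _ _
  · rintro (n | n | k | k) <;> exact weight_pow p hp0 _ _
  · have key : ∀ i, projGen p ε (a + 1) (c + 1) .K (projE p ε (a + 1) (c + 1) i) =
        (qq p ^ 2 * projWt p ε (a + 1) (c + 1) i) • projE p ε (a + 1) (c + 1) i := by
      rintro (⟨n, hn⟩ | ⟨n, hn⟩ | ⟨k, hk⟩ | ⟨k, hk⟩)
      · rcases n with _ | n
        · simp only [projE, projWt, if_true, projK_l, Nat.add_sub_cancel]
          rw [wt_cross' p hp0 ε _ _ _ h, wt_pred]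
        · simp only [projE, projWt, Nat.succ_ne_zero, if_false, Nat.add_sub_cancel, map_add,
            map_smul, projK_t, projK_b]
          rw [wt_pred, smul_add, smul_comm]
      · rcases n with _ | n
        · simp [projE, co_zero]
        · simp only [projE, projWt, Nat.add_sub_cancel, map_smul, projK_b]
          rw [wt_pred, smul_comm]
      · rcases k with _ | k
        · simp [projE, co_zero]
        · simp only [projE, projWt, Nat.add_sub_cancel, map_smul, projK_l]
          rw [wt_pred, smul_comm]
      · rcases k with _ | k
        · simp only [projE, projWt, if_true, projK_b, Nat.add_sub_cancel]
          rw [wt_cross p hp0 ε _ _ _ h, wt_pred]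
        · simp only [projE, projWt, Nat.succ_ne_zero, if_false, Nat.add_sub_cancel,
            map_smul, projK_r]
          rw [wt_pred, smul_comm]
    exact key
  · have key : ∀ i, projGen p ε (a + 1) (c + 1) .K (projF (a + 1) (c + 1) i) =
        ((qq p ^ 2)⁻¹ * projWt p ε (a + 1) (c + 1) i) • projF (a + 1) (c + 1) i := by
      rintro (⟨n, hn⟩ | ⟨n, hn⟩ | ⟨k, hk⟩ | ⟨k, hk⟩)
      · simp only [projF, projWt]
        split_ifs with h1
        · rw [projK_t, wt_succ]
        · obtain rfl : n = a := by omega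
          rw [projK_r, wt_cross p hp0 ε _ _ _ h, ← wt_succ]
      · simp only [projF, projWt]
        rw [projK_b, wt_succ]
      · simp only [projF, projWt]
        split_ifs with h1
        · rw [projK_l, wt_succ]
        · obtain rfl : k = c := by omega
          rw [projK_b, wt_cross' p hp0 ε _ _ _ h, ← wt_succ]
      · simp only [projF, projWt]
        rw [projK_r, wt_succ]
    exact key
  · have key : ∀ i, projGen p ε (a + 1) (c + 1) .E (projF (a + 1) (c + 1) i) -
        projGen p ε (a + 1) (c + 1) .F (projE p ε (a + 1) (c + 1) i) =
        ((qq p - (qq p)⁻¹)⁻¹ * (projWt p ε (a + 1) (c + 1) i -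
          (projWt p ε (a + 1) (c + 1) i)⁻¹)) • Finsupp.single i 1 := by
      rintro (⟨n, hn⟩ | ⟨n, hn⟩ | ⟨k, hk⟩ | ⟨k, hk⟩)
      · have e1 : (Finsupp.single (ProjIdx.t ⟨n, hn⟩) 1 : ProjSpace (a + 1) (c + 1)) =
            tVec (a + 1) (c + 1) n := by rw [tVec, dif_pos hn]
        have e2 : projGen p ε (a + 1) (c + 1) .E (projF (a + 1) (c + 1) (.t ⟨n, hn⟩)) =
            co p ε (a + 1) (n + 1) • tVec (a + 1) (c + 1) n + bVec (a + 1) (c + 1) n := by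
          simp only [projF]
          split_ifs with h1
          · rw [projE_t p ε n h1]
          · obtain rfl : n = a := by omega
            rw [projE_r_zero p ε hc, co_self, zero_smul, zero_add]
            rfl
        have e3 : projGen p ε (a + 1) (c + 1) .F (projE p ε (a + 1) (c + 1) (.t ⟨n, hn⟩)) =
            co p ε (a + 1) n • tVec (a + 1) (c + 1) n + bVec (a + 1) (c + 1) n := by
          rcases n with _ | n
          · simp only [projE, if_true, Nat.add_sub_cancel, co_zero, zero_smul, zero_add]
            rw [projF_l_last p ε c rfl]
          · simp only [projE, Nat.succ_ne_zero, if_false, Nat.add_sub_cancel, map_add, map_smul]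
            rw [projF_t p ε n hn, projF_b]
        rw [e1, e2, e3, add_sub_add_right_eq_sub, ← sub_smul, co_sub p hp]
        rfl
      · have e1 : (Finsupp.single (ProjIdx.b ⟨n, hn⟩) 1 : ProjSpace (a + 1) (c + 1)) =
            bVec (a + 1) (c + 1) n := by rw [bVec, dif_pos hn]
        have e3 : projGen p ε (a + 1) (c + 1) .F (projE p ε (a + 1) (c + 1) (.b ⟨n, hn⟩)) =
            co p ε (a + 1) n • bVec (a + 1) (c + 1) n := by
          rcases n with _ | n
          · simp [projE, co_zero]
          · simp only [projE, Nat.add_sub_cancel, map_smul, projF_b]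
        rw [e1, e3]
        simp only [projF, projWt]
        rw [projE_b, ← sub_smul, co_sub p hp]
      · have e1 : (Finsupp.single (ProjIdx.l ⟨k, hk⟩) 1 : ProjSpace (a + 1) (c + 1)) =
            lVec (a + 1) (c + 1) k := by rw [lVec, dif_pos hk]
        have e2 : projGen p ε (a + 1) (c + 1) .E (projF (a + 1) (c + 1) (.l ⟨k, hk⟩)) =
            co p (-ε) (c + 1) (k + 1) • lVec (a + 1) (c + 1) k := by
          simp only [projF]
          split_ifs with h1
          · rw [projE_l p ε k]
          · obtain rfl : k = c := by omega
            rw [projE_b_zero p ε, co_self, zero_smul]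
        have e3 : projGen p ε (a + 1) (c + 1) .F (projE p ε (a + 1) (c + 1) (.l ⟨k, hk⟩)) =
            co p (-ε) (c + 1) k • lVec (a + 1) (c + 1) k := by
          rcases k with _ | k
          · simp [projE, co_zero]
          · simp only [projE, Nat.add_sub_cancel, map_smul]
            rw [projF_l p ε k hk]
        rw [e1, e2, e3, ← sub_smul, co_sub p hp]
        rfl
      · have e1 : (Finsupp.single (ProjIdx.r ⟨k, hk⟩) 1 : ProjSpace (a + 1) (c + 1)) =
            rVec (a + 1) (c + 1) k := by rw [rVec, dif_pos hk]
        have e3 : projGen p ε (a + 1) (c + 1) .F (projE p ε (a + 1) (c + 1) (.r ⟨k, hk⟩)) =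
            co p (-ε) (c + 1) k • rVec (a + 1) (c + 1) k := by
          rcases k with _ | k
          · simp only [projE, if_true, Nat.add_sub_cancel, co_zero, zero_smul, projF_b]
            rw [bVec, dif_neg (by omega)]
          · simp only [projE, Nat.succ_ne_zero, if_false, Nat.add_sub_cancel, map_smul, projF_r]
        rw [e1, e3]
        simp only [projF, projWt]
        rw [projE_r, ← sub_smul, co_sub p hp]
    exact key
  · rintro (⟨n, hn⟩ | ⟨n, hn⟩ | ⟨k, hk⟩ | ⟨k, hk⟩) <;> simp only [heightE] <;> omega
  · rintro (⟨n, hn⟩ | ⟨n, hn⟩ | ⟨k, hk⟩ | ⟨k, hk⟩) <;> simp only [heightF] <;> omega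

/-- The projective module with top the irreducible module of dimension `a` and highest weight
`ε q ^ (a - 1)`. -/
def proj (p : ℕ) (ε : ℤˣ) (a c : ℕ) (ha : 0 < a) (hc : 0 < c) (h : a + c = p) :
    Uq p →ₐ[ℂ] Module.End ℂ (ProjSpace a c) :=
  lift p (projGen p ε a c) (projGen_satisfies p ε a c ha hc h)

end projective

/-- The projective module `P⁺_s`, `1 ≤ s ≤ p - 1`. -/
def projPlus (p s : ℕ) (h1 : 1 ≤ s) (h2 : s < p) : Uq p →ₐ[ℂ] Module.End ℂ (ProjSpace s (p - s)) :=
  proj p 1 s (p - s) h1 (by omega) (by omega)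

/-- The projective module `P⁻_(p - s)`, `1 ≤ s ≤ p - 1`. -/
def projMinus (p s : ℕ) (h1 : 1 ≤ s) (h2 : s < p) :
    Uq p →ₐ[ℂ] Module.End ℂ (ProjSpace (p - s) s) :=
  proj p (-1) (p - s) s (by omega) h1 (by omega)

/-- The direct sum `P⁺_s ⊕ P⁻_(p - s)`. -/
def projSum (p s : ℕ) (h1 : 1 ≤ s) (h2 : s < p) :
    Uq p →ₐ[ℂ] Module.End ℂ (ProjSpace s (p - s) × ProjSpace (p - s) s) :=
  (LinearMap.prodMapAlgHom ℂ _ _).comp ((projPlus p s h1 h2).prod (projMinus p s h1 h2))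

/-! ## Pseudotraces and the Radford map -/

/-- The linear map `b_n ↦ α t_n`, zero on all `t_n`, `l_k`, `r_k`. -/
def bottomToTop (α : ℂ) (a c : ℕ) : Module.End ℂ (ProjSpace a c) :=
  onBasis fun i => match i with
    | .b n => α • Finsupp.single (.t n) 1
    | _ => 0

/-- The coefficient `α_s = -a₀ [s] / (p (q - q⁻¹))`. -/
def alpha (p : ℕ) (a₀ : ℂ) (s : ℕ) : ℂ := -a₀ * (qInt p s / (p * (qq p - (qq p)⁻¹)))

/-- The map `σ_s` on `P⁺_s ⊕ P⁻_(p - s)`. -/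
def sigma (p : ℕ) (a₀ : ℂ) (s : ℕ) :
    Module.End ℂ (ProjSpace s (p - s) × ProjSpace (p - s) s) :=
  LinearMap.prodMap (bottomToTop (alpha p a₀ s) s (p - s)) (bottomToTop (alpha p a₀ s) (p - s) s)

/-- The pseudotrace `γ(s) : x ↦ Tr (g⁻¹ x σ_s)` over `P⁺_s ⊕ P⁻_(p - s)`, where
`g = K ^ (p + 1)` is the balancing element, so that `g⁻¹ = K ^ (p - 1)`. -/
def pseudotrace (p : ℕ) (a₀ : ℂ) (s : ℕ) (h1 : 1 ≤ s) (h2 : s < p) : Uq p →ₗ[ℂ] ℂ :=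
  LinearMap.trace ℂ (ProjSpace s (p - s) × ProjSpace (p - s) s) ∘ₗ
    LinearMap.mulRight ℂ (sigma p a₀ s) ∘ₗ (projSum p s h1 h2).toLinearMap ∘ₗ
    LinearMap.mulLeft ℂ (K p ^ (p - 1))

/-- The two-sided cointegral `c = ζ F^(p-1) E^(p-1) ∑_(0 ≤ j < 2p) K^j`, in the normalization
`ζ = √(p / 2) / ([p - 1]!)²`. -/
def cointegral (p : ℕ) : Uq p :=
  ((Real.sqrt ((p : ℝ) / 2) : ℂ) / qFactorial p (p - 1) ^ 2) •
    (F p ^ (p - 1) * E p ^ (p - 1) * ∑ j ∈ Finset.range (2 * p), K p ^ j)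

/-- The Radford map `φ(β) = ∑ β(c') c''`, where `Δ(c) = ∑ c' ⊗ c''`. -/
def radford (p : ℕ) [NeZero p] (β : Uq p →ₗ[ℂ] ℂ) : Uq p :=
  TensorProduct.lid ℂ (Uq p) (LinearMap.rTensor (Uq p) β (Coalgebra.comul (R := ℂ) (cointegral p)))

/-! ## The canonical central elements -/

/-- The index set `1 ≤ s ≤ p - 1`. -/
abbrev Idx (p : ℕ) : Type := {s : ℕ // 1 ≤ s ∧ s < p}

/-- The inclusion of `1 ≤ s ≤ p - 1` in `0 ≤ s ≤ p`. -/
def Idx.toFin {p : ℕ} (s : Idx p) : Fin (p + 1) := ⟨s, Nat.lt_succ_of_lt s.2.2⟩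

/-- Families `e_s` (`0 ≤ s ≤ p`) and `w⁺_s`, `w⁻_s` (`1 ≤ s ≤ p - 1`) of elements. -/
@[ext]
structure Family (p : ℕ) where
  /-- The elements `e_s`. -/
  e : Fin (p + 1) → Uq p
  /-- The elements `w⁺_s`. -/
  wPlus : Idx p → Uq p
  /-- The elements `w⁻_s`. -/
  wMinus : Idx p → Uq p

/-- The families of canonical central elements: the primitive idempotents `e_s` of the centre,
labelled by the irreducible modules on which they act as the identity, and the nilpotent central
elements `w⁺_s`, `w⁻_s`, normalized by their action on the top vectors of the projective
modules. -/
structure Family.IsCanonical {p : ℕ} (hp : 2 ≤ p) (C : Family p) : Prop where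
  e_mem : ∀ s, C.e s ∈ Subalgebra.center ℂ (Uq p)
  wPlus_mem : ∀ s, C.wPlus s ∈ Subalgebra.center ℂ (Uq p)
  wMinus_mem : ∀ s, C.wMinus s ∈ Subalgebra.center ℂ (Uq p)
  e_mul_e : ∀ s s', C.e s * C.e s' = if s = s' then C.e s else 0
  e_ne_zero : ∀ s, C.e s ≠ 0
  e_primitive : ∀ s, ∀ f ∈ Subalgebra.center ℂ (Uq p), f * f = f → C.e s * f = f →
    f = 0 ∨ f = C.e s
  e_mul_wPlus : ∀ s s', C.e s * C.wPlus s' = if s = s'.toFin then C.wPlus s' else 0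
  e_mul_wMinus : ∀ s s', C.e s * C.wMinus s' = if s = s'.toFin then C.wMinus s' else 0
  wPlus_mul_wPlus : ∀ s s', C.wPlus s * C.wPlus s' = 0
  wPlus_mul_wMinus : ∀ s s', C.wPlus s * C.wMinus s' = 0
  wMinus_mul_wMinus : ∀ s s', C.wMinus s * C.wMinus s' = 0
  /-- For `1 ≤ s ≤ p`, `e_s` is the identity on the irreducible module `X⁺_s`. -/
  e_irr : ∀ s : Fin (p + 1), s ≠ 0 → irr p 1 s hp (Nat.lt_succ_iff.1 s.2) (C.e s) = 1
  /-- `e_0` is the identity on the irreducible module `X⁻_p`. -/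
  e_zero_irr : irr p (-1) p hp le_rfl (C.e 0) = 1
  /-- `w⁺_s t_n = b_n` in `P⁺_s`. -/
  wPlus_plus : ∀ (s : Idx p) (n : Fin s.1), projPlus p s s.2.1 s.2.2 (C.wPlus s)
    (Finsupp.single (.t n) 1) = Finsupp.single (.b n) 1
  /-- `w⁺_s t_k = 0` in `P⁻_(p - s)`. -/
  wPlus_minus : ∀ (s : Idx p) (k : Fin (p - s.1)), projMinus p s s.2.1 s.2.2 (C.wPlus s)
    (Finsupp.single (.t k) 1) = 0
  /-- `w⁻_s t_k = b_k` in `P⁻_(p - s)`. -/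
  wMinus_minus : ∀ (s : Idx p) (k : Fin (p - s.1)), projMinus p s s.2.1 s.2.2 (C.wMinus s)
    (Finsupp.single (.t k) 1) = Finsupp.single (.b k) 1
  /-- `w⁻_s t_n = 0` in `P⁺_s`. -/
  wMinus_plus : ∀ (s : Idx p) (n : Fin s.1), projPlus p s s.2.1 s.2.2 (C.wMinus s)
    (Finsupp.single (.t n) 1) = 0

end RestrictedQuantumGroup

end

/-!
The theorem is proved by letting both sides act on a faithful module: the direct sum of the modules
`P^ε_a` of dimension `2p` and the simple modules `X^±_p`. By the spanning half of the
Poincaré–Birkhoff–Witt theorem every element is a combination of the `F ^ i E ^ j K ^ k`, and in a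
nonzero two-sided ideal one can move the first coefficient to `F ^ (p - 1) E ^ (p - 1)` times a
weight projector, which does not vanish on the lowest vector of the top of a suitable module
(`IsNull.eq_zero`). A central element acts on `P^ε_a` as `x + y N`, where `N : t_n ↦ b_n`, with
equal `x` for the two modules of a block, so it is determined by the numbers `x`, `y⁺`, `y⁻` of each
block (`exists_actsBy`, `ActsBy.ext`).

The Casimir element `C` has a different eigenvalue `β_s` on each block and acts on the modules
`P^ε_a` as `β_s + N`. Polynomials in `C` therefore give the idempotents `e_s` and the sums
`w⁺_s + w⁻_s`, and a projector to the weights of `X⁺_s` separates `w⁺_s` from `w⁻_s`. Conversely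
the conditions on the canonical central elements determine the numbers `x`, `y⁺`, `y⁻`. This gives
existence and uniqueness (`existsUnique_isCanonical`).

For the Radford image, write `γ(s)(x) = α τ(K ^ (p - 1) x)` with `τ` the sum over the two modules of
the block of the matrix coefficients from `t_n` to `b_n`. The functional `τ` is symmetric, since the
failures of symmetry of the two summands cancel (`blockTrace_mul_comm`). As the cointegral is
two-sided, an element can be moved from one leg of its coproduct to the other at the cost of the
antipode. Hence `φ(s)` is central (`contractLeft_mem_center`), and since `(C - β_s)²` annihilates
the block, `φ(s)` is annihilated by `(C - β_s)²` and supported on that block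
(`casimir_sub_sq_mul_contractLeft`).

It remains to let `φ(s)` act on the highest weight vector `t_0` of the top of both modules. In the
`q`-binomial expansion of the coproduct only the terms `F ^ i E ^ i ⊗ F ^ m E ^ m` with
`i + m = p - 1` contribute, and the sum over the powers of `K` selects the matrix coefficient at the
lowest vector `t_(a - 1)`. Since `F ^ m E ^ m` is a product of shifts of `C`, it acts on `t_n` as
`∏ (κ_j + N)` with explicit `κ_j` (`proj_F_pow_mul_E_pow_t`). The sum over `m` collapses to
`α R (1 + H N)`, where `R` is the product and `H` the sum of the inverses of the nonzero numbers among
`ε [-k] [a + k]`, `0 < k < p` (`sum_derivProd_mul_derivProd`). The harmonic sum telescopes to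
`H = -ε (q ^ a + q ^ (-a)) / [a]²` (`sum_inv_kappa`), the product is given by `prod_kappa`, and the
constants combine to the stated ones (`cointegral_mul_alpha_mul_kappaProd`).
-/

noncomputable section

namespace RestrictedQuantumGroup

/-! ### Generation, weights and the Casimir element -/

theorem adjoin_range_cls (p : ℕ) : Algebra.adjoin ℂ (Set.range (cls p)) = ⊤ := by
  have h1 : Set.range (cls p) =
      RingQuot.mkAlgHom ℂ (Rel p) '' Set.range (FreeAlgebra.ι ℂ : Gen → FreeAlgebra ℂ Gen) := by
    rw [← Set.range_comp]
    rfl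
  rw [h1, ← AlgHom.map_adjoin, FreeAlgebra.adjoin_range_ι, Algebra.map_top,
    AlgHom.range_eq_top]
  exact RingQuot.mkAlgHom_surjective ℂ (Rel p)

theorem Ki_eq_pow (p : ℕ) (hp : 0 < p) : Ki p = K p ^ (2 * p - 1) := by
  have r := cls_satisfies p
  have h : K p * K p ^ (2 * p - 1) = 1 := by
    rw [← pow_succ', show 2 * p - 1 + 1 = 2 * p by omega]
    exact r.K_pow
  calc Ki p = Ki p * (K p * K p ^ (2 * p - 1)) := by rw [h, mul_one]
    _ = K p ^ (2 * p - 1) := by rw [← mul_assoc, r.Ki_K, one_mul]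

/-- Since `K⁻¹ = K ^ (2p - 1)`, the algebra is generated by `E`, `F` and `K`. -/
theorem Uq.induction {p : ℕ} (hp : 0 < p) {P : Uq p → Prop} (hE : P (E p)) (hF : P (F p))
    (hK : P (K p)) (hc : ∀ c : ℂ, P (algebraMap ℂ (Uq p) c))
    (hadd : ∀ x y, P x → P y → P (x + y)) (hmul : ∀ x y, P x → P y → P (x * y)) (x : Uq p) :
    P x := by
  have hpow : ∀ n : ℕ, P (K p ^ n) := by
    intro n
    induction n with
    | zero => simpa using hc 1
    | succ n ih => rw [pow_succ]; exact hmul _ _ ih hK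
  have hx : x ∈ Algebra.adjoin ℂ (Set.range (cls p)) := by
    rw [adjoin_range_cls]; trivial
  induction hx using Algebra.adjoin_induction with
  | mem x hx =>
    obtain ⟨g, rfl⟩ := hx
    cases g
    · exact hE
    · exact hF
    · exact hK
    · change P (Ki p)
      rw [Ki_eq_pow p hp]
      exact hpow _
  | algebraMap c => exact hc c
  | add x y _ _ hx hy => exact hadd x y hx hy
  | mul x y _ _ hx hy => exact hmul x y hx hy

theorem mem_center_iff {p : ℕ} (hp : 0 < p) {z : Uq p} :
    z ∈ Subalgebra.center ℂ (Uq p) ↔ Commute (E p) z ∧ Commute (F p) z ∧ Commute (K p) z := by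
  rw [Subalgebra.mem_center_iff]
  refine ⟨fun h => ⟨h _, h _, h _⟩, fun ⟨hE, hF, hK⟩ x => ?_⟩
  exact Uq.induction hp (P := fun x => Commute x z) hE hF hK
    (fun c => Algebra.commutes c z) (fun _ _ => Commute.add_left) (fun _ _ => Commute.mul_left) x

section relations
variable (p : ℕ)

theorem K_mul_Ki : K p * Ki p = 1 := (cls_satisfies p).K_Ki
theorem Ki_mul_K : Ki p * K p = 1 := (cls_satisfies p).Ki_K
theorem E_pow_self : E p ^ p = 0 := (cls_satisfies p).E_pow
theorem F_pow_self : F p ^ p = 0 := (cls_satisfies p).F_pow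
theorem K_pow_two_mul : K p ^ (2 * p) = 1 := (cls_satisfies p).K_pow

/-- `x` has weight `m` for the adjoint action of `K`: `K x = q ^ (2m) x K`. -/
def HasWeight (x : Uq p) (m : ℤ) : Prop := K p * x = qq p ^ (2 * m) • (x * K p)

variable {p}

theorem hasWeight_E : HasWeight p (E p) 1 := by
  have := (cls_satisfies p).K_E
  rwa [HasWeight, mul_one, zpow_ofNat]

theorem hasWeight_F : HasWeight p (F p) (-1) := by
  have := (cls_satisfies p).K_F
  rwa [HasWeight, mul_neg, mul_one, zpow_neg, zpow_ofNat]

theorem HasWeight.mul {x y : Uq p} {m n : ℤ} (hx : HasWeight p x m) (hy : HasWeight p y n) :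
    HasWeight p (x * y) (m + n) := by
  unfold HasWeight at *
  rw [← mul_assoc, hx, smul_mul_assoc, mul_assoc, hy, mul_smul_comm, smul_smul, mul_add,
    zpow_add₀ (qq_ne_zero p), mul_assoc]

theorem hasWeight_one : HasWeight p 1 0 := by simp [HasWeight]

theorem HasWeight.pow {x : Uq p} {m : ℤ} (hx : HasWeight p x m) (n : ℕ) :
    HasWeight p (x ^ n) (n * m) := by
  induction n with
  | zero => simpa using hasWeight_one
  | succ n ih =>
    have h : ((n + 1 : ℕ) : ℤ) * m = n * m + m := by push_cast; ring
    rw [pow_succ, h]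
    exact ih.mul hx

theorem HasWeight.commute {x : Uq p} (hx : HasWeight p x 0) : Commute (K p) x := by
  have h : K p * x = _ := hx
  rw [mul_zero, zpow_zero, one_smul] at h
  exact h

theorem HasWeight.Ki_mul {x : Uq p} {m : ℤ} (hx : HasWeight p x m) :
    Ki p * x = (qq p ^ (2 * m))⁻¹ • (x * Ki p) := by
  have h0 : qq p ^ (2 * m) ≠ 0 := zpow_ne_zero _ (qq_ne_zero p)
  have h1 : x * K p = (qq p ^ (2 * m))⁻¹ • (K p * x) := by
    rw [hx, smul_smul, inv_mul_cancel₀ h0, one_smul]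
  calc Ki p * x = Ki p * (x * K p) * Ki p := by rw [mul_assoc, mul_assoc, K_mul_Ki, mul_one]
    _ = (qq p ^ (2 * m))⁻¹ • (x * Ki p) := by
      rw [h1, mul_smul_comm, ← mul_assoc, Ki_mul_K, one_mul, smul_mul_assoc]

theorem HasWeight.K_pow_mul {x : Uq p} {m : ℤ} (hx : HasWeight p x m) (n : ℕ) :
    K p ^ n * x = (qq p ^ (2 * m)) ^ n • (x * K p ^ n) := by
  induction n with
  | zero => simp
  | succ n ih =>
    rw [pow_succ', mul_assoc, ih, mul_smul_comm, ← mul_assoc, hx, smul_mul_assoc, smul_smul,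
      mul_assoc, ← pow_succ', ← pow_succ]

variable (p)

/-- The square of `q - q⁻¹`. -/
def nu : ℂ := (qq p - (qq p)⁻¹) ^ 2

theorem nu_ne_zero (hp : 2 ≤ p) : nu p ≠ 0 := pow_ne_zero _ (qq_sub_inv_ne p hp)

/-- The element `(q ^ m K + q ^ (-m) K⁻¹) / (q - q⁻¹)²`. -/
def qCosh (m : ℤ) : Uq p := (nu p)⁻¹ • (qq p ^ m • K p + (qq p ^ m)⁻¹ • Ki p)

/-- The Casimir element, normalized so that `F E` has coefficient `1`. -/
def casimir : Uq p := F p * E p + qCosh p 1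

theorem F_mul_E : F p * E p = casimir p - qCosh p 1 := by rw [casimir, add_sub_cancel_right]

theorem E_mul_F (hp : 2 ≤ p) : E p * F p = casimir p - qCosh p (-1) := by
  have h1 : E p * F p = F p * E p + (qq p - (qq p)⁻¹)⁻¹ • (K p - Ki p) := by
    rw [← (cls_satisfies p).E_F]; abel
  have h0 := qq_sub_inv_ne p hp
  have hq := qq_ne_zero p
  have h2 : (qq p - (qq p)⁻¹)⁻¹ = (nu p)⁻¹ * (qq p - (qq p)⁻¹) := by
    rw [nu]; field_simp
  rw [h1, casimir, qCosh, qCosh, h2, zpow_neg, zpow_one, inv_inv]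
  module

variable {p}

/-- Moving `q ^ m K + q ^ (-m) K⁻¹` across an element of weight `n` shifts `m` by `2n`. -/
theorem HasWeight.qCosh_mul {x : Uq p} {n : ℤ} (hx : HasWeight p x n) (m : ℤ) :
    qCosh p m * x = x * qCosh p (m + 2 * n) := by
  have hK : K p * x = _ := hx
  have hKi := hx.Ki_mul
  rw [qCosh, qCosh, zpow_add₀ (qq_ne_zero p)]
  simp only [smul_mul_assoc, mul_smul_comm, add_mul, mul_add, hK, hKi, smul_smul, mul_inv]

theorem commute_casimir (hp : 2 ≤ p) :
    Commute (E p) (casimir p) ∧ Commute (F p) (casimir p) ∧ Commute (K p) (casimir p) := by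
  refine ⟨?_, ?_, ?_⟩
  · have h1 : casimir p * E p = E p * F p * E p + qCosh p (-1) * E p := by
      rw [E_mul_F p hp, sub_mul, sub_add_cancel]
    have h2 : E p * casimir p = E p * F p * E p + E p * qCosh p 1 := by
      rw [casimir]; noncomm_ring
    rw [Commute, SemiconjBy, h1, h2, hasWeight_E.qCosh_mul]
    rfl
  · have h1 : F p * casimir p = F p * E p * F p + F p * qCosh p (-1) := by
      rw [mul_assoc, E_mul_F p hp, mul_sub, sub_add_cancel]
    have h2 : casimir p * F p = F p * E p * F p + qCosh p 1 * F p := by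
      rw [casimir]; noncomm_ring
    rw [Commute, SemiconjBy, h1, h2, hasWeight_F.qCosh_mul]
    rfl
  · have h1 : Commute (K p) (F p * E p) := (hasWeight_F.mul hasWeight_E).commute
    have h2 : Commute (K p) (Ki p) := by rw [Commute, SemiconjBy, K_mul_Ki, Ki_mul_K]
    rw [casimir, qCosh]
    exact h1.add_right ((((Commute.refl _).smul_right _).add_right (h2.smul_right _)).smul_right _)

theorem E_mul_F_pow (hp : 2 ≤ p) (n : ℕ) :
    E p * F p ^ (n + 1) = F p ^ n * (casimir p - qCosh p (-1 - 2 * n)) := by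
  have hc : Commute (F p ^ n) (casimir p) := (commute_casimir hp).2.1.pow_left n
  rw [pow_succ', ← mul_assoc, E_mul_F p hp, sub_mul, (hasWeight_F.pow n).qCosh_mul, mul_sub, hc.eq]
  congr 3
  ring_nf

/-- The key relation that expresses the products `F ^ m E ^ m` by the Casimir element and `K`. -/
theorem F_pow_mul_E_pow_succ (hp : 2 ≤ p) (m : ℕ) :
    F p ^ (m + 1) * E p ^ (m + 1) = F p ^ m * E p ^ m * (casimir p - qCosh p (1 + 2 * m)) := by
  have hc : Commute (E p ^ m) (casimir p) := (commute_casimir hp).1.pow_left m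
  have hw := (hasWeight_E.pow (p := p) m).qCosh_mul 1
  rw [mul_one] at hw
  calc F p ^ (m + 1) * E p ^ (m + 1) = F p ^ m * (F p * E p) * E p ^ m := by
        rw [pow_succ, pow_succ']; noncomm_ring
    _ = F p ^ m * ((casimir p) * E p ^ m) - F p ^ m * (qCosh p 1 * E p ^ m) := by
        rw [F_mul_E, mul_assoc, sub_mul, mul_sub]
    _ = _ := by rw [← hc.eq, hw, mul_sub, mul_assoc, mul_assoc]

end relations

/-! ### Homomorphisms between the modules -/

/-- A linear map that commutes with the actions of `E`, `F` and `K` is a module homomorphism. -/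
theorem intertwines {p : ℕ} (hp : 0 < p) {V W : Type*} [AddCommGroup V] [Module ℂ V]
    [AddCommGroup W] [Module ℂ W] (ρ : Uq p →ₐ[ℂ] Module.End ℂ V) (σ : Uq p →ₐ[ℂ] Module.End ℂ W)
    (f : V →ₗ[ℂ] W) (hE : f ∘ₗ ρ (E p) = σ (E p) ∘ₗ f) (hF : f ∘ₗ ρ (F p) = σ (F p) ∘ₗ f)
    (hK : f ∘ₗ ρ (K p) = σ (K p) ∘ₗ f) (x : Uq p) : f ∘ₗ ρ x = σ x ∘ₗ f := by
  refine Uq.induction hp (P := fun x => f ∘ₗ ρ x = σ x ∘ₗ f) hE hF hK ?_ ?_ ?_ x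
  · intro c
    ext v
    simp [Algebra.algebraMap_eq_smul_one]
  · intro x y hx hy
    rw [map_add, map_add, LinearMap.comp_add, LinearMap.add_comp, hx, hy]
  · intro x y hx hy
    rw [map_mul, map_mul, Module.End.mul_eq_comp, Module.End.mul_eq_comp, ← LinearMap.comp_assoc,
      hx, LinearMap.comp_assoc, hy, LinearMap.comp_assoc]

theorem projSpace_hom_ext {a c : ℕ} {W : Type*} [AddCommMonoid W] [Module ℂ W]
    {f g : ProjSpace a c →ₗ[ℂ] W}
    (ht : ∀ n, n < a → f (tVec a c n) = g (tVec a c n))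
    (hb : ∀ n, n < a → f (bVec a c n) = g (bVec a c n))
    (hl : ∀ k, k < c → f (lVec a c k) = g (lVec a c k))
    (hr : ∀ k, k < c → f (rVec a c k) = g (rVec a c k)) : f = g := by
  refine Finsupp.lhom_ext' fun i => LinearMap.ext_ring ?_
  rcases i with ⟨n, hn⟩ | ⟨n, hn⟩ | ⟨n, hn⟩ | ⟨n, hn⟩
  · simpa [tVec, hn] using ht n hn
  · simpa [bVec, hn] using hb n hn
  · simpa [lVec, hn] using hl n hn
  · simpa [rVec, hn] using hr n hn

theorem irr_hom_ext {s : ℕ} {W : Type*} [AddCommMonoid W] [Module ℂ W]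
    {f g : (Fin s →₀ ℂ) →ₗ[ℂ] W} (h : ∀ n, n < s → f (irrVec s n) = g (irrVec s n)) : f = g := by
  refine Finsupp.lhom_ext' fun i => LinearMap.ext_ring ?_
  obtain ⟨n, hn⟩ := i
  simpa [irrVec, hn] using h n hn

/-- The nilpotent endomorphism `t_n ↦ b_n` of a projective module. -/
def topToBottom (a c : ℕ) : Module.End ℂ (ProjSpace a c) :=
  onBasis fun i => match i with
    | .t n => Finsupp.single (.b n) 1
    | _ => 0

/-- The map between the two projective modules of a block that sends the top of the source to the
left constituent of the target: `t_k ↦ l_k`, `r_n ↦ b_n`. -/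
def topToLeft (a c : ℕ) : ProjSpace c a →ₗ[ℂ] ProjSpace a c :=
  Finsupp.linearCombination ℂ fun i => match i with
    | .t k => Finsupp.single (.l k) 1
    | .r n => Finsupp.single (.b n) 1
    | _ => 0

/-- The map between the two projective modules of a block that sends the top of the source to the
right constituent of the target: `t_k ↦ r_k`, `l_n ↦ b_n`. -/
def topToRight (a c : ℕ) : ProjSpace c a →ₗ[ℂ] ProjSpace a c :=
  Finsupp.linearCombination ℂ fun i => match i with
    | .t k => Finsupp.single (.r k) 1
    | .l n => Finsupp.single (.b n) 1
    | _ => 0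

/-- The inclusion of an irreducible module as the socle of its projective cover. -/
def irrToBottom (a c : ℕ) : (Fin a →₀ ℂ) →ₗ[ℂ] ProjSpace a c :=
  Finsupp.linearCombination ℂ fun n => Finsupp.single (.b n) 1

section vectors
variable (a c n : ℕ)

theorem bVec_eq_zero (h : a ≤ n) : bVec a c n = 0 := by rw [bVec, dif_neg (by omega)]
theorem rVec_eq_zero (h : c ≤ n) : rVec a c n = 0 := by rw [rVec, dif_neg (by omega)]

@[simp] theorem topToBottom_t : topToBottom a c (tVec a c n) = bVec a c n := by
  rw [tVec, bVec]; split_ifs <;> simp [topToBottom]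
@[simp] theorem topToBottom_b : topToBottom a c (bVec a c n) = 0 := by
  rw [bVec]; split_ifs <;> simp [topToBottom]
@[simp] theorem topToBottom_l : topToBottom a c (lVec a c n) = 0 := by
  rw [lVec]; split_ifs <;> simp [topToBottom]
@[simp] theorem topToBottom_r : topToBottom a c (rVec a c n) = 0 := by
  rw [rVec]; split_ifs <;> simp [topToBottom]

@[simp] theorem topToLeft_t : topToLeft a c (tVec c a n) = lVec a c n := by
  rw [tVec, lVec]; split_ifs <;> simp [topToLeft]
@[simp] theorem topToLeft_b : topToLeft a c (bVec c a n) = 0 := by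
  rw [bVec]; split_ifs <;> simp [topToLeft]
@[simp] theorem topToLeft_l : topToLeft a c (lVec c a n) = 0 := by
  rw [lVec]; split_ifs <;> simp [topToLeft]
@[simp] theorem topToLeft_r : topToLeft a c (rVec c a n) = bVec a c n := by
  rw [rVec, bVec]; split_ifs <;> simp [topToLeft]

@[simp] theorem topToRight_t : topToRight a c (tVec c a n) = rVec a c n := by
  rw [tVec, rVec]; split_ifs <;> simp [topToRight]
@[simp] theorem topToRight_b : topToRight a c (bVec c a n) = 0 := by
  rw [bVec]; split_ifs <;> simp [topToRight]
@[simp] theorem topToRight_l : topToRight a c (lVec c a n) = bVec a c n := by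
  rw [lVec, bVec]; split_ifs <;> simp [topToRight]
@[simp] theorem topToRight_r : topToRight a c (rVec c a n) = 0 := by
  rw [rVec]; split_ifs <;> simp [topToRight]

@[simp] theorem irrToBottom_irrVec : irrToBottom a c (irrVec a n) = bVec a c n := by
  rw [irrVec, bVec]; split_ifs <;> simp [irrToBottom]

end vectors

theorem topToBottom_mul_self (a c : ℕ) : topToBottom a c * topToBottom a c = 0 :=
  projSpace_hom_ext (by simp) (by simp) (by simp) (by simp)

section proj
variable {p a c : ℕ} {ε : ℤˣ} (ha : 0 < a) (hc : 0 < c) (h : a + c = p)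

@[simp] theorem proj_cls (g : Gen) : proj p ε a c ha hc h (cls p g) = projGen p ε a c g :=
  lift_cls _ _ _ _

theorem projE_l_zero : projGen p ε a c .E (lVec a c 0) = 0 := by
  rw [lVec]
  split_ifs with h
  · simp only [projGen, weightGen, onBasis_single, projE, co_zero, zero_smul]
  · simp

theorem topToBottom_intertwines (x : Uq p) :
    topToBottom a c ∘ₗ proj p ε a c ha hc h x = proj p ε a c ha hc h x ∘ₗ topToBottom a c := by
  refine intertwines (by omega) _ _ _ ?_ ?_ ?_ x
  · refine projSpace_hom_ext ?_ ?_ ?_ ?_ <;> rintro (_ | n) hn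
    · simp [projE_t_zero p ε ha, projE_b_zero]
    · simp [projE_t p ε n hn, projE_b]
    · simp [projE_b_zero]
    · simp [projE_b]
    · simp [projE_l_zero]
    · simp [projE_l]
    · simp [projE_r_zero p ε hc]
    · simp [projE_r]
  · refine projSpace_hom_ext ?_ ?_ ?_ ?_ <;> intro n hn
    · obtain h1 | h1 : n + 1 < a ∨ n + 1 = a := by omega
      · simp [projF_t p ε n h1, projF_b]
      · simp [projF_t_last p ε n h1, projF_b, bVec_eq_zero a c _ h1.ge]
    · simp [projF_b]
    · obtain h1 | h1 : n + 1 < c ∨ n + 1 = c := by omega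
      · simp [projF_l p ε n h1]
      · simp [projF_l_last p ε n h1]
    · simp [projF_r]
  · refine projSpace_hom_ext ?_ ?_ ?_ ?_ <;> intro n hn <;>
      simp [projK_t, projK_b, projK_l, projK_r]

theorem topToLeft_intertwines (x : Uq p) :
    topToLeft a c ∘ₗ proj p (-ε) c a hc ha ((Nat.add_comm c a).trans h) x =
      proj p ε a c ha hc h x ∘ₗ topToLeft a c := by
  refine intertwines (by omega) _ _ _ ?_ ?_ ?_ x
  · refine projSpace_hom_ext ?_ ?_ ?_ ?_ <;> rintro (_ | n) hn
    · simp [projE_t_zero p (-ε) hc, projE_l_zero]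
    · simp [projE_t p (-ε) n hn, projE_l]
    · simp [projE_b_zero]
    · simp [projE_b]
    · simp [projE_l_zero]
    · simp [projE_l]
    · simp [projE_r_zero p (-ε) ha, projE_b_zero]
    · simp [projE_r, projE_b]
  · refine projSpace_hom_ext ?_ ?_ ?_ ?_ <;> intro n hn
    · obtain h1 | h1 : n + 1 < c ∨ n + 1 = c := by omega
      · simp [projF_t p (-ε) n h1, projF_l p ε n h1]
      · simp [projF_t_last p (-ε) n h1, projF_l_last p ε n h1]
    · simp [projF_b]
    · obtain h1 | h1 : n + 1 < a ∨ n + 1 = a := by omega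
      · simp [projF_l p (-ε) n h1]
      · simp [projF_l_last p (-ε) n h1]
    · simp [projF_r, projF_b]
  · refine projSpace_hom_ext ?_ ?_ ?_ ?_ <;> intro n hn <;>
      simp [projK_t, projK_b, projK_l, projK_r]

theorem topToRight_intertwines (x : Uq p) :
    topToRight a c ∘ₗ proj p (-ε) c a hc ha ((Nat.add_comm c a).trans h) x =
      proj p ε a c ha hc h x ∘ₗ topToRight a c := by
  refine intertwines (by omega) _ _ _ ?_ ?_ ?_ x
  · refine projSpace_hom_ext ?_ ?_ ?_ ?_ <;> rintro (_ | n) hn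
    · simp [projE_t_zero p (-ε) hc, projE_r_zero p ε hc]
    · simp [projE_t p (-ε) n hn, projE_r]
    · simp [projE_b_zero]
    · simp [projE_b]
    · simp [projE_l_zero, projE_b_zero]
    · simp [projE_l, projE_b]
    · simp [projE_r_zero p (-ε) ha]
    · simp [projE_r]
  · refine projSpace_hom_ext ?_ ?_ ?_ ?_ <;> intro n hn
    · obtain h1 | h1 : n + 1 < c ∨ n + 1 = c := by omega
      · simp [projF_t p (-ε) n h1, projF_r]
      · simp [projF_t_last p (-ε) n h1, projF_r, rVec_eq_zero a c _ h1.ge]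
    · simp [projF_b]
    · obtain h1 | h1 : n + 1 < a ∨ n + 1 = a := by omega
      · simp [projF_l p (-ε) n h1, projF_b]
      · simp [projF_l_last p (-ε) n h1, projF_b, bVec_eq_zero a c _ h1.ge]
    · simp [projF_r]
  · refine projSpace_hom_ext ?_ ?_ ?_ ?_ <;> intro n hn <;>
      simp [projK_t, projK_b, projK_l, projK_r]

end proj

section irr
variable {p : ℕ} (ε : ℤˣ) (s : ℕ) (hp : 2 ≤ p) (hs : s ≤ p)

@[simp] theorem irr_cls (g : Gen) : irr p ε s hp hs (cls p g) = irrGen p ε s g :=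
  lift_cls _ _ _ _

theorem irrK_irrVec (n : ℕ) : irrGen p ε s .K (irrVec s n) = wt p ε s n • irrVec s n := by
  rw [irrVec]
  split_ifs with h
  · simp only [irrGen, weightGen, onBasis_single]
  · simp

theorem irrE_irrVec_zero : irrGen p ε s .E (irrVec s 0) = 0 := by
  rw [irrVec]
  split_ifs with h
  · simp only [irrGen, weightGen, onBasis_single, co_zero, zero_smul]
  · simp

theorem irrE_irrVec (n : ℕ) :
    irrGen p ε s .E (irrVec s (n + 1)) = co p ε s (n + 1) • irrVec s n := by
  rcases Nat.lt_trichotomy (n + 1) s with h | h | h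
  · rw [irrVec, dif_pos h]
    simp only [irrGen, weightGen, onBasis_single, Nat.add_sub_cancel]
  · subst h
    rw [co_self, zero_smul, irrVec, dif_neg (lt_irrefl _), map_zero]
  · rw [irrVec, dif_neg (by omega), map_zero, irrVec, dif_neg (by omega), smul_zero]

theorem irrF_irrVec (n : ℕ) : irrGen p ε s .F (irrVec s n) = irrVec s (n + 1) := by
  by_cases h : n < s
  · rw [irrVec, dif_pos h]
    simp only [irrGen, weightGen, onBasis_single]
  · rw [irrVec, dif_neg h, irrVec, dif_neg (by omega), map_zero]

variable {ε} {a c : ℕ}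

theorem irrToBottom_intertwines (hp : 2 ≤ p) (ha : 0 < a) (hc : 0 < c) (h : a + c = p)
    (x : Uq p) : irrToBottom a c ∘ₗ irr p ε a hp (by omega) x =
      proj p ε a c ha hc h x ∘ₗ irrToBottom a c := by
  refine intertwines (by omega) _ _ _ ?_ ?_ ?_ x
  · refine irr_hom_ext ?_
    rintro (_ | n) hn
    · simp [irrE_irrVec_zero, projE_b_zero]
    · simp [irrE_irrVec, projE_b]
  · refine irr_hom_ext fun n hn => ?_
    simp [irrF_irrVec, projF_b]
  · refine irr_hom_ext fun n hn => ?_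
    simp [irrK_irrVec, projK_b]

end irr

/-! ### Arithmetic of `q`-numbers -/

section arithmetic
variable {p : ℕ}

theorem qq_primitive (hp : 0 < p) : IsPrimitiveRoot (qq p) (2 * p) := by
  have h := Complex.isPrimitiveRoot_exp (2 * p) (by omega)
  have e : qq p = Complex.exp (2 * Real.pi * Complex.I / ((2 * p : ℕ) : ℂ)) := by
    have h : (p : ℂ) ≠ 0 := by exact_mod_cast hp.ne'
    rw [qq]
    congr 1
    push_cast
    field_simp
  rwa [e]

theorem qq_zpow_eq_one_iff (hp : 0 < p) (n : ℤ) : qq p ^ n = 1 ↔ (2 * p : ℤ) ∣ n := by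
  have := (qq_primitive hp).zpow_eq_one_iff_dvd n
  rwa [Nat.cast_mul, Nat.cast_ofNat] at this

theorem qq_zpow_self (hp : 0 < p) : qq p ^ (p : ℤ) = -1 := by rw [zpow_natCast, qq_pow p hp]

theorem qInt_neg (n : ℤ) : qInt p (-n) = -qInt p n := by
  rw [qInt, qInt, neg_neg, ← neg_sub, neg_div]

theorem qInt_add_self (hp : 0 < p) (n : ℤ) : qInt p (n + p) = -qInt p n := by
  have h0 := qq_ne_zero p
  rw [qInt, qInt, neg_add, zpow_add₀ h0, zpow_add₀ h0, zpow_neg _ (p : ℤ), qq_zpow_self hp]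
  norm_num
  ring

theorem qInt_self_sub (hp : 0 < p) (n : ℤ) : qInt p (p - n) = qInt p n := by
  rw [sub_eq_neg_add, qInt_add_self hp, qInt_neg, neg_neg]

theorem qInt_ne_zero (hp : 2 ≤ p) {n : ℤ} (hn : ¬ (p : ℤ) ∣ n) : qInt p n ≠ 0 := by
  have h0 := qq_ne_zero p
  rw [qInt, div_ne_zero_iff, zpow_neg]
  refine ⟨fun h => hn ?_, qq_sub_inv_ne p hp⟩
  have hz : qq p ^ n ≠ 0 := zpow_ne_zero _ h0
  have h2 : qq p ^ (2 * n) = 1 := by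
    rw [two_mul, zpow_add₀ h0]
    field_simp at h
    linear_combination h
  rw [qq_zpow_eq_one_iff (by omega)] at h2
  exact (mul_dvd_mul_iff_left two_ne_zero).1 h2

theorem qInt_ne_zero_of_lt (hp : 2 ≤ p) {n : ℤ} (h1 : 0 < n) (h2 : n < p) : qInt p n ≠ 0 :=
  qInt_ne_zero hp fun h => by have := Int.le_of_dvd h1 h; omega

theorem geom_sum_root {N : ℕ} {z : ℂ} (hz : z ^ N = 1) :
    ∑ j ∈ Finset.range N, z ^ j = if z = 1 then (N : ℂ) else 0 := by
  split_ifs with h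
  · simp [h]
  · have := mul_geom_sum z N
    rw [hz, sub_self] at this
    exact (mul_eq_zero.1 this).resolve_left (sub_ne_zero.2 h)

theorem sgn_neg (ε : ℤˣ) : sgn (-ε) = -sgn ε := by simp [sgn]

/-- The coefficient `ε [j] [a - j]`, for an arbitrary integer `j`. -/
def kappa (p : ℕ) (ε : ℤˣ) (a : ℕ) (j : ℤ) : ℂ := sgn ε * qInt p j * qInt p (a - j)

theorem co_eq_kappa (ε : ℤˣ) (a n : ℕ) : co p ε a n = kappa p ε a n := rfl

theorem kappa_ne_zero (hp : 2 ≤ p) (ε : ℤˣ) (a : ℕ) {j : ℤ} (h1 : ¬ (p : ℤ) ∣ j)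
    (h2 : ¬ (p : ℤ) ∣ a - j) : kappa p ε a j ≠ 0 :=
  mul_ne_zero (mul_ne_zero (left_ne_zero_of_mul_eq_one (sgn_mul_self ε)) (qInt_ne_zero hp h1))
    (qInt_ne_zero hp h2)

theorem kappa_add_self (hp : 0 < p) (ε : ℤˣ) (a : ℕ) (j : ℤ) :
    kappa p ε a (j + p) = kappa p ε a j := by
  have h : (a : ℤ) - j = (a - (j + p)) + p := by ring
  rw [kappa, kappa, h, qInt_add_self hp, qInt_add_self hp]
  ring

theorem kappa_sub (ε : ℤˣ) (a : ℕ) (j : ℤ) : kappa p ε a (a - j) = kappa p ε a j := by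
  rw [kappa, kappa, sub_sub_cancel]
  ring

theorem kappa_zero (ε : ℤˣ) (a : ℕ) : kappa p ε a 0 = 0 := by simp [kappa, qInt_zero]

theorem kappa_self (ε : ℤˣ) (a : ℕ) : kappa p ε a a = 0 := by simp [kappa, qInt_zero]

/-- The eigenvalue `ε (q ^ a + q ^ (-a)) / (q - q⁻¹)²` of the Casimir element on the irreducible
module of dimension `a`. -/
def casimirEig (p : ℕ) (ε : ℤˣ) (a : ℕ) : ℂ :=
  (nu p)⁻¹ * (sgn ε * (qq p ^ (a : ℤ) + (qq p ^ (a : ℤ))⁻¹))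

theorem casimirEig_sub (hp : 2 ≤ p) (ε : ℤˣ) (a n : ℕ) (m : ℤ) :
    casimirEig p ε a - (nu p)⁻¹ * (qq p ^ (1 + 2 * m) * wt p ε a n +
      (qq p ^ (1 + 2 * m))⁻¹ * (wt p ε a n)⁻¹) = kappa p ε a (n - m) := by
  have h0 := qq_ne_zero p
  have h1 := qq_sub_inv_ne p hp
  have h2 : qq p ^ 2 - 1 ≠ 0 := by
    intro h
    apply h1
    field_simp
    linear_combination h
  have hn : qq p ^ (n : ℤ) ≠ 0 := zpow_ne_zero _ h0
  have hm : qq p ^ m ≠ 0 := zpow_ne_zero _ h0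
  have hs : qq p ^ (a : ℤ) ≠ 0 := zpow_ne_zero _ h0
  rw [wt, mul_inv, sgn_inv]
  simp only [casimirEig, kappa, nu, qInt, zpow_sub₀ h0, zpow_add₀ h0, zpow_neg, zpow_one,
    two_mul]
  generalize qq p ^ (n : ℤ) = x at *
  generalize qq p ^ m = y at *
  generalize qq p ^ (a : ℤ) = z at *
  field_simp
  ring

theorem casimirEig_zero (hp : 2 ≤ p) (ε : ℤˣ) (a n : ℕ) :
    (nu p)⁻¹ * (qq p * wt p ε a n + (qq p)⁻¹ * (wt p ε a n)⁻¹) =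
      casimirEig p ε a - kappa p ε a n := by
  have := casimirEig_sub hp ε a n 0
  rw [mul_zero, add_zero, zpow_one, sub_zero] at this
  rw [← this]
  ring

theorem casimirEig_cross (ε : ℤˣ) (a c : ℕ) (h : a + c = p) (hp : 0 < p) :
    casimirEig p (-ε) c = casimirEig p ε a := by
  have h0 := qq_ne_zero p
  have h1 : (c : ℤ) = p - a := by omega
  rw [casimirEig, casimirEig, h1, zpow_sub₀ h0, qq_zpow_self hp, sgn_neg]
  have hs : qq p ^ (a : ℤ) ≠ 0 := zpow_ne_zero _ h0
  field_simp
  ring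

/-- The derivative at `0` of the polynomial `∏ (f j + X)`. -/
def derivProd (f : ℕ → ℂ) (s : Finset ℕ) : ℂ := ∑ k ∈ s, ∏ j ∈ s.erase k, f j

theorem derivProd_range_succ (f : ℕ → ℂ) (m : ℕ) :
    derivProd f (Finset.range (m + 1)) =
      f m * derivProd f (Finset.range m) + ∏ j ∈ Finset.range m, f j := by
  rw [derivProd, derivProd, Finset.range_add_one, Finset.sum_insert (by simp),
    Finset.erase_insert (by simp), add_comm, Finset.mul_sum]
  congr 1
  refine Finset.sum_congr rfl fun k hk => ?_
  have hk' : m ≠ k := by have := Finset.mem_range.1 hk; omega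
  rw [Finset.erase_insert_of_ne hk', Finset.prod_insert (by simp)]

/-- The logarithmic derivative of a product. -/
theorem derivProd_eq_mul_sum_inv (f : ℕ → ℂ) (s : Finset ℕ) (h : ∀ j ∈ s, f j ≠ 0) :
    derivProd f s = (∏ j ∈ s, f j) * ∑ j ∈ s, (f j)⁻¹ := by
  rw [derivProd, Finset.mul_sum]
  refine Finset.sum_congr rfl fun k hk => ?_
  rw [← Finset.mul_prod_erase s f hk]
  have := h k hk
  field_simp

theorem derivProd_eq_prod_erase (f : ℕ → ℂ) (s : Finset ℕ) {i : ℕ} (hi : i ∈ s) (h : f i = 0) :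
    derivProd f s = ∏ j ∈ s.erase i, f j := by
  rw [derivProd]
  refine Finset.sum_eq_single_of_mem i hi fun k hk hki => ?_
  exact Finset.prod_eq_zero (Finset.mem_erase.2 ⟨hki.symm, hi⟩) h

end arithmetic

/-! ### The action of the Casimir element -/

section casimir
variable {p : ℕ} {V : Type*} [AddCommGroup V] [Module ℂ V] (ρ : Uq p →ₐ[ℂ] Module.End ℂ V)

theorem Ki_apply {v : V} {d : ℂ} (hd : d ≠ 0) (hv : ρ (K p) v = d • v) :
    ρ (Ki p) v = d⁻¹ • v := by
  have h : ρ (Ki p) (ρ (K p) v) = v := by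
    rw [← Module.End.mul_apply, ← map_mul, Ki_mul_K, map_one, Module.End.one_apply]
  rw [hv, map_smul] at h
  exact (inv_smul_eq_iff₀ hd).2 h.symm |>.symm

theorem qCosh_apply {v : V} {d : ℂ} (hd : d ≠ 0) (hv : ρ (K p) v = d • v) (m : ℤ) :
    ρ (qCosh p m) v = ((nu p)⁻¹ * (qq p ^ m * d + (qq p ^ m)⁻¹ * d⁻¹)) • v := by
  simp only [qCosh, map_smul, map_add, LinearMap.smul_apply, LinearMap.add_apply, hv,
    Ki_apply ρ hd hv, smul_smul, ← add_smul]

theorem casimir_apply {v : V} {d : ℂ} (hd : d ≠ 0) (hv : ρ (K p) v = d • v) :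
    ρ (casimir p) v =
      ρ (F p) (ρ (E p) v) + ((nu p)⁻¹ * (qq p * d + (qq p)⁻¹ * d⁻¹)) • v := by
  have h := qCosh_apply ρ hd hv 1
  rw [zpow_one] at h
  rw [casimir, map_add, LinearMap.add_apply, h, map_mul, Module.End.mul_apply]

end casimir

section action
variable {p a c : ℕ} {ε : ℤˣ}

theorem wt_ne_zero (n : ℕ) : wt p ε a n ≠ 0 := weight_ne p ε _

/-- On a projective module the Casimir element acts as a scalar plus the nilpotent
endomorphism `t_n ↦ b_n`. -/
theorem proj_casimir (ha : 0 < a) (hc : 0 < c) (h : a + c = p) :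
    proj p ε a c ha hc h (casimir p) = casimirEig p ε a • 1 + topToBottom a c := by
  have hp : 2 ≤ p := by omega
  have hl : c - 1 + 1 = c := by omega
  refine projSpace_hom_ext ?_ ?_ ?_ ?_ <;> intro n hn
  · rw [casimir_apply _ (wt_ne_zero (p := p) (a := a) (ε := ε) n) (by simp [projK_t]),
      casimirEig_zero hp, ← co_eq_kappa]
    rcases n with _ | n
    · simp [projE_t_zero p ε ha, projF_l_last p ε (c - 1) hl, co_zero, add_comm]
    · simp only [proj_cls, projE_t p ε n hn, map_add, map_smul, projF_t p ε n hn, projF_b,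
        LinearMap.add_apply, LinearMap.smul_apply, Module.End.one_apply, topToBottom_t]
      module
  · rw [casimir_apply _ (wt_ne_zero (p := p) (a := a) (ε := ε) n) (by simp [projK_b]),
      casimirEig_zero hp, ← co_eq_kappa]
    rcases n with _ | n
    · simp [projE_b_zero, co_zero]
    · simp only [proj_cls, projE_b, map_smul, projF_b,
        LinearMap.add_apply, LinearMap.smul_apply, Module.End.one_apply, topToBottom_b]
      module
  · rw [casimir_apply _ (wt_ne_zero (p := p) (a := c) (ε := -ε) n) (by simp [projK_l]),
      casimirEig_zero hp, ← co_eq_kappa, casimirEig_cross ε a c h (by omega)]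
    rcases n with _ | n
    · simp [projE_l_zero, co_zero]
    · simp only [proj_cls, projE_l, map_smul, projF_l p ε n hn,
        LinearMap.add_apply, LinearMap.smul_apply, Module.End.one_apply, topToBottom_l]
      module
  · rw [casimir_apply _ (wt_ne_zero (p := p) (a := c) (ε := -ε) n) (by simp [projK_r]),
      casimirEig_zero hp, ← co_eq_kappa, casimirEig_cross ε a c h (by omega)]
    rcases n with _ | n
    · simp [projE_r_zero p ε hc, co_zero, projF_b, bVec_eq_zero a c (a - 1 + 1) (by omega)]
    · simp only [proj_cls, projE_r, map_smul, projF_r,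
        LinearMap.add_apply, LinearMap.smul_apply, Module.End.one_apply, topToBottom_r]
      module

theorem irr_casimir (hp : 2 ≤ p) (ha : a ≤ p) :
    irr p ε a hp ha (casimir p) = casimirEig p ε a • 1 := by
  refine irr_hom_ext fun n hn => ?_
  rw [casimir_apply _ (wt_ne_zero (p := p) (a := a) (ε := ε) n) (by simp [irrK_irrVec]),
    casimirEig_zero hp, ← co_eq_kappa]
  rcases n with _ | n
  · simp [irrE_irrVec_zero, co_zero]
  · simp only [irr_cls, irrE_irrVec, map_smul, irrF_irrVec, LinearMap.smul_apply,
      Module.End.one_apply]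
    module

theorem proj_F_pow_mul_E_pow_b (ha : 0 < a) (hc : 0 < c) (h : a + c = p) (n m : ℕ) :
    proj p ε a c ha hc h (F p ^ m * E p ^ m) (bVec a c n) =
      (∏ j ∈ Finset.range m, kappa p ε a (n - j)) • bVec a c n := by
  have hp : 2 ≤ p := by omega
  induction m with
  | zero => simp
  | succ m ih =>
    rw [F_pow_mul_E_pow_succ hp, map_mul, Module.End.mul_apply, map_sub, LinearMap.sub_apply,
      qCosh_apply _ (wt_ne_zero (p := p) (a := a) (ε := ε) n) (by simp [projK_b]), proj_casimir]
    simp only [LinearMap.add_apply, LinearMap.smul_apply, Module.End.one_apply, topToBottom_b,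
      add_zero, ← sub_smul]
    rw [casimirEig_sub hp, map_smul, ih, smul_smul, Finset.prod_range_succ, mul_comm]

/-- The element `F ^ m E ^ m` acts on `t_n` as `∏ (ε [n - j] [a - n + j] + N)`, where
`N : t_n ↦ b_n`. -/
theorem proj_F_pow_mul_E_pow_t (ha : 0 < a) (hc : 0 < c) (h : a + c = p) (n m : ℕ) :
    proj p ε a c ha hc h (F p ^ m * E p ^ m) (tVec a c n) =
      (∏ j ∈ Finset.range m, kappa p ε a (n - j)) • tVec a c n +
      derivProd (fun j => kappa p ε a (n - j)) (Finset.range m) • bVec a c n := by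
  have hp : 2 ≤ p := by omega
  induction m with
  | zero => simp [derivProd]
  | succ m ih =>
    rw [F_pow_mul_E_pow_succ hp, map_mul, Module.End.mul_apply, map_sub, LinearMap.sub_apply,
      qCosh_apply _ (wt_ne_zero (p := p) (a := a) (ε := ε) n) (by simp [projK_t]), proj_casimir]
    simp only [LinearMap.add_apply, LinearMap.smul_apply, Module.End.one_apply, topToBottom_t]
    rw [add_sub_right_comm, ← sub_smul, casimirEig_sub hp, map_add, map_smul, ih,
      proj_F_pow_mul_E_pow_b, Finset.prod_range_succ, derivProd_range_succ]
    module

theorem irr_F_pow_mul_E_pow (hp : 2 ≤ p) (ha : a ≤ p) (n m : ℕ) :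
    irr p ε a hp ha (F p ^ m * E p ^ m) (irrVec a n) =
      (∏ j ∈ Finset.range m, kappa p ε a (n - j)) • irrVec a n := by
  induction m with
  | zero => simp
  | succ m ih =>
    rw [F_pow_mul_E_pow_succ hp, map_mul, Module.End.mul_apply, map_sub, LinearMap.sub_apply,
      qCosh_apply _ (wt_ne_zero (p := p) (a := a) (ε := ε) n) (by simp [irrK_irrVec]), irr_casimir]
    simp only [LinearMap.smul_apply, Module.End.one_apply, ← sub_smul]
    rw [casimirEig_sub hp, map_smul, ih, smul_smul, Finset.prod_range_succ, mul_comm]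

end action

/-! ### The projective modules form a faithful family -/

section weightProj
variable (p : ℕ)

/-- The projector `(2p)⁻¹ ∑ q ^ (-kj) K ^ j` to the `K`-eigenvalue `q ^ k`. -/
def weightProj (k : ℤ) : Uq p :=
  ((2 * p : ℕ) : ℂ)⁻¹ • ∑ j ∈ Finset.range (2 * p), (qq p ^ (-k)) ^ j • K p ^ j

variable {p}

theorem qq_zpow_pow (hp : 0 < p) (k : ℤ) : (qq p ^ k) ^ (2 * p) = 1 := by
  rw [← zpow_natCast, ← zpow_mul, qq_zpow_eq_one_iff hp]
  push_cast
  exact dvd_mul_left _ _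

theorem sum_weightProj (hp : 0 < p) :
    ∑ k ∈ Finset.range (2 * p), weightProj p (k : ℤ) = 1 := by
  have h0 : ((2 * p : ℕ) : ℂ) ≠ 0 := by exact_mod_cast (by omega : 2 * p ≠ 0)
  simp only [weightProj]
  rw [← Finset.smul_sum, Finset.sum_comm]
  have key : ∀ j ∈ Finset.range (2 * p),
      ∑ k ∈ Finset.range (2 * p), (qq p ^ (-(k : ℤ))) ^ j • K p ^ j =
        if j = 0 then ((2 * p : ℕ) : ℂ) • (1 : Uq p) else 0 := by
    intro j hj
    have e : ∀ k : ℕ, (qq p ^ (-(k : ℤ))) ^ j = (qq p ^ (-(j : ℤ))) ^ k := by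
      intro k
      rw [← zpow_natCast, ← zpow_natCast, ← zpow_mul, ← zpow_mul]
      ring_nf
    simp only [e]
    rw [← Finset.sum_smul, geom_sum_root (qq_zpow_pow hp _)]
    have hj' := Finset.mem_range.1 hj
    rcases Nat.eq_zero_or_pos j with rfl | hj0
    · simp
    · have h1 : qq p ^ (-(j : ℤ)) ≠ 1 := by
        rw [Ne, qq_zpow_eq_one_iff hp, dvd_neg]
        intro hd
        have := Int.le_of_dvd (by omega) hd
        omega
      rw [if_neg h1, if_neg hj0.ne', zero_smul]
  rw [Finset.sum_congr rfl key, Finset.sum_ite_eq' (Finset.range (2 * p)) 0,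
    if_pos (Finset.mem_range.2 (by omega)), smul_smul, inv_mul_cancel₀ h0, one_smul]

theorem K_mul_weightProj (k : ℤ) :
    K p * weightProj p k = qq p ^ k • weightProj p k := by
  have h0 := qq_ne_zero p
  have hk : qq p ^ k ≠ 0 := zpow_ne_zero _ h0
  rcases Nat.eq_zero_or_pos p with rfl | hp
  · simp [weightProj]
  rw [weightProj, mul_smul_comm, smul_comm, Finset.mul_sum]
  have e : ∀ j : ℕ, K p * (qq p ^ (-k)) ^ j • K p ^ j =
      qq p ^ k • ((qq p ^ (-k)) ^ (j + 1) • K p ^ (j + 1)) := by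
    intro j
    rw [mul_smul_comm, ← pow_succ', smul_smul, pow_succ (qq p ^ (-k)), mul_comm (qq p ^ k),
      mul_assoc, zpow_neg, inv_mul_cancel₀ hk, mul_one]
  simp only [e]
  rw [← Finset.smul_sum]
  refine congrArg (_ • ·) (congrArg (_ • ·) ?_)
  have h1 := Finset.sum_range_succ (fun j => (qq p ^ (-k)) ^ j • K p ^ j) (2 * p)
  have h2 := Finset.sum_range_succ' (fun j => (qq p ^ (-k)) ^ j • K p ^ j) (2 * p)
  rw [h1] at h2
  simp only [qq_zpow_pow hp, K_pow_two_mul, pow_zero] at h2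
  exact (add_right_cancel h2).symm

theorem weightProj_apply {V : Type*} [AddCommGroup V] [Module ℂ V]
    (ρ : Uq p →ₐ[ℂ] Module.End ℂ V) {v : V} {d : ℂ} (hv : ρ (K p) v = d • v)
    (hd : d ^ (2 * p) = 1) (hp : 0 < p) (k : ℤ) :
    ρ (weightProj p k) v = if d = qq p ^ k then v else 0 := by
  have h0 : ((2 * p : ℕ) : ℂ) ≠ 0 := by exact_mod_cast (by omega : 2 * p ≠ 0)
  have hpow : ∀ j : ℕ, ρ (K p ^ j) v = d ^ j • v := by
    intro j
    induction j with
    | zero => simp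
    | succ j ih => rw [pow_succ, map_mul, Module.End.mul_apply, hv, map_smul, ih, smul_smul,
        pow_succ']
  simp only [weightProj, map_smul, map_sum, LinearMap.smul_apply, LinearMap.sum_apply, hpow,
    smul_smul, ← mul_pow]
  rw [← Finset.sum_smul, geom_sum_root (by rw [mul_pow, hd, qq_zpow_pow hp, mul_one])]
  have hk : qq p ^ k ≠ 0 := zpow_ne_zero _ (qq_ne_zero p)
  have e : qq p ^ (-k) * d = 1 ↔ d = qq p ^ k := by
    rw [zpow_neg, inv_mul_eq_one₀ hk, eq_comm]
  simp only [e]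
  split_ifs
  · rw [smul_smul, inv_mul_cancel₀ h0, one_smul]
  · simp

end weightProj

section span
variable {p : ℕ}

theorem HasWeight.K_mul_mul_weightProj {x : Uq p} {m : ℤ} (hx : HasWeight p x m) (k : ℤ) :
    K p * (x * weightProj p k) = qq p ^ (2 * m + k) • (x * weightProj p k) := by
  rw [← mul_assoc, hx, smul_mul_assoc, mul_assoc, K_mul_weightProj, mul_smul_comm, smul_smul,
    zpow_add₀ (qq_ne_zero p)]

theorem qCosh_mul_of_K_mul {y : Uq p} {d : ℂ} (hd : d ≠ 0) (hy : K p * y = d • y) (m : ℤ) :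
    qCosh p m * y = ((nu p)⁻¹ * (qq p ^ m * d + (qq p ^ m)⁻¹ * d⁻¹)) • y := by
  have h : Ki p * y = d⁻¹ • y := by
    have h1 : Ki p * (K p * y) = y := by rw [← mul_assoc, Ki_mul_K, one_mul]
    rw [hy, mul_smul_comm] at h1
    exact (inv_smul_eq_iff₀ hd).2 h1.symm |>.symm
  simp only [qCosh, smul_mul_assoc, add_mul, hy, h, smul_smul, ← add_smul]

/-- The spanning half of the Poincaré–Birkhoff–Witt theorem, on one weight space. -/
theorem mul_weightProj_mem_span (hp : 2 ≤ p) (k : ℤ) (x : Uq p) :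
    x * weightProj p k ∈ Submodule.span ℂ
      (Set.range fun ij : ℕ × ℕ => F p ^ ij.1 * E p ^ ij.2 * weightProj p k) := by
  set S := Submodule.span ℂ
      (Set.range fun ij : ℕ × ℕ => F p ^ ij.1 * E p ^ ij.2 * weightProj p k) with hS
  have hmem : ∀ i j : ℕ, F p ^ i * E p ^ j * weightProj p k ∈ S := fun i j =>
    Submodule.subset_span ⟨(i, j), rfl⟩
  have hgen : ∀ x : Uq p, (∀ i j : ℕ, x * (F p ^ i * E p ^ j * weightProj p k) ∈ S) →
      ∀ y ∈ S, x * y ∈ S := by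
    intro x hx y hy
    induction hy using Submodule.span_induction with
    | mem y hy => obtain ⟨⟨i, j⟩, rfl⟩ := hy; exact hx i j
    | zero => rw [mul_zero]; exact S.zero_mem
    | add y z _ _ hy hz => rw [mul_add]; exact S.add_mem hy hz
    | smul c y _ hy => rw [mul_smul_comm]; exact S.smul_mem _ hy
  have key : ∀ x : Uq p, ∀ y ∈ S, x * y ∈ S := by
    intro x
    refine Uq.induction (by omega) (P := fun x => ∀ y ∈ S, x * y ∈ S) ?_ ?_ ?_ ?_ ?_ ?_ x
    · refine hgen _ fun i j => ?_
      rcases i with _ | i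
      · have := hmem 0 (j + 1)
        rw [pow_succ'] at this
        simpa [mul_assoc] using this
      · have hk : qq p ^ (2 * ((j : ℤ) * 1) + k) ≠ 0 := zpow_ne_zero _ (qq_ne_zero p)
        have hw := (hasWeight_E.pow (p := p) j).K_mul_mul_weightProj k
        obtain ⟨r, hr⟩ : ∃ r : ℂ, _ = r • _ := ⟨_, qCosh_mul_of_K_mul hk hw 1⟩
        obtain ⟨r', hr'⟩ : ∃ r : ℂ, _ = r • _ := ⟨_, qCosh_mul_of_K_mul hk hw (-1 - 2 * i)⟩
        have e : E p * (F p ^ (i + 1) * E p ^ j * weightProj p k) =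
            F p ^ (i + 1) * E p ^ (j + 1) * weightProj p k +
              (r - r') • (F p ^ i * E p ^ j * weightProj p k) := by
          calc E p * (F p ^ (i + 1) * E p ^ j * weightProj p k)
              = (E p * F p ^ (i + 1)) * (E p ^ j * weightProj p k) := by simp only [mul_assoc]
            _ = F p ^ i * (F p * E p * (E p ^ j * weightProj p k) +
                qCosh p 1 * (E p ^ j * weightProj p k) -
                qCosh p (-1 - 2 * i) * (E p ^ j * weightProj p k)) := by
              rw [E_mul_F_pow hp, casimir]
              simp only [mul_assoc, add_mul, sub_mul]
            _ = _ := by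
              rw [hr, hr', pow_succ (F p), pow_succ' (E p)]
              simp only [mul_sub, mul_add, mul_smul_comm, mul_assoc]
              module
        rw [e]
        exact S.add_mem (hmem _ _) (S.smul_mem _ (hmem _ _))
    · refine hgen _ fun i j => ?_
      have := hmem (i + 1) j
      rw [pow_succ'] at this
      simpa [mul_assoc] using this
    · refine hgen _ fun i j => ?_
      rw [((hasWeight_F.pow i).mul (hasWeight_E.pow j)).K_mul_mul_weightProj k]
      exact S.smul_mem _ (hmem _ _)
    · intro c y hy
      rw [← Algebra.smul_def]
      exact S.smul_mem _ hy
    · intro x y hx hy z hz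
      rw [add_mul]
      exact S.add_mem (hx z hz) (hy z hz)
    · intro x y hx hy z hz
      rw [mul_assoc]
      exact hx _ (hy z hz)
  have h1 := hmem 0 0
  rw [pow_zero, pow_zero, one_mul, one_mul] at h1
  exact key x _ h1

theorem exists_coeff (hp : 2 ≤ p) (k : ℤ) (x : Uq p) : ∃ f : ℕ → ℕ → ℂ,
    x * weightProj p k = ∑ i ∈ Finset.range p, ∑ j ∈ Finset.range p,
      f i j • (F p ^ i * E p ^ j * weightProj p k) := by
  have h := mul_weightProj_mem_span hp k x
  generalize x * weightProj p k = y at h ⊢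
  induction h using Submodule.span_induction with
  | mem y hy =>
    obtain ⟨⟨i, j⟩, rfl⟩ := hy
    by_cases hij : i < p ∧ j < p
    · refine ⟨fun i' j' => if i' = i then if j' = j then 1 else 0 else 0, ?_⟩
      rw [Finset.sum_eq_single_of_mem i (Finset.mem_range.2 hij.1),
        Finset.sum_eq_single_of_mem j (Finset.mem_range.2 hij.2)]
      · simp
      · intro j' _ hj'
        simp [hj']
      · intro i' _ hi'
        simp [hi']
    · refine ⟨0, ?_⟩
      have : F p ^ i * E p ^ j = 0 := by
        rw [not_and_or, not_lt, not_lt] at hij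
        rcases hij with h | h
        · rw [pow_eq_zero_of_le h (F_pow_self p), zero_mul]
        · rw [pow_eq_zero_of_le h (E_pow_self p), mul_zero]
      simp [this]
  | zero => exact ⟨0, by simp⟩
  | add y z _ _ hy hz =>
    obtain ⟨f, hf⟩ := hy
    obtain ⟨g, hg⟩ := hz
    refine ⟨f + g, ?_⟩
    simp only [hf, hg, Pi.add_apply, add_smul, Finset.sum_add_distrib]
  | smul c y _ hy =>
    obtain ⟨f, hf⟩ := hy
    refine ⟨c • f, ?_⟩
    simp only [hf, Pi.smul_apply, smul_assoc, Finset.smul_sum]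

end span

section faithful
variable {p : ℕ}

/-- The element acts by zero on all projective modules, the simple ones included. -/
structure IsNull (hp : 2 ≤ p) (x : Uq p) : Prop where
  irr : ∀ ε, irr p ε p hp le_rfl x = 0
  proj : ∀ ε a c ha hc h, proj p ε a c ha hc h x = 0

theorem IsNull.mul_left {hp : 2 ≤ p} {x : Uq p} (hx : IsNull hp x) (y : Uq p) :
    IsNull hp (y * x) :=
  ⟨fun ε => by rw [map_mul, hx.irr, mul_zero],
    fun ε a c ha hc h => by rw [map_mul, hx.proj, mul_zero]⟩

theorem IsNull.mul_right {hp : 2 ≤ p} {x : Uq p} (hx : IsNull hp x) (y : Uq p) :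
    IsNull hp (x * y) :=
  ⟨fun ε => by rw [map_mul, hx.irr, zero_mul],
    fun ε a c ha hc h => by rw [map_mul, hx.proj, zero_mul]⟩

/-- Every power of `q` is the lowest weight of a simple module. -/
theorem exists_wt_last (hp : 2 ≤ p) (l : ℤ) :
    ∃ (ε : ℤˣ) (a : ℕ), 0 < a ∧ a ≤ p ∧ wt p ε a (a - 1) = qq p ^ l := by
  -- With `r` the residue of `-l` modulo `2p`, the lowest weight `ε q ^ (1 - a)` is `q ^ (-r)` for
  -- `ε = 1`, `a = r + 1` if `r < p`, and for `ε = -1`, `a = r - p + 1` if `r ≥ p`.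
  have h0 := qq_ne_zero p
  have hp2 : (0 : ℤ) < 2 * p := by omega
  have hr0 := Int.emod_nonneg (-l) hp2.ne'
  have hr1 := Int.emod_lt_of_pos (-l) hp2
  have hr : qq p ^ l = qq p ^ (-((-l) % (2 * p))) := by
    have e : l = -((-l) % (2 * p)) + 2 * p * (-((-l) / (2 * p))) := by
      have := Int.emod_add_mul_ediv (-l) (2 * p)
      linarith
    have h1 : qq p ^ (2 * p * (-((-l) / (2 * p))) : ℤ) = 1 := by
      rw [qq_zpow_eq_one_iff (by omega)]
      exact dvd_mul_right _ _
    conv_lhs => rw [e, zpow_add₀ h0, h1, mul_one]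
  rw [hr]
  obtain ⟨r, hr⟩ := Int.eq_ofNat_of_zero_le hr0
  rw [hr] at hr1 ⊢
  by_cases h : r < p
  · refine ⟨1, r + 1, by omega, by omega, ?_⟩
    rw [wt, Nat.add_sub_cancel]
    simp only [sgn, Units.val_one, Int.cast_one, one_mul]
    congr 1
    push_cast
    ring
  · obtain ⟨m, rfl⟩ : ∃ m, r = p + m := ⟨r - p, by omega⟩
    refine ⟨-1, m + 1, by omega, by omega, ?_⟩
    have e : -((p + m : ℕ) : ℤ) = -(m : ℤ) - p := by push_cast; ring
    have e2 : (((m + 1 : ℕ) : ℤ) - 1 - 2 * m) = -(m : ℤ) := by push_cast; ring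
    rw [wt, Nat.add_sub_cancel, e, e2, zpow_sub₀ h0, qq_zpow_self (by omega), sgn_neg]
    simp [sgn, div_neg]

theorem not_dvd_of_pos_of_lt {n : ℤ} (h1 : 0 < n) (h2 : n < p) : ¬ (p : ℤ) ∣ n := fun h => by
  have := Int.le_of_dvd h1 h; omega

/-- For every weight `q ^ l` there is a vector of this weight in one of the projective modules on
which `F ^ (p - 1) E ^ (p - 1)` does not vanish: the lowest vector of the top. -/
theorem exists_vector (hp : 2 ≤ p) (l : ℤ) :
    ∃ (V : Type) (_ : AddCommGroup V) (_ : Module ℂ V) (ρ : Uq p →ₐ[ℂ] Module.End ℂ V) (v : V),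
      (∀ x, IsNull hp x → ρ x = 0) ∧ ρ (K p) v = qq p ^ l • v ∧
      ρ (F p ^ (p - 1) * E p ^ (p - 1)) v ≠ 0 := by
  obtain ⟨ε, a, ha, hap, hl⟩ := exists_wt_last hp l
  rcases hap.lt_or_eq with hlt | rfl
  · refine ⟨_, _, _, proj p ε a (p - a) ha (by omega) (by omega), tVec a (p - a) (a - 1),
      fun x hx => hx.proj _ _ _ _ _ _, ?_, ?_⟩
    · rw [proj_cls, projK_t, hl]
    · -- One factor of the product of the numbers `ε [n - j] [a - n + j]` vanishes, the one with
      -- `j = n`, so the coefficient of `b_n` is the product of the others.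
      have hz : (fun j : ℕ => kappa p ε a (((a - 1 : ℕ) : ℤ) - j)) (a - 1) = 0 := by
        simp [kappa_zero]
      have hm : a - 1 ∈ Finset.range (p - 1) := Finset.mem_range.2 (by omega)
      rw [proj_F_pow_mul_E_pow_t, Finset.prod_eq_zero hm hz, zero_smul, zero_add,
        derivProd_eq_prod_erase _ _ hm hz]
      refine smul_ne_zero (Finset.prod_ne_zero_iff.2 fun j hj => ?_) ?_
      · obtain ⟨hj1, hj2⟩ := Finset.mem_erase.1 hj
        have hj3 := Finset.mem_range.1 hj2
        refine kappa_ne_zero hp ε a ?_ ?_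
        · rcases Nat.lt_or_gt_of_ne hj1 with h | h
          · exact not_dvd_of_pos_of_lt (by omega) (by omega)
          · rw [← dvd_neg]
            exact not_dvd_of_pos_of_lt (by omega) (by omega)
        · exact not_dvd_of_pos_of_lt (by omega) (by omega)
      · rw [bVec, dif_pos (by omega)]
        simp
  · refine ⟨_, _, _, irr a ε a hp le_rfl, irrVec a (a - 1), fun x hx => hx.irr _, ?_, ?_⟩
    · rw [irr_cls, irrK_irrVec, hl]
    · rw [irr_F_pow_mul_E_pow]
      refine smul_ne_zero (Finset.prod_ne_zero_iff.2 fun j hj => ?_) ?_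
      · have hj3 := Finset.mem_range.1 hj
        exact kappa_ne_zero hp ε a (not_dvd_of_pos_of_lt (by omega) (by omega))
          (not_dvd_of_pos_of_lt (by omega) (by omega))
      · rw [irrVec, dif_pos (by omega)]
        simp

/-- The element `F ^ (p - 1) E ^ j P E ^ (p - 1 - j)`, with `P` the projector to a weight, is
`F ^ (p - 1) E ^ (p - 1)` followed on the right by the projector to another weight, so it acts
nontrivially on some projective module. -/
theorem eq_zero_of_isNull_smul (hp : 2 ≤ p) (k : ℤ) {j : ℕ} (hj : j < p) {r : ℂ}
    (h : IsNull hp (r • (F p ^ (p - 1) * E p ^ j * weightProj p k * E p ^ (p - 1 - j)))) :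
    r = 0 := by
  obtain ⟨V, _, _, ρ, v, hρ, hK, hv⟩ := exists_vector hp (k - 2 * ((p - 1 - j : ℕ) : ℤ))
  have h1 := LinearMap.congr_fun (hρ _ h) v
  have hK' : ρ (K p) (ρ (E p ^ (p - 1 - j)) v) = qq p ^ k • ρ (E p ^ (p - 1 - j)) v := by
    have hw : K p * E p ^ (p - 1 - j) = _ := hasWeight_E.pow (p - 1 - j)
    rw [← Module.End.mul_apply, ← map_mul, hw, map_smul, map_mul, LinearMap.smul_apply,
      Module.End.mul_apply, hK, map_smul, smul_smul, ← zpow_add₀ (qq_ne_zero p)]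
    congr 2
    ring
  rw [map_smul, LinearMap.smul_apply, map_mul, Module.End.mul_apply, map_mul,
    Module.End.mul_apply, weightProj_apply ρ hK' (qq_zpow_pow (by omega) k) (by omega),
    if_pos rfl, ← Module.End.mul_apply, ← map_mul, mul_assoc, ← pow_add,
    show j + (p - 1 - j) = p - 1 by omega, LinearMap.zero_apply] at h1
  exact (smul_eq_zero.1 h1).resolve_right hv

/-- The irreducible modules of dimension `p` and the projective modules `P` of dimension `2p`
together are faithful. The annihilator is a two-sided ideal; multiplying an element
`∑ f_ij F ^ i E ^ j Q` of it, with `Q` the projector to a weight, by `F ^ (p - 1 - i)` on the left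
and `E ^ (p - 1 - j)` on the right isolates the lexicographically first coefficient. -/
theorem IsNull.eq_zero {hp : 2 ≤ p} {x : Uq p} (hx : IsNull hp x) : x = 0 := by
  have key : ∀ k : ℤ, x * weightProj p k = 0 := by
    intro k
    obtain ⟨f, hf⟩ := exists_coeff hp k x
    have hzero : ∀ i, i < p → ∀ j, j < p → f i j = 0 := by
      intro i
      induction i using Nat.strong_induction_on with
      | _ i ihi =>
      intro hi j
      induction j using Nat.strong_induction_on with
      | _ j ihj =>
      intro hj
      have h1 : IsNull hp (F p ^ (p - 1 - i) * (x * weightProj p k) * E p ^ (p - 1 - j)) :=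
        ((hx.mul_right _).mul_left _).mul_right _
      have hEP : ∀ j', j < j' → E p ^ j' * weightProj p k * E p ^ (p - 1 - j) = 0 := by
        intro j' hj'
        have hn : ∀ n : ℕ, K p ^ n * E p ^ (p - 1 - j) = _ :=
          fun n => (hasWeight_E.pow (p := p) (p - 1 - j)).K_pow_mul n
        rw [weightProj, mul_smul_comm, smul_mul_assoc, Finset.mul_sum, Finset.sum_mul,
          Finset.sum_eq_zero, smul_zero]
        intro n _
        rw [mul_smul_comm, smul_mul_assoc, mul_assoc, hn, mul_smul_comm, ← mul_assoc (E p ^ j'),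
          ← pow_add, pow_eq_zero_of_le (by omega) (E_pow_self p), zero_mul, smul_zero, smul_zero]
      have h2 : F p ^ (p - 1 - i) * (x * weightProj p k) * E p ^ (p - 1 - j) =
          f i j • (F p ^ (p - 1) * E p ^ j * weightProj p k * E p ^ (p - 1 - j)) := by
        rw [hf, Finset.mul_sum, Finset.sum_mul,
          Finset.sum_eq_single_of_mem i (Finset.mem_range.2 hi), Finset.mul_sum, Finset.sum_mul,
          Finset.sum_eq_single_of_mem j (Finset.mem_range.2 hj)]
        · have e1 : F p ^ (p - 1) = F p ^ (p - 1 - i) * F p ^ i := by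
            rw [← pow_add, Nat.sub_add_cancel (by omega)]
          rw [mul_smul_comm, smul_mul_assoc, e1]
          simp only [mul_assoc]
        · intro j' hj'1 hj'2
          rcases Nat.lt_or_gt_of_ne hj'2 with h | h
          · rw [ihj j' h (by omega), zero_smul, mul_zero, zero_mul]
          · rw [mul_smul_comm, smul_mul_assoc, mul_assoc (F p ^ i), mul_assoc, mul_assoc,
              hEP j' h, mul_zero, mul_zero, smul_zero]
        · intro i' hi'1 hi'2
          rw [Finset.mul_sum, Finset.sum_mul]
          refine Finset.sum_eq_zero fun j' hj' => ?_
          rcases Nat.lt_or_gt_of_ne hi'2 with h | h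
          · rw [ihi i' h (by omega) j' (Finset.mem_range.1 hj'), zero_smul, mul_zero, zero_mul]
          · rw [mul_smul_comm, smul_mul_assoc, mul_assoc (F p ^ i'), ← mul_assoc (F p ^ _),
              ← pow_add, pow_eq_zero_of_le (by omega) (F_pow_self p), zero_mul, zero_mul,
              smul_zero]
      rw [h2] at h1
      exact eq_zero_of_isNull_smul hp k hj h1
    rw [hf]
    refine Finset.sum_eq_zero fun i hi => Finset.sum_eq_zero fun j hj => ?_
    rw [hzero i (Finset.mem_range.1 hi) j (Finset.mem_range.1 hj), zero_smul]
  rw [← mul_one x, ← sum_weightProj (by omega : 0 < p), Finset.mul_sum]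
  exact Finset.sum_eq_zero fun k _ => key k

end faithful

/-! ### Central elements and their action -/

section coordinates
variable {p : ℕ}

theorem onBasis_diagonal_apply {I : Type*} (d : I → ℂ) (v : I →₀ ℂ) (i : I) :
    onBasis (fun i => d i • Finsupp.single i 1) v i = d i * v i := by
  classical
  have h : Finsupp.lapply i ∘ₗ onBasis (fun i => d i • Finsupp.single i (1 : ℂ)) =
      d i • (Finsupp.lapply i : (I →₀ ℂ) →ₗ[ℂ] ℂ) := by
    refine Finsupp.lhom_ext' fun j => LinearMap.ext_ring ?_
    by_cases hj : j = i
    · subst hj; simp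
    · simp [hj]
  exact LinearMap.congr_fun h v

theorem wt_injOn (hp : 0 < p) {ε : ℤˣ} {a n m : ℕ} (hn : n < p) (hm : m < p)
    (h : wt p ε a n = wt p ε a m) : n = m := by
  have h0 := qq_ne_zero p
  have h1 := mul_left_cancel₀ (left_ne_zero_of_mul_eq_one (sgn_mul_self ε)) h
  have e : qq p ^ (2 * ((m : ℤ) - n)) = 1 := by
    rw [show 2 * ((m : ℤ) - n) = ((a : ℤ) - 1 - 2 * n) - ((a : ℤ) - 1 - 2 * m) by ring,
      zpow_sub₀ h0, h1, div_self (zpow_ne_zero _ h0)]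
  rw [qq_zpow_eq_one_iff hp, mul_dvd_mul_iff_left two_ne_zero] at e
  have := Int.eq_zero_of_abs_lt_dvd e (abs_lt.2 ⟨by omega, by omega⟩)
  omega

theorem irrToBottom_apply_b {a c : ℕ} (v : Fin a →₀ ℂ) (i : Fin a) :
    irrToBottom a c v (.b i) = v i := by
  classical
  have h : (Finsupp.lapply (ProjIdx.b i) : ProjSpace a c →ₗ[ℂ] ℂ) ∘ₗ irrToBottom a c =
      Finsupp.lapply i := by
    refine Finsupp.lhom_ext' fun j => LinearMap.ext_ring ?_
    by_cases hj : j = i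
    · subst hj; simp [irrToBottom]
    · simp [irrToBottom, hj]
  exact LinearMap.congr_fun h v

end coordinates

section central
variable {p a c : ℕ} {ε : ℤˣ}

theorem proj_weight_top (ha : 0 < a) (hc : 0 < c) (h : a + c = p) {v : ProjSpace a c}
    (hv : projGen p ε a c .K v = wt p ε a 0 • v) :
    ∃ x y : ℂ, v = x • tVec a c 0 + y • bVec a c 0 := by
  have hco : ∀ i, projWt p ε a c i ≠ wt p ε a 0 → v i = 0 := by
    intro i hi
    have h1 := DFunLike.congr_fun hv i
    rw [Finsupp.smul_apply, smul_eq_mul] at h1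
    change onBasis (fun i => projWt p ε a c i • Finsupp.single i 1) v i = _ at h1
    rw [onBasis_diagonal_apply] at h1
    by_contra h2
    exact hi (mul_right_cancel₀ h2 h1)
  refine ⟨v (.t ⟨0, ha⟩), v (.b ⟨0, ha⟩), Finsupp.ext fun i => ?_⟩
  rw [tVec, dif_pos ha, bVec, dif_pos ha]
  classical
  rcases i with ⟨n, hn⟩ | ⟨n, hn⟩ | ⟨k, hk⟩ | ⟨k, hk⟩
  · rcases n with _ | n
    · simp
    · rw [hco (.t ⟨n + 1, hn⟩) fun h1 => Nat.succ_ne_zero n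
        (wt_injOn (by omega) (by omega) (by omega) h1)]
      simp
  · rcases n with _ | n
    · simp
    · rw [hco (.b ⟨n + 1, hn⟩) fun h1 => Nat.succ_ne_zero n
        (wt_injOn (by omega) (by omega) (by omega) h1)]
      simp
  · rw [hco]
    · simp
    · intro h1
      rw [projWt, wt_cross p (by omega) ε a c k h] at h1
      have := wt_injOn (by omega) (by omega) (by omega) h1
      omega
  · rw [hco]
    · simp
    · intro h1
      rw [projWt, wt_cross p (by omega) ε a c k h] at h1
      have := wt_injOn (by omega) (by omega) (by omega) h1
      omega

/-- A projective module is generated by the highest weight vector of its top. -/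
theorem proj_end_eq_zero (ha : 0 < a) (hc : 0 < c) (h : a + c = p)
    (D : Module.End ℂ (ProjSpace a c))
    (hE : ∀ v, D (projGen p ε a c .E v) = projGen p ε a c .E (D v))
    (hF : ∀ v, D (projGen p ε a c .F v) = projGen p ε a c .F (D v))
    (h0 : D (tVec a c 0) = 0) : D = 0 := by
  have ht : ∀ n, n < a → D (tVec a c n) = 0 := by
    intro n
    induction n with
    | zero => intro _; exact h0
    | succ n ih => intro hn; rw [← projF_t p ε n hn, hF, ih (by omega), map_zero]
  have hl : ∀ j, j < c → D (lVec a c (c - 1 - j)) = 0 := by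
    intro j
    induction j with
    | zero => intro _; rw [Nat.sub_zero, ← projE_t_zero p ε ha, hE, h0, map_zero]
    | succ j ih =>
      intro hj
      have h1 := projE_l (a := a) (c := c) p ε (c - 1 - (j + 1))
      rw [show c - 1 - (j + 1) + 1 = c - 1 - j by omega] at h1
      have h2 := congrArg D h1
      rw [hE, ih (by omega), map_zero, map_smul] at h2
      refine (smul_eq_zero.1 h2.symm).resolve_left ?_
      rw [co_eq_kappa]
      exact kappa_ne_zero (by omega) _ _ (not_dvd_of_pos_of_lt (by omega) (by omega))
        (not_dvd_of_pos_of_lt (by omega) (by omega))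
  have hr : ∀ k, D (rVec a c k) = 0 := by
    intro k
    induction k with
    | zero =>
      rw [← projF_t_last p ε (a - 1) (by omega), hF, ht _ (by omega), map_zero]
    | succ k ih => rw [← projF_r p ε k, hF, ih, map_zero]
  have hb : ∀ n, D (bVec a c n) = 0 := by
    intro n
    induction n with
    | zero =>
      have := hl 0 hc
      rw [← projF_l_last p ε (c - 1) (by omega), hF, ← Nat.sub_zero (c - 1), this, map_zero]
    | succ n ih => rw [← projF_b p ε n, hF, ih, map_zero]
  refine projSpace_hom_ext (fun n hn => ?_) (fun n _ => ?_) (fun k hk => ?_) fun k _ => ?_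
  · rw [ht n hn, LinearMap.zero_apply]
  · rw [hb n, LinearMap.zero_apply]
  · have := hl (c - 1 - k) (by omega)
    rwa [show c - 1 - (c - 1 - k) = k by omega] at this
  · rw [hr k, LinearMap.zero_apply]

theorem proj_central (ha : 0 < a) (hc : 0 < c) (h : a + c = p) {z : Uq p}
    (hz : z ∈ Subalgebra.center ℂ (Uq p)) :
    ∃ x y : ℂ, proj p ε a c ha hc h z = x • 1 + y • topToBottom a c := by
  rw [Subalgebra.mem_center_iff] at hz
  have hcomm : ∀ (g : Gen) v, proj p ε a c ha hc h z (projGen p ε a c g v) =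
      projGen p ε a c g (proj p ε a c ha hc h z v) := by
    intro g v
    rw [← proj_cls ha hc h, ← Module.End.mul_apply, ← Module.End.mul_apply, ← map_mul, ← map_mul,
      hz]
  have hN : ∀ (g : Gen) v, topToBottom a c (projGen p ε a c g v) =
      projGen p ε a c g (topToBottom a c v) := by
    intro g v
    have := LinearMap.congr_fun (topToBottom_intertwines (ε := ε) ha hc h (cls p g)) v
    rwa [LinearMap.comp_apply, LinearMap.comp_apply, proj_cls] at this
  obtain ⟨x, y, hxy⟩ := proj_weight_top ha hc h (ε := ε)
    (v := proj p ε a c ha hc h z (tVec a c 0)) (by rw [← hcomm, projK_t, map_smul])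
  refine ⟨x, y, sub_eq_zero.1 (proj_end_eq_zero (p := p) (ε := ε) ha hc h _ ?_ ?_ ?_)⟩
  · intro v
    simp only [LinearMap.sub_apply, LinearMap.add_apply, LinearMap.smul_apply,
      Module.End.one_apply, hcomm, hN, map_sub, map_add, map_smul]
  · intro v
    simp only [LinearMap.sub_apply, LinearMap.add_apply, LinearMap.smul_apply,
      Module.End.one_apply, hcomm, hN, map_sub, map_add, map_smul]
  · simp [hxy]

theorem irr_central (hp : 2 ≤ p) {z : Uq p} (hz : z ∈ Subalgebra.center ℂ (Uq p)) :
    ∃ x : ℂ, irr p ε p hp le_rfl z = x • 1 := by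
  rw [Subalgebra.mem_center_iff] at hz
  have hcomm : ∀ (g : Gen) v, irr p ε p hp le_rfl z (irrGen p ε p g v) =
      irrGen p ε p g (irr p ε p hp le_rfl z v) := by
    intro g v
    rw [← irr_cls ε p hp le_rfl, ← Module.End.mul_apply, ← Module.End.mul_apply, ← map_mul,
      ← map_mul, hz]
  have hp0 : 0 < p := by omega
  set v := irr p ε p hp le_rfl z (irrVec p 0) with hv
  have hK : irrGen p ε p .K v = wt p ε p 0 • v := by rw [hv, ← hcomm, irrK_irrVec, map_smul]
  have hv0 : v = v ⟨0, hp0⟩ • irrVec p 0 := by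
    refine Finsupp.ext fun i => ?_
    rw [irrVec, dif_pos hp0]
    obtain ⟨n, hn⟩ := i
    rcases n with _ | n
    · simp
    · have h1 := DFunLike.congr_fun hK ⟨n + 1, hn⟩
      change onBasis (fun i : Fin p => wt p ε p i • Finsupp.single i 1) v _ = _ at h1
      rw [onBasis_diagonal_apply, Finsupp.smul_apply, smul_eq_mul] at h1
      have h2 : v ⟨n + 1, hn⟩ = 0 := by
        by_contra h2
        exact Nat.succ_ne_zero n (wt_injOn hp0 hn hp0 (mul_right_cancel₀ h2 h1))
      rw [h2]
      simp
  refine ⟨v ⟨0, hp0⟩, irr_hom_ext fun n _ => ?_⟩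
  rw [LinearMap.smul_apply, Module.End.one_apply]
  induction n with
  | zero => exact hv0
  | succ n ih => rw [← irrF_irrVec ε p n, hcomm, ih (by omega), map_smul]

theorem smul_add_smul_injective (ha : 0 < a) {x y x' y' : ℂ}
    (h : x • (1 : Module.End ℂ (ProjSpace a c)) + y • topToBottom a c =
      x' • (1 : Module.End ℂ (ProjSpace a c)) + y' • topToBottom a c) : x = x' ∧ y = y' := by
  have h1 := LinearMap.congr_fun h (tVec a c 0)
  simp only [LinearMap.add_apply, LinearMap.smul_apply, Module.End.one_apply, topToBottom_t] at h1
  rw [tVec, dif_pos ha, bVec, dif_pos ha] at h1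
  exact ⟨by simpa using DFunLike.congr_fun h1 (.t ⟨0, ha⟩),
    by simpa using DFunLike.congr_fun h1 (.b ⟨0, ha⟩)⟩

/-- A central element has the same eigenvalue on the two projective modules of a block. -/
theorem proj_scalar_eq (ha : 0 < a) (hc : 0 < c) (h : a + c = p) {z : Uq p} {x y x' y' : ℂ}
    (h1 : proj p ε a c ha hc h z = x • 1 + y • topToBottom a c)
    (h2 : proj p (-ε) c a hc ha ((Nat.add_comm c a).trans h) z =
      x' • 1 + y' • topToBottom c a) : x = x' := by
  have h3 := LinearMap.congr_fun (topToLeft_intertwines (ε := ε) ha hc h z) (tVec c a 0)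
  rw [LinearMap.comp_apply, LinearMap.comp_apply, h1, h2] at h3
  simp only [LinearMap.add_apply, LinearMap.smul_apply, Module.End.one_apply, topToBottom_t,
    map_add, map_smul, topToLeft_t, topToLeft_b, topToBottom_l, smul_zero, add_zero] at h3
  rw [lVec, dif_pos hc] at h3
  simpa using (DFunLike.congr_fun h3 (.l ⟨0, hc⟩)).symm

end central

section actsBy
variable {p : ℕ}

/-- The element `z` acts on the projective modules like a central element: as the scalar `x s` on
the block of `X⁺_s`, up to the multiples `yp s` and `ym s` of the nilpotent endomorphisms
`t_n ↦ b_n` of `P⁺_s` and `P⁻_(p - s)`. The block of `X⁻_p` has index `0`. -/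
structure ActsBy (hp : 2 ≤ p) (z : Uq p) (x yp ym : ℕ → ℂ) : Prop where
  irrPlus : irr p 1 p hp le_rfl z = x p • 1
  irrMinus : irr p (-1) p hp le_rfl z = x 0 • 1
  plus : ∀ s h1 h2, projPlus p s h1 h2 z = x s • 1 + yp s • topToBottom s (p - s)
  minus : ∀ s h1 h2, projMinus p s h1 h2 z = x s • 1 + ym s • topToBottom (p - s) s

variable {hp : 2 ≤ p} {z z' : Uq p} {x yp ym x' yp' ym' : ℕ → ℂ}

theorem isNull_of_plus_minus (h1 : irr p 1 p hp le_rfl z = 0)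
    (h2 : irr p (-1) p hp le_rfl z = 0) (h3 : ∀ s h1 h2, projPlus p s h1 h2 z = 0)
    (h4 : ∀ s h1 h2, projMinus p s h1 h2 z = 0) : IsNull hp z := by
  refine ⟨fun ε => ?_, fun ε a c ha hc h => ?_⟩
  · rcases Int.units_eq_one_or ε with rfl | rfl
    · exact h1
    · exact h2
  · rcases Int.units_eq_one_or ε with rfl | rfl
    · obtain rfl : c = p - a := by omega
      exact h3 a ha (by omega)
    · obtain rfl : a = p - c := by omega
      exact h4 c hc (by omega)

theorem ActsBy.sub (h : ActsBy hp z x yp ym) (h' : ActsBy hp z' x' yp' ym') :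
    ActsBy hp (z - z') (x - x') (yp - yp') (ym - ym') := by
  refine ⟨?_, ?_, fun s h1 h2 => ?_, fun s h1 h2 => ?_⟩
  · rw [map_sub, h.irrPlus, h'.irrPlus, Pi.sub_apply]; module
  · rw [map_sub, h.irrMinus, h'.irrMinus, Pi.sub_apply]; module
  · rw [map_sub, h.plus, h'.plus, Pi.sub_apply, Pi.sub_apply]; module
  · rw [map_sub, h.minus, h'.minus, Pi.sub_apply, Pi.sub_apply]; module

theorem ActsBy.add (h : ActsBy hp z x yp ym) (h' : ActsBy hp z' x' yp' ym') :
    ActsBy hp (z + z') (x + x') (yp + yp') (ym + ym') := by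
  refine ⟨?_, ?_, fun s h1 h2 => ?_, fun s h1 h2 => ?_⟩
  · rw [map_add, h.irrPlus, h'.irrPlus, Pi.add_apply]; module
  · rw [map_add, h.irrMinus, h'.irrMinus, Pi.add_apply]; module
  · rw [map_add, h.plus, h'.plus, Pi.add_apply, Pi.add_apply]; module
  · rw [map_add, h.minus, h'.minus, Pi.add_apply, Pi.add_apply]; module

theorem ActsBy.smul (h : ActsBy hp z x yp ym) (r : ℂ) :
    ActsBy hp (r • z) (r • x) (r • yp) (r • ym) := by
  refine ⟨?_, ?_, fun s h1 h2 => ?_, fun s h1 h2 => ?_⟩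
  · rw [map_smul, h.irrPlus, smul_smul]; rfl
  · rw [map_smul, h.irrMinus, smul_smul]; rfl
  · rw [map_smul, h.plus, Pi.smul_apply, Pi.smul_apply]; module
  · rw [map_smul, h.minus, Pi.smul_apply, Pi.smul_apply]; module

theorem smul_add_mul_smul_add {a c : ℕ} (x y x' y' : ℂ) :
    (x • (1 : Module.End ℂ (ProjSpace a c)) + y • topToBottom a c) *
      (x' • (1 : Module.End ℂ (ProjSpace a c)) + y' • topToBottom a c) =
      (x * x') • (1 : Module.End ℂ (ProjSpace a c)) + (x * y' + y * x') • topToBottom a c := by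
  simp only [add_mul, mul_add, smul_mul_assoc, mul_smul_comm, one_mul, mul_one,
    topToBottom_mul_self, smul_zero]
  module

theorem ActsBy.mul (h : ActsBy hp z x yp ym) (h' : ActsBy hp z' x' yp' ym') :
    ActsBy hp (z * z') (x * x') (x * yp' + yp * x') (x * ym' + ym * x') := by
  refine ⟨?_, ?_, fun s h1 h2 => ?_, fun s h1 h2 => ?_⟩
  · rw [map_mul, h.irrPlus, h'.irrPlus, smul_mul_smul_comm, mul_one]; rfl
  · rw [map_mul, h.irrMinus, h'.irrMinus, smul_mul_smul_comm, mul_one]; rfl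
  · rw [map_mul, h.plus, h'.plus, smul_add_mul_smul_add]; rfl
  · rw [map_mul, h.minus, h'.minus, smul_add_mul_smul_add]; rfl

theorem ActsBy.one : ActsBy hp 1 1 0 0 := by
  refine ⟨?_, ?_, fun s h1 h2 => ?_, fun s h1 h2 => ?_⟩ <;> simp

theorem ActsBy.eq_zero (h : ActsBy hp z x yp ym) (hx : ∀ s, s ≤ p → x s = 0)
    (hyp : ∀ s, 1 ≤ s → s < p → yp s = 0) (hym : ∀ s, 1 ≤ s → s < p → ym s = 0) : z = 0 := by
  refine IsNull.eq_zero (hp := hp) (isNull_of_plus_minus ?_ ?_ (fun s h1 h2 => ?_)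
    fun s h1 h2 => ?_)
  · rw [h.irrPlus, hx p le_rfl, zero_smul]
  · rw [h.irrMinus, hx 0 (Nat.zero_le _), zero_smul]
  · rw [h.plus, hx s h2.le, hyp s h1 h2, zero_smul, zero_smul, add_zero]
  · rw [h.minus, hx s h2.le, hym s h1 h2, zero_smul, zero_smul, add_zero]

theorem ActsBy.ext (h : ActsBy hp z x yp ym) (h' : ActsBy hp z' x' yp' ym')
    (hx : ∀ s, s ≤ p → x s = x' s) (hyp : ∀ s, 1 ≤ s → s < p → yp s = yp' s)
    (hym : ∀ s, 1 ≤ s → s < p → ym s = ym' s) : z = z' :=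
  sub_eq_zero.1 <| (h.sub h').eq_zero (fun s hs => sub_eq_zero.2 (hx s hs))
    (fun s h1 h2 => sub_eq_zero.2 (hyp s h1 h2)) fun s h1 h2 => sub_eq_zero.2 (hym s h1 h2)

theorem ActsBy.unique (h : ActsBy hp z x yp ym) (h' : ActsBy hp z x' yp' ym') :
    (∀ s, s ≤ p → x s = x' s) ∧ (∀ s, 1 ≤ s → s < p → yp s = yp' s) ∧
      ∀ s, 1 ≤ s → s < p → ym s = ym' s := by
  have hone : ∀ {r r' : ℂ},
      r • (1 : Module.End ℂ (Fin p →₀ ℂ)) = r' • (1 : Module.End ℂ (Fin p →₀ ℂ)) → r = r' := by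
    intro r r' hr
    have h1 := LinearMap.congr_fun hr (Finsupp.single ⟨0, by omega⟩ 1)
    simpa using DFunLike.congr_fun h1 ⟨0, by omega⟩
  have hP : ∀ s, 1 ≤ s → s < p → x s = x' s ∧ yp s = yp' s := fun s h1 h2 =>
    smul_add_smul_injective (by omega) ((h.plus s h1 h2).symm.trans (h'.plus s h1 h2))
  have hM : ∀ s, 1 ≤ s → s < p → x s = x' s ∧ ym s = ym' s := fun s h1 h2 =>
    smul_add_smul_injective (by omega) ((h.minus s h1 h2).symm.trans (h'.minus s h1 h2))
  refine ⟨fun s hs => ?_, fun s h1 h2 => (hP s h1 h2).2, fun s h1 h2 => (hM s h1 h2).2⟩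
  rcases Nat.eq_zero_or_pos s with rfl | h0
  · exact hone (h.irrMinus.symm.trans h'.irrMinus)
  · rcases hs.lt_or_eq with h2 | rfl
    · exact (hP s h0 h2).1
    · exact hone (h.irrPlus.symm.trans h'.irrPlus)

theorem ActsBy.irr (h : ActsBy hp z x yp ym) {s : ℕ} (h1 : 1 ≤ s) (h2 : s ≤ p) :
    irr p 1 s hp h2 z = x s • 1 := by
  rcases h2.lt_or_eq with h3 | rfl
  · refine LinearMap.ext fun v => Finsupp.ext fun i => ?_
    have h4 := LinearMap.congr_fun
      (irrToBottom_intertwines p (ε := 1) hp (a := s) (c := p - s) (by omega) (by omega)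
        (by omega) z) v
    have h5 : proj p 1 s (p - s) (by omega) (by omega) (by omega) z = _ := h.plus s h1 h3
    rw [LinearMap.comp_apply, LinearMap.comp_apply, h5] at h4
    have h6 : topToBottom s (p - s) (irrToBottom s (p - s) v) = 0 := by
      have : topToBottom s (p - s) ∘ₗ irrToBottom s (p - s) = 0 :=
        irr_hom_ext fun n _ => by simp
      exact LinearMap.congr_fun this v
    rw [LinearMap.add_apply, LinearMap.smul_apply, LinearMap.smul_apply, h6, smul_zero, add_zero,
      Module.End.one_apply] at h4
    have h7 := DFunLike.congr_fun h4 (.b i)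
    rw [irrToBottom_apply_b, Finsupp.smul_apply, irrToBottom_apply_b] at h7
    exact h7
  · exact h.irrPlus

theorem exists_actsBy (hz : z ∈ Subalgebra.center ℂ (Uq p)) :
    ∃ x yp ym : ℕ → ℂ, ActsBy hp z x yp ym := by
  have hP : ∀ s : ℕ, ∃ xy : ℂ × ℂ, ∀ h1 h2,
      projPlus p s h1 h2 z = xy.1 • 1 + xy.2 • topToBottom s (p - s) := by
    intro s
    by_cases h : 1 ≤ s ∧ s < p
    · obtain ⟨x, y, hxy⟩ := proj_central (ε := 1) (a := s) (c := p - s) (by omega) (by omega)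
        (by omega) hz
      exact ⟨(x, y), fun _ _ => hxy⟩
    · exact ⟨0, fun h1 h2 => absurd ⟨h1, h2⟩ h⟩
  have hM : ∀ s : ℕ, ∃ xy : ℂ × ℂ, ∀ h1 h2,
      projMinus p s h1 h2 z = xy.1 • 1 + xy.2 • topToBottom (p - s) s := by
    intro s
    by_cases h : 1 ≤ s ∧ s < p
    · obtain ⟨x, y, hxy⟩ := proj_central (ε := -1) (a := p - s) (c := s) (by omega) (by omega)
        (by omega) hz
      exact ⟨(x, y), fun _ _ => hxy⟩
    · exact ⟨0, fun h1 h2 => absurd ⟨h1, h2⟩ h⟩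
  choose P hP using hP
  choose M hM using hM
  obtain ⟨xP, hxP⟩ := irr_central (ε := 1) hp hz
  obtain ⟨xM, hxM⟩ := irr_central (ε := -1) hp hz
  refine ⟨fun s => if s = 0 then xM else if s = p then xP else (P s).1, fun s => (P s).2,
    fun s => (M s).2, ?_, ?_, fun s h1 h2 => ?_, fun s h1 h2 => ?_⟩
  · simp [hxP, show p ≠ 0 by omega]
  · simp [hxM]
  · rw [hP, if_neg (by omega), if_neg (by omega)]
  · have := proj_scalar_eq (ε := 1) (by omega) (by omega) (by omega) (hP s h1 h2) (hM s h1 h2)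
    rw [hM, if_neg (by omega), if_neg (by omega), this]

theorem ActsBy.mem_center (h : ActsBy hp z x yp ym) : z ∈ Subalgebra.center ℂ (Uq p) := by
  rw [Subalgebra.mem_center_iff]
  intro b
  refine sub_eq_zero.1 (IsNull.eq_zero (hp := hp) (isNull_of_plus_minus ?_ ?_
    (fun s h1 h2 => ?_) fun s h1 h2 => ?_))
  · rw [map_sub, map_mul, map_mul, h.irrPlus, mul_smul_comm, smul_mul_assoc, mul_one, one_mul,
      sub_self]
  · rw [map_sub, map_mul, map_mul, h.irrMinus, mul_smul_comm, smul_mul_assoc, mul_one, one_mul,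
      sub_self]
  · have hN := topToBottom_intertwines (p := p) (ε := 1) (a := s) (c := p - s) (by omega)
      (by omega) (by omega) b
    change topToBottom s (p - s) * projPlus p s h1 h2 b =
      projPlus p s h1 h2 b * topToBottom s (p - s) at hN
    rw [map_sub, map_mul, map_mul, h.plus, mul_add, add_mul, mul_smul_comm, mul_smul_comm,
      smul_mul_assoc, smul_mul_assoc, hN, mul_one, one_mul, sub_self]
  · have hN := topToBottom_intertwines (p := p) (ε := -1) (a := p - s) (c := s) (by omega)
      (by omega) (by omega) b
    change topToBottom (p - s) s * projMinus p s h1 h2 b =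
      projMinus p s h1 h2 b * topToBottom (p - s) s at hN
    rw [map_sub, map_mul, map_mul, h.minus, mul_add, add_mul, mul_smul_comm, mul_smul_comm,
      smul_mul_assoc, smul_mul_assoc, hN, mul_one, one_mul, sub_self]

theorem actsBy_casimir : ActsBy hp (casimir p) (casimirEig p 1) 1 1 := by
  refine ⟨irr_casimir hp le_rfl, ?_, fun s h1 h2 => ?_, fun s h1 h2 => ?_⟩
  · rw [irr_casimir, casimirEig_cross 1 0 p (by omega) (by omega)]
  · rw [projPlus, proj_casimir, Pi.one_apply, one_smul]
  · rw [projMinus, proj_casimir, casimirEig_cross 1 s (p - s) (by omega) (by omega),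
      Pi.one_apply, one_smul]

/-- A polynomial in the Casimir element acts by its values and by the values of its derivative at
the eigenvalues. -/
theorem actsBy_aeval (P : Polynomial ℂ) :
    ActsBy hp (Polynomial.aeval (casimir p) P) (fun s => P.eval (casimirEig p 1 s))
      (fun s => P.derivative.eval (casimirEig p 1 s))
      (fun s => P.derivative.eval (casimirEig p 1 s)) := by
  induction P using Polynomial.induction_on' with
  | add P Q hP hQ =>
    rw [map_add]
    convert hP.add hQ using 1 <;> ext s <;> simp
  | monomial n r =>
    rw [← Polynomial.C_mul_X_pow_eq_monomial]
    induction n with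
    | zero =>
      have h := (ActsBy.one (hp := hp)).smul r
      convert h using 1
      · simp [Algebra.algebraMap_eq_smul_one]
      · ext s; simp
      · ext s; simp
      · ext s; simp
    | succ n ih =>
      have h := ih.mul (actsBy_casimir (hp := hp))
      rw [pow_succ, ← mul_assoc, map_mul, Polynomial.aeval_X]
      convert h using 1 <;> ext s <;>
        simp only [Polynomial.eval_mul, Polynomial.derivative_mul, Polynomial.eval_add,
          Polynomial.derivative_X, Polynomial.eval_X, Polynomial.eval_one, Pi.add_apply,
          Pi.mul_apply, Pi.one_apply] <;> ring

theorem casimirEig_injOn (hp : 2 ≤ p) {s t : ℕ} (hs : s ≤ p) (ht : t ≤ p)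
    (h : casimirEig p 1 s = casimirEig p 1 t) : s = t := by
  have h0 := qq_ne_zero p
  have hs0 : qq p ^ (s : ℤ) ≠ 0 := zpow_ne_zero _ h0
  have ht0 : qq p ^ (t : ℤ) ≠ 0 := zpow_ne_zero _ h0
  have h1 := mul_left_cancel₀ (inv_ne_zero (nu_ne_zero p hp)) h
  have h1 := mul_left_cancel₀ (left_ne_zero_of_mul_eq_one (sgn_mul_self 1)) h1
  have h2 : (qq p ^ ((s : ℤ) - t) - 1) * (qq p ^ ((s : ℤ) + t) - 1) = 0 := by
    rw [zpow_sub₀ h0, zpow_add₀ h0]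
    field_simp at h1 ⊢
    linear_combination h1
  rcases mul_eq_zero.1 h2 with h3 | h3
  · rw [sub_eq_zero, qq_zpow_eq_one_iff (by omega)] at h3
    obtain ⟨k, hk⟩ := h3
    have : k = 0 := by nlinarith
    subst this
    omega
  · rw [sub_eq_zero, qq_zpow_eq_one_iff (by omega)] at h3
    obtain ⟨k, hk⟩ := h3
    have h4 : 0 ≤ k := by nlinarith
    have h5 : k ≤ 1 := by nlinarith
    interval_cases k <;> omega

end actsBy

/-! ### Existence and uniqueness of the canonical central elements -/

section canonical
variable {p : ℕ} {hp : 2 ≤ p} {z : Uq p} {x yp ym x' yp' ym' : ℕ → ℂ}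

theorem ActsBy.congr (h : ActsBy hp z x yp ym)
    (hx : ∀ s, s ≤ p → x s = x' s) (hyp : ∀ s, 1 ≤ s → s < p → yp s = yp' s)
    (hym : ∀ s, 1 ≤ s → s < p → ym s = ym' s) : ActsBy hp z x' yp' ym' :=
  ⟨by rw [h.irrPlus, hx p le_rfl], by rw [h.irrMinus, hx 0 (Nat.zero_le _)],
    fun s h1 h2 => by rw [h.plus, hx s h2.le, hyp s h1 h2],
    fun s h1 h2 => by rw [h.minus, hx s h2.le, hym s h1 h2]⟩

/-- The polynomial `3 L² - 2 L³` in the Lagrange basis polynomial `L` that vanishes at all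
eigenvalues of the Casimir element but one. It takes the same values as `L` at the eigenvalues, and
its derivative vanishes there. -/
def idemPoly (p s : ℕ) : Polynomial ℂ :=
  let L := Lagrange.basis (Finset.range (p + 1)) (casimirEig p 1) s
  3 * L ^ 2 - 2 * L ^ 3

theorem eval_lagrange (hp : 2 ≤ p) {s t : ℕ} (hs : s ≤ p) (ht : t ≤ p) :
    (Lagrange.basis (Finset.range (p + 1)) (casimirEig p 1) s).eval (casimirEig p 1 t) =
      (Pi.single s 1 : ℕ → ℂ) t := by
  have hinj : Set.InjOn (casimirEig p 1) (Finset.range (p + 1)) := by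
    intro i hi j hj h
    rw [Finset.mem_coe, Finset.mem_range] at hi hj
    exact casimirEig_injOn hp (by omega) (by omega) h
  by_cases h : t = s
  · subst h
    rw [Lagrange.eval_basis_self hinj (Finset.mem_range.2 (by omega)), Pi.single_eq_same]
  · rw [Lagrange.eval_basis_of_ne (Ne.symm h) (Finset.mem_range.2 (by omega)),
      Pi.single_eq_of_ne h]

theorem single_sq (s t : ℕ) : (Pi.single s 1 : ℕ → ℂ) t ^ 2 = (Pi.single s 1 : ℕ → ℂ) t := by
  by_cases h : t = s
  · subst h; simp
  · simp [h]

theorem eval_idemPoly (hp : 2 ≤ p) {s t : ℕ} (hs : s ≤ p) (ht : t ≤ p) :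
    (idemPoly p s).eval (casimirEig p 1 t) = (Pi.single s 1 : ℕ → ℂ) t := by
  have h := single_sq s t
  simp only [idemPoly, Polynomial.eval_sub, Polynomial.eval_mul, Polynomial.eval_pow,
    Polynomial.eval_ofNat, eval_lagrange hp hs ht]
  generalize (Pi.single s 1 : ℕ → ℂ) t = u at *
  linear_combination (1 - 2 * u) * h

theorem eval_derivative_idemPoly (hp : 2 ≤ p) {s t : ℕ} (hs : s ≤ p) (ht : t ≤ p) :
    (idemPoly p s).derivative.eval (casimirEig p 1 t) = 0 := by
  have h := single_sq s t
  simp only [idemPoly, Polynomial.derivative_sub, Polynomial.derivative_mul,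
    Polynomial.derivative_pow, Polynomial.derivative_ofNat, Polynomial.eval_sub,
    Polynomial.eval_mul, Polynomial.eval_add, Polynomial.eval_pow, Polynomial.eval_C,
    Polynomial.eval_ofNat, Polynomial.eval_zero, eval_lagrange hp hs ht]
  generalize (Pi.single s 1 : ℕ → ℂ) t = u at *
  push_cast
  generalize (Polynomial.derivative (Lagrange.basis (Finset.range (p + 1))
    (casimirEig p 1) s)).eval (casimirEig p 1 t) = v
  norm_num
  linear_combination (-6 * v) * h

theorem exists_idempotent (hp : 2 ≤ p) {s : ℕ} (hs : s ≤ p) :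
    ∃ z, ActsBy hp z (Pi.single s 1) 0 0 :=
  ⟨_, (actsBy_aeval (hp := hp) (idemPoly p s)).congr
    (fun _ ht => eval_idemPoly hp hs ht)
    (fun _ _ ht => eval_derivative_idemPoly hp hs ht.le)
    (fun _ _ ht => eval_derivative_idemPoly hp hs ht.le)⟩

/-- The element `w⁺_s + w⁻_s` is `(C - β_s) e_s`, where `C` is the Casimir element and `β_s` its
eigenvalue on `X⁺_s`. -/
theorem exists_nilpotent (hp : 2 ≤ p) {s : ℕ} (hs : s ≤ p) :
    ∃ z, ActsBy hp z 0 (Pi.single s 1) (Pi.single s 1) := by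
  have key : ∀ t, t ≤ p → ((Polynomial.X - Polynomial.C (casimirEig p 1 s)) *
      idemPoly p s).derivative.eval (casimirEig p 1 t) = (Pi.single s 1 : ℕ → ℂ) t := by
    intro t ht
    simp only [Polynomial.derivative_mul, Polynomial.eval_add, Polynomial.eval_mul,
      eval_idemPoly hp hs ht, eval_derivative_idemPoly hp hs ht, Polynomial.derivative_sub,
      Polynomial.derivative_X, Polynomial.derivative_C, Polynomial.eval_sub, Polynomial.eval_one,
      Polynomial.eval_zero]
    ring
  refine ⟨_, (actsBy_aeval (hp := hp) ((Polynomial.X - Polynomial.C (casimirEig p 1 s)) *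
    idemPoly p s)).congr (fun t ht => ?_) (fun t _ ht => key t ht.le) fun t _ ht => key t ht.le⟩
  simp only [Polynomial.eval_mul, eval_idemPoly hp hs ht, Polynomial.eval_sub, Polynomial.eval_X,
    Polynomial.eval_C, Pi.zero_apply]
  by_cases h : t = s
  · subst h; simp
  · simp [h]

/-- The two summands of `w⁺_s + w⁻_s` are separated by the projector to the weights of
`X⁺_s`, which do not occur in `X⁻_(p - s)`. -/
theorem exists_nilpotent_plus (hp : 2 ≤ p) {s : ℕ} (h1 : 1 ≤ s) (h2 : s < p) :
    ∃ z, ActsBy hp z 0 (Pi.single s 1) 0 := by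
  obtain ⟨w, hw⟩ := exists_nilpotent hp h2.le
  have hp0 : 0 < p := by omega
  have hwt : ∀ m : ℕ, qq p ^ ((s : ℤ) - 1 - 2 * m) = wt p 1 s m := by
    intro m
    simp [wt, sgn]
  refine ⟨(∑ m ∈ Finset.range s, weightProj p ((s : ℤ) - 1 - 2 * m)) * w, ?_, ?_,
    fun t ht1 ht2 => ?_, fun t ht1 ht2 => ?_⟩
  · rw [map_mul, hw.irrPlus]; simp
  · rw [map_mul, hw.irrMinus]; simp
  · rw [map_mul, hw.plus]
    by_cases hts : t = s
    · subst hts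
      rw [Pi.zero_apply, zero_smul, zero_add, Pi.single_eq_same, one_smul]
      refine projSpace_hom_ext (fun n hn => ?_) (by simp) (by simp) (by simp)
      rw [Module.End.mul_apply, topToBottom_t, map_sum, LinearMap.sum_apply,
        Finset.sum_eq_single_of_mem n (Finset.mem_range.2 hn)]
      · rw [weightProj_apply _ (d := wt p 1 t n) (by simp [projPlus, projK_b])
          (weight_pow p hp0 _ _) hp0, hwt, if_pos rfl]
      · intro m hm hmn
        rw [weightProj_apply _ (d := wt p 1 t n) (by simp [projPlus, projK_b])
          (weight_pow p hp0 _ _) hp0, hwt, if_neg]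
        intro h
        have := Finset.mem_range.1 hm
        exact hmn (wt_injOn hp0 (by omega) (by omega) h).symm
    · simp [hts]
  · rw [map_mul, hw.minus]
    by_cases hts : t = s
    · subst hts
      rw [Pi.zero_apply, zero_smul, zero_add, Pi.single_eq_same, one_smul]
      refine projSpace_hom_ext (fun n hn => ?_) (by simp) (by simp) (by simp)
      rw [Module.End.mul_apply, topToBottom_t, map_sum, LinearMap.sum_apply, Finset.sum_eq_zero]
      · simp
      · intro m hm
        rw [weightProj_apply _ (d := wt p (-1) (p - t) n) (by simp [projMinus, projK_b])
          (weight_pow p hp0 _ _) hp0, hwt, if_neg]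
        intro h
        rw [wt_cross p hp0 1 t (p - t) n (by omega)] at h
        have := Finset.mem_range.1 hm
        have := wt_injOn hp0 (by omega) (by omega) h
        omega
    · simp [hts]

/-- The data that characterize the canonical central elements. -/
structure Family.IsStandard (hp : 2 ≤ p) (C : Family p) : Prop where
  e : ∀ s, ActsBy hp (C.e s) (Pi.single (s : ℕ) 1) 0 0
  wPlus : ∀ s, ActsBy hp (C.wPlus s) 0 (Pi.single (s : ℕ) 1) 0
  wMinus : ∀ s, ActsBy hp (C.wMinus s) 0 0 (Pi.single (s : ℕ) 1)

theorem exists_isStandard (hp : 2 ≤ p) : ∃ C : Family p, C.IsStandard hp := by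
  choose e he using fun s : Fin (p + 1) => exists_idempotent hp (Nat.lt_succ_iff.1 s.2)
  choose w hw using fun s : Idx p => exists_nilpotent hp s.2.2.le
  choose wp hwp using fun s : Idx p => exists_nilpotent_plus hp s.2.1 s.2.2
  refine ⟨⟨e, wp, fun s => w s - wp s⟩, he, hwp, fun s => ?_⟩
  simpa using (hw s).sub (hwp s)

theorem tVec_of_fin {a : ℕ} (c : ℕ) (n : Fin a) :
    (Finsupp.single (.t n) 1 : ProjSpace a c) = tVec a c n := by rw [tVec, dif_pos n.2]

theorem bVec_of_fin {a : ℕ} (c : ℕ) (n : Fin a) :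
    (Finsupp.single (.b n) 1 : ProjSpace a c) = bVec a c n := by rw [bVec, dif_pos n.2]

theorem single_mul_single (s t : ℕ) (y : ℂ) : (Pi.single s 1 * Pi.single t y : ℕ → ℂ) =
    if s = t then Pi.single t y else 0 := by
  ext u
  split_ifs with h
  · subst h
    by_cases hu : u = s
    · subst hu; simp
    · simp [hu]
  · by_cases hu : u = s
    · subst hu; simp [h]
    · simp [hu]

theorem ActsBy.zero : ActsBy hp 0 0 0 0 := by simpa using (ActsBy.one (hp := hp)).smul 0

/-- A central idempotent has eigenvalues `0` and `1` and no nilpotent part. -/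
theorem ActsBy.idempotent (h : ActsBy hp z x yp ym) (hz : z * z = z) :
    (∀ s, s ≤ p → x s = 0 ∨ x s = 1) ∧ (∀ s, 1 ≤ s → s < p → yp s = 0) ∧
      ∀ s, 1 ≤ s → s < p → ym s = 0 := by
  have h1 := h.mul h
  rw [hz] at h1
  obtain ⟨hx, hyp, hym⟩ := h.unique h1
  have hx' : ∀ s, s ≤ p → x s = 0 ∨ x s = 1 := by
    intro s hs
    have h2 : x s * (x s - 1) = 0 := by
      have := hx s hs
      rw [Pi.mul_apply] at this
      linear_combination -this
    rcases mul_eq_zero.1 h2 with h3 | h3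
    · exact Or.inl h3
    · exact Or.inr (sub_eq_zero.1 h3)
  have hy : ∀ u v : ℂ, (u = 0 ∨ u = 1) → v = u * v + v * u → v = 0 := by
    rintro u v (rfl | rfl) h
    · simpa using h
    · linear_combination -h
  exact ⟨hx', fun s h1 h2 => hy _ _ (hx' s h2.le) (hyp s h1 h2),
    fun s h1 h2 => hy _ _ (hx' s h2.le) (hym s h1 h2)⟩

/-- All defining properties of the canonical central elements can be read off from their action on
the projective modules. -/
theorem Family.IsStandard.isCanonical {C : Family p} (h : C.IsStandard hp) :
    C.IsCanonical hp where
  e_mem s := (h.e s).mem_center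
  wPlus_mem s := (h.wPlus s).mem_center
  wMinus_mem s := (h.wMinus s).mem_center
  e_mul_e s s' := by
    have h1 := (h.e s).mul (h.e s')
    rw [single_mul_single] at h1
    split_ifs with hs
    · subst hs
      refine h1.ext (h.e s) ?_ ?_ ?_ <;> intros <;> simp
    · rw [if_neg (fun h => hs (Fin.ext h))] at h1
      refine h1.eq_zero ?_ ?_ ?_ <;> intros <;> simp
  e_ne_zero s h0 := by
    have h1 := h.e s
    rw [h0] at h1
    have := (h1.unique ActsBy.zero).1 s (Nat.lt_succ_iff.1 s.2)
    simp at this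
  e_primitive s f hf hff hef := by
    obtain ⟨x, yp, ym, h1⟩ := exists_actsBy (hp := hp) hf
    obtain ⟨hx, hyp, hym⟩ := h1.idempotent hff
    have h2 := (h.e s).mul h1
    rw [hef] at h2
    have hx0 : ∀ t, t ≤ p → t ≠ s → x t = 0 := by
      intro t ht hts
      rw [(h1.unique h2).1 t ht]
      simp [hts]
    rcases hx s (Nat.lt_succ_iff.1 s.2) with h3 | h3
    · left
      refine h1.eq_zero (fun t ht => ?_) hyp hym
      by_cases hts : t = s
      · rw [hts, h3]
      · exact hx0 t ht hts
    · right
      refine h1.ext (h.e s) (fun t ht => ?_) hyp hym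
      by_cases hts : t = s
      · rw [hts, h3, Pi.single_eq_same]
      · rw [hx0 t ht hts, Pi.single_eq_of_ne hts]
  e_mul_wPlus s s' := by
    have h1 := (h.e s).mul (h.wPlus s')
    rw [single_mul_single] at h1
    split_ifs with hs
    · subst hs
      refine h1.ext (h.wPlus s') ?_ ?_ ?_ <;> intros <;> simp [Idx.toFin]
    · rw [if_neg (fun h : (s : ℕ) = (s' : ℕ) => hs (Fin.ext h))] at h1
      refine h1.eq_zero ?_ ?_ ?_ <;> intros <;> simp
  e_mul_wMinus s s' := by
    have h1 := (h.e s).mul (h.wMinus s')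
    rw [single_mul_single] at h1
    split_ifs with hs
    · subst hs
      refine h1.ext (h.wMinus s') ?_ ?_ ?_ <;> intros <;> simp [Idx.toFin]
    · rw [if_neg (fun h : (s : ℕ) = (s' : ℕ) => hs (Fin.ext h))] at h1
      refine h1.eq_zero ?_ ?_ ?_ <;> intros <;> simp
  wPlus_mul_wPlus s s' := by
    refine ((h.wPlus s).mul (h.wPlus s')).eq_zero ?_ ?_ ?_ <;> intros <;> simp
  wPlus_mul_wMinus s s' := by
    refine ((h.wPlus s).mul (h.wMinus s')).eq_zero ?_ ?_ ?_ <;> intros <;> simp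
  wMinus_mul_wMinus s s' := by
    refine ((h.wMinus s).mul (h.wMinus s')).eq_zero ?_ ?_ ?_ <;> intros <;> simp
  e_irr s hs := by
    have h0 : 1 ≤ (s : ℕ) := Nat.one_le_iff_ne_zero.2 fun h => hs (Fin.ext h)
    rw [(h.e s).irr h0, Pi.single_eq_same, one_smul]
  e_zero_irr := by
    rw [(h.e 0).irrMinus]
    simp
  wPlus_plus s n := by rw [(h.wPlus s).plus, tVec_of_fin, bVec_of_fin]; simp
  wPlus_minus s n := by rw [(h.wPlus s).minus, tVec_of_fin]; simp
  wMinus_minus s n := by rw [(h.wMinus s).minus, tVec_of_fin, bVec_of_fin]; simp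
  wMinus_plus s n := by rw [(h.wMinus s).plus, tVec_of_fin]; simp

theorem smul_tVec_add_smul_bVec_injective {a c : ℕ} (ha : 0 < a) {r r' y y' : ℂ}
    (h : r • tVec a c 0 + y • bVec a c 0 = r' • tVec a c 0 + y' • bVec a c 0) :
    r = r' ∧ y = y' := by
  rw [tVec, dif_pos ha, bVec, dif_pos ha] at h
  exact ⟨by simpa using DFunLike.congr_fun h (.t ⟨0, ha⟩),
    by simpa using DFunLike.congr_fun h (.b ⟨0, ha⟩)⟩

/-- The eigenvalue of `e_s` on its own block is `1`, by the normalization on `X⁺_s` or `X⁻_p`. -/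
theorem Family.IsCanonical.eigenvalue_self {C : Family p} (h : C.IsCanonical hp) (s : Fin (p + 1))
    (hs : ActsBy hp (C.e s) x yp ym) : x s = 1 := by
  have hone : ∀ {n : ℕ} (hn : 0 < n) {r : ℂ},
      r • (1 : Module.End ℂ (Fin n →₀ ℂ)) = 1 → r = 1 := by
    intro n hn r hr
    have h1 := LinearMap.congr_fun hr (Finsupp.single ⟨0, hn⟩ 1)
    simpa using DFunLike.congr_fun h1 ⟨0, hn⟩
  by_cases h0 : s = 0
  · subst h0
    exact hone (by omega : 0 < p) (hs.irrMinus.symm.trans h.e_zero_irr)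
  · have h1 : 1 ≤ (s : ℕ) := Nat.one_le_iff_ne_zero.2 fun h => h0 (Fin.ext h)
    exact hone h1 ((hs.irr h1 (Nat.lt_succ_iff.1 s.2)).symm.trans (h.e_irr s h0))

theorem Family.IsCanonical.actsBy_e {C : Family p} (h : C.IsCanonical hp) (s : Fin (p + 1)) :
    ActsBy hp (C.e s) (Pi.single (s : ℕ) 1) 0 0 := by
  obtain ⟨x, yp, ym, h1⟩ := exists_actsBy (hp := hp) (h.e_mem s)
  have h2 := h.e_mul_e s s
  rw [if_pos rfl] at h2
  obtain ⟨_, hyp, hym⟩ := h1.idempotent h2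
  refine h1.congr (fun t ht => ?_) hyp hym
  by_cases hts : t = s
  · rw [hts, h.eigenvalue_self s h1, Pi.single_eq_same]
  · -- The eigenvalue of `e_s` on another block vanishes since `e_s e_t = 0`.
    rw [Pi.single_eq_of_ne hts]
    let t' : Fin (p + 1) := ⟨t, by omega⟩
    obtain ⟨x', yp', ym', h3⟩ := exists_actsBy (hp := hp) (h.e_mem t')
    have h4 := h1.mul h3
    have h5 : t' ≠ s := fun h => hts (congrArg Fin.val h)
    rw [h.e_mul_e, if_neg h5.symm] at h4
    have h6 := (h4.unique ActsBy.zero).1 t ht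
    rwa [Pi.mul_apply, h.eigenvalue_self t' h3, mul_one] at h6

theorem ActsBy.vanish_of_mul_eq (h : ActsBy hp z x yp ym) {s : ℕ} {e : Uq p}
    (he : ActsBy hp e (Pi.single s 1) 0 0) (hez : e * z = z) :
    (∀ t, t ≤ p → t ≠ s → x t = 0) ∧ (∀ t, 1 ≤ t → t < p → t ≠ s → yp t = 0) ∧
      ∀ t, 1 ≤ t → t < p → t ≠ s → ym t = 0 := by
  have h1 := he.mul h
  rw [hez] at h1
  obtain ⟨h2, h3, h4⟩ := h.unique h1
  refine ⟨fun t ht hts => ?_, fun t ht1 ht2 hts => ?_, fun t ht1 ht2 hts => ?_⟩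
  · rw [h2 t ht]; simp [hts]
  · rw [h3 t ht1 ht2]; simp [hts]
  · rw [h4 t ht1 ht2]; simp [hts]

/-- The defining properties determine the action of the canonical central elements on the
projective modules. -/
theorem Family.IsCanonical.isStandard {C : Family p} (h : C.IsCanonical hp) :
    C.IsStandard hp where
  e := h.actsBy_e
  wPlus s := by
    obtain ⟨x, yp, ym, h1⟩ := exists_actsBy (hp := hp) (h.wPlus_mem s)
    have h2 := h.e_mul_wPlus s.toFin s
    rw [if_pos rfl] at h2
    obtain ⟨hx, hyp, hym⟩ := h1.vanish_of_mul_eq (h.actsBy_e s.toFin) h2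
    have hP := h.wPlus_plus s ⟨0, s.2.1⟩
    have hM := h.wPlus_minus s ⟨0, by have := s.2.2; omega⟩
    rw [h1.plus, tVec_of_fin, bVec_of_fin] at hP
    rw [h1.minus, tVec_of_fin] at hM
    have hP' := smul_tVec_add_smul_bVec_injective (c := p - s) (r := x s) (y := yp s)
      (r' := 0) (y' := 1) s.2.1 (by simpa using hP)
    have hM' := smul_tVec_add_smul_bVec_injective (c := s) (r := x s) (y := ym s)
      (r' := 0) (y' := 0) (by have := s.2.2; omega : 0 < p - (s : ℕ)) (by simpa using hM)
    refine h1.congr (fun t ht => ?_) (fun t h3 h4 => ?_) fun t h3 h4 => ?_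
    · by_cases hts : t = s
      · rw [hts, hP'.1]; rfl
      · exact hx t ht hts
    · by_cases hts : t = s
      · rw [hts, hP'.2, Pi.single_eq_same]
      · rw [hyp t h3 h4 hts, Pi.single_eq_of_ne hts]
    · by_cases hts : t = s
      · rw [hts, hM'.2]; rfl
      · exact hym t h3 h4 hts
  wMinus s := by
    obtain ⟨x, yp, ym, h1⟩ := exists_actsBy (hp := hp) (h.wMinus_mem s)
    have h2 := h.e_mul_wMinus s.toFin s
    rw [if_pos rfl] at h2
    obtain ⟨hx, hyp, hym⟩ := h1.vanish_of_mul_eq (h.actsBy_e s.toFin) h2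
    have hP := h.wMinus_plus s ⟨0, s.2.1⟩
    have hM := h.wMinus_minus s ⟨0, by have := s.2.2; omega⟩
    rw [h1.plus, tVec_of_fin] at hP
    rw [h1.minus, tVec_of_fin, bVec_of_fin] at hM
    have hP' := smul_tVec_add_smul_bVec_injective (c := p - s) (r := x s) (y := yp s)
      (r' := 0) (y' := 0) s.2.1 (by simpa using hP)
    have hM' := smul_tVec_add_smul_bVec_injective (c := s) (r := x s) (y := ym s)
      (r' := 0) (y' := 1) (by have := s.2.2; omega : 0 < p - (s : ℕ)) (by simpa using hM)
    refine h1.congr (fun t ht => ?_) (fun t h3 h4 => ?_) fun t h3 h4 => ?_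
    · by_cases hts : t = s
      · rw [hts, hP'.1]; rfl
      · exact hx t ht hts
    · by_cases hts : t = s
      · rw [hts, hP'.2]; rfl
      · exact hyp t h3 h4 hts
    · by_cases hts : t = s
      · rw [hts, hM'.2, Pi.single_eq_same]
      · rw [hym t h3 h4 hts, Pi.single_eq_of_ne hts]

theorem existsUnique_isCanonical (hp : 2 ≤ p) : ∃! C : Family p, C.IsCanonical hp := by
  obtain ⟨C, hC⟩ := exists_isStandard hp
  refine ⟨C, hC.isCanonical, fun C' hC' => ?_⟩
  have h := hC'.isStandard
  refine Family.ext (funext fun s => ?_) (funext fun s => ?_) (funext fun s => ?_)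
  · exact (h.e s).ext (hC.e s) (fun _ _ => rfl) (fun _ _ _ => rfl) fun _ _ _ => rfl
  · exact (h.wPlus s).ext (hC.wPlus s) (fun _ _ => rfl) (fun _ _ _ => rfl) fun _ _ _ => rfl
  · exact (h.wMinus s).ext (hC.wMinus s) (fun _ _ => rfl) (fun _ _ _ => rfl) fun _ _ _ => rfl

end canonical

/-! ### The pseudotraces -/

section coordinates
variable (a c n m : ℕ)

/-- The coefficient of `t_n`, zero if `n ≥ a`. -/
def tCoord : ProjSpace a c →ₗ[ℂ] ℂ := if h : n < a then Finsupp.lapply (.t ⟨n, h⟩) else 0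
/-- The coefficient of `b_n`, zero if `n ≥ a`. -/
def bCoord : ProjSpace a c →ₗ[ℂ] ℂ := if h : n < a then Finsupp.lapply (.b ⟨n, h⟩) else 0
/-- The coefficient of `l_k`, zero if `k ≥ c`. -/
def lCoord : ProjSpace a c →ₗ[ℂ] ℂ := if h : n < c then Finsupp.lapply (.l ⟨n, h⟩) else 0
/-- The coefficient of `r_k`, zero if `k ≥ c`. -/
def rCoord : ProjSpace a c →ₗ[ℂ] ℂ := if h : n < c then Finsupp.lapply (.r ⟨n, h⟩) else 0

theorem tCoord_t : tCoord a c n (tVec a c m) = if m = n ∧ n < a then 1 else 0 := by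
  classical
  unfold tCoord tVec
  split_ifs <;> simp_all
theorem bCoord_b : bCoord a c n (bVec a c m) = if m = n ∧ n < a then 1 else 0 := by
  classical
  unfold bCoord bVec
  split_ifs <;> simp_all
theorem lCoord_l : lCoord a c n (lVec a c m) = if m = n ∧ n < c then 1 else 0 := by
  classical
  unfold lCoord lVec
  split_ifs <;> simp_all
theorem rCoord_r : rCoord a c n (rVec a c m) = if m = n ∧ n < c then 1 else 0 := by
  classical
  unfold rCoord rVec
  split_ifs <;> simp_all

@[simp] theorem tCoord_b : tCoord a c n (bVec a c m) = 0 := by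
  unfold tCoord bVec; split_ifs <;> simp
@[simp] theorem tCoord_l : tCoord a c n (lVec a c m) = 0 := by
  unfold tCoord lVec; split_ifs <;> simp
@[simp] theorem tCoord_r : tCoord a c n (rVec a c m) = 0 := by
  unfold tCoord rVec; split_ifs <;> simp
@[simp] theorem bCoord_t : bCoord a c n (tVec a c m) = 0 := by
  unfold bCoord tVec; split_ifs <;> simp
@[simp] theorem bCoord_l : bCoord a c n (lVec a c m) = 0 := by
  unfold bCoord lVec; split_ifs <;> simp
@[simp] theorem bCoord_r : bCoord a c n (rVec a c m) = 0 := by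
  unfold bCoord rVec; split_ifs <;> simp
@[simp] theorem lCoord_t : lCoord a c n (tVec a c m) = 0 := by
  unfold lCoord tVec; split_ifs <;> simp
@[simp] theorem lCoord_b : lCoord a c n (bVec a c m) = 0 := by
  unfold lCoord bVec; split_ifs <;> simp
@[simp] theorem lCoord_r : lCoord a c n (rVec a c m) = 0 := by
  unfold lCoord rVec; split_ifs <;> simp
@[simp] theorem rCoord_t : rCoord a c n (tVec a c m) = 0 := by
  unfold rCoord tVec; split_ifs <;> simp
@[simp] theorem rCoord_b : rCoord a c n (bVec a c m) = 0 := by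
  unfold rCoord bVec; split_ifs <;> simp
@[simp] theorem rCoord_l : rCoord a c n (lVec a c m) = 0 := by
  unfold rCoord lVec; split_ifs <;> simp

theorem bCoord_topToBottom (v : ProjSpace a c) :
    bCoord a c n (topToBottom a c v) = tCoord a c n v := by
  have : bCoord a c n ∘ₗ topToBottom a c = tCoord a c n :=
    projSpace_hom_ext (by simp [bCoord_b, tCoord_t]) (by simp) (by simp) (by simp)
  exact LinearMap.congr_fun this v

theorem bCoord_topToLeft (v : ProjSpace c a) :
    bCoord a c n (topToLeft a c v) = rCoord c a n v := by
  have : bCoord a c n ∘ₗ topToLeft a c = rCoord c a n :=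
    projSpace_hom_ext (by simp) (by simp) (by simp) (by simp [bCoord_b, rCoord_r])
  exact LinearMap.congr_fun this v

theorem bCoord_topToRight (v : ProjSpace c a) :
    bCoord a c n (topToRight a c v) = lCoord c a n v := by
  have : bCoord a c n ∘ₗ topToRight a c = lCoord c a n :=
    projSpace_hom_ext (by simp) (by simp) (by simp [bCoord_b, lCoord_l]) (by simp)
  exact LinearMap.congr_fun this v

variable (p : ℕ) (ε : ℤˣ)

theorem bCoord_K (v : ProjSpace a c) :
    bCoord a c n (projGen p ε a c .K v) = wt p ε a n * bCoord a c n v := by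
  have : bCoord a c n ∘ₗ projGen p ε a c .K = wt p ε a n • bCoord a c n := by
    refine projSpace_hom_ext ?_ ?_ ?_ ?_ <;> intro m hm
    · simp [projK_t]
    · simp only [LinearMap.comp_apply, projK_b, map_smul, LinearMap.smul_apply, bCoord_b]
      split_ifs with h
      · rw [h.1]
      · simp
    · simp [projK_l]
    · simp [projK_r]
  exact LinearMap.congr_fun this v

theorem bCoord_E (hc : 0 < c) (hn : n + 1 < a) (v : ProjSpace a c) :
    bCoord a c n (projGen p ε a c .E v) =
      co p ε a (n + 1) * bCoord a c (n + 1) v + tCoord a c (n + 1) v := by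
  have : bCoord a c n ∘ₗ projGen p ε a c .E =
      co p ε a (n + 1) • bCoord a c (n + 1) + tCoord a c (n + 1) := by
    refine projSpace_hom_ext ?_ ?_ ?_ ?_ <;> rintro (_ | m) hm
    · simp [projE_t_zero p ε hm, tCoord_t]
    · simp [projE_t p ε m hm, tCoord_t, bCoord_b, hn, show n < a by omega]
    · simp [projE_b_zero, bCoord_b]
    · simp only [LinearMap.comp_apply, projE_b, map_smul, bCoord_b, LinearMap.add_apply,
        LinearMap.smul_apply, tCoord_b, add_zero, hn, show n < a by omega, and_true,
        Nat.add_right_cancel_iff]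
      split_ifs with h
      · rw [h]
      · simp
    · simp [projE_l_zero]
    · simp [projE_l]
    · simp [projE_r_zero p ε hc, bCoord_b, show a - 1 ≠ n by omega]
    · simp [projE_r]
  exact LinearMap.congr_fun this v

theorem bCoord_E_last (hc : 0 < c) (hn : n + 1 = a) (v : ProjSpace a c) :
    bCoord a c n (projGen p ε a c .E v) = rCoord a c 0 v := by
  have : bCoord a c n ∘ₗ projGen p ε a c .E = rCoord a c 0 := by
    refine projSpace_hom_ext ?_ ?_ ?_ ?_ <;> rintro (_ | m) hm
    · simp [projE_t_zero p ε hm]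
    · simp [projE_t p ε m hm, bCoord_b, show m ≠ n by omega]
    · simp [projE_b_zero]
    · simp [projE_b, bCoord_b, show m ≠ n by omega]
    · simp [projE_l_zero]
    · simp [projE_l]
    · simp [projE_r_zero p ε hc, bCoord_b, rCoord_r, hc, show a - 1 = n by omega,
        show n < a by omega]
    · simp [projE_r, rCoord_r]
  exact LinearMap.congr_fun this v

theorem bCoord_F_zero (ha : 0 < a) (v : ProjSpace a c) :
    bCoord a c 0 (projGen p ε a c .F v) = lCoord a c (c - 1) v := by
  have : bCoord a c 0 ∘ₗ projGen p ε a c .F = lCoord a c (c - 1) := by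
    refine projSpace_hom_ext ?_ ?_ ?_ ?_ <;> intro m hm
    · obtain h1 | h1 : m + 1 < a ∨ m + 1 = a := by omega
      · simp [projF_t p ε m h1]
      · simp [projF_t_last p ε m h1]
    · simp [projF_b, bCoord_b]
    · obtain h1 | h1 : m + 1 < c ∨ m + 1 = c := by omega
      · simp [projF_l p ε m h1, lCoord_l, show m ≠ c - 1 by omega]
      · subst h1
        simp [projF_l_last p ε m rfl, lCoord_l, bCoord_b, ha]
    · simp [projF_r]
  exact LinearMap.congr_fun this v

theorem bCoord_F_succ (hn : n + 1 < a) (v : ProjSpace a c) :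
    bCoord a c (n + 1) (projGen p ε a c .F v) = bCoord a c n v := by
  have : bCoord a c (n + 1) ∘ₗ projGen p ε a c .F = bCoord a c n := by
    refine projSpace_hom_ext ?_ ?_ ?_ ?_ <;> intro m hm
    · obtain h1 | h1 : m + 1 < a ∨ m + 1 = a := by omega
      · simp [projF_t p ε m h1]
      · simp [projF_t_last p ε m h1]
    · simp [projF_b, bCoord_b, hn, show n < a by omega]
    · obtain h1 | h1 : m + 1 < c ∨ m + 1 = c := by omega
      · simp [projF_l p ε m h1]
      · simp [projF_l_last p ε m h1, bCoord_b]
    · simp [projF_r]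
  exact LinearMap.congr_fun this v

end coordinates

section trace
variable {p a c : ℕ} (ε : ℤˣ) (ha : 0 < a) (hc : 0 < c) (h : a + c = p)

/-- The sum of the matrix coefficients of `x` from `t_n` to `b_n` in a projective module. -/
def topBottomTrace : Uq p →ₗ[ℂ] ℂ :=
  ∑ n ∈ Finset.range a, bCoord a c n ∘ₗ LinearMap.applyₗ (tVec a c n) ∘ₗ
    (proj p ε a c ha hc h).toLinearMap

theorem topBottomTrace_apply (x : Uq p) : topBottomTrace ε ha hc h x =
    ∑ n ∈ Finset.range a, bCoord a c n (proj p ε a c ha hc h x (tVec a c n)) := by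
  simp [topBottomTrace]

/-- The defect of symmetry of `topBottomTrace` for `E` is antisymmetric in the two projective
modules of a block. -/
theorem topBottomTrace_mul_E (x : Uq p) :
    topBottomTrace ε ha hc h (x * E p) - topBottomTrace ε ha hc h (E p * x) =
      rCoord c a 0 (proj p (-ε) c a hc ha ((Nat.add_comm c a).trans h) x (tVec c a (c - 1))) -
      rCoord a c 0 (proj p ε a c ha hc h x (tVec a c (a - 1))) := by
  obtain ⟨a, rfl⟩ : ∃ a', a = a' + 1 := ⟨a - 1, by omega⟩
  have hN := fun v => LinearMap.congr_fun (topToBottom_intertwines (ε := ε) ha hc h x) v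
  have hL := LinearMap.congr_fun (topToLeft_intertwines (ε := ε) ha hc h x)
    (tVec c (a + 1) (c - 1))
  rw [LinearMap.comp_apply, LinearMap.comp_apply, topToLeft_t] at hL
  rw [topBottomTrace_apply, topBottomTrace_apply, Finset.sum_range_succ', Finset.sum_range_succ]
  simp only [map_mul, Module.End.mul_apply, proj_cls]
  rw [projE_t_zero p ε ha, ← hL, bCoord_topToLeft, bCoord_E_last _ _ _ _ _ hc rfl,
    Nat.add_sub_cancel, add_sub_add_comm, ← Finset.sum_sub_distrib, Finset.sum_eq_zero, zero_add]
  intro n hn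
  have hn' := Finset.mem_range.1 hn
  have hN' := hN (tVec (a + 1) c n)
  rw [LinearMap.comp_apply, LinearMap.comp_apply, topToBottom_t] at hN'
  rw [projE_t p ε n (by omega), map_add, map_smul, map_add, map_smul, ← hN', bCoord_topToBottom,
    bCoord_E _ _ _ _ _ hc (by omega), smul_eq_mul, sub_self]

/-- The defect of symmetry of `topBottomTrace` for `F` is antisymmetric in the two projective
modules of a block. -/
theorem topBottomTrace_mul_F (x : Uq p) :
    topBottomTrace ε ha hc h (x * F p) - topBottomTrace ε ha hc h (F p * x) =
      lCoord c a (a - 1) (proj p (-ε) c a hc ha ((Nat.add_comm c a).trans h) x (tVec c a 0)) -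
      lCoord a c (c - 1) (proj p ε a c ha hc h x (tVec a c 0)) := by
  obtain ⟨a, rfl⟩ : ∃ a', a = a' + 1 := ⟨a - 1, by omega⟩
  have hR := LinearMap.congr_fun (topToRight_intertwines (ε := ε) ha hc h x) (tVec c (a + 1) 0)
  rw [LinearMap.comp_apply, LinearMap.comp_apply, topToRight_t] at hR
  rw [topBottomTrace_apply, topBottomTrace_apply, Finset.sum_range_succ, Finset.sum_range_succ']
  simp only [map_mul, Module.End.mul_apply, proj_cls]
  rw [projF_t_last p ε a rfl, ← hR, bCoord_topToRight, bCoord_F_zero _ _ _ _ ha,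
    Nat.add_sub_cancel, add_sub_add_comm, ← Finset.sum_sub_distrib, Finset.sum_eq_zero, zero_add]
  intro n hn
  have hn' := Finset.mem_range.1 hn
  rw [projF_t p ε n (by omega), bCoord_F_succ _ _ _ _ _ (by omega), sub_self]

theorem topBottomTrace_mul_K (x : Uq p) :
    topBottomTrace ε ha hc h (x * K p) = topBottomTrace ε ha hc h (K p * x) := by
  rw [topBottomTrace_apply, topBottomTrace_apply]
  refine Finset.sum_congr rfl fun n _ => ?_
  simp only [map_mul, Module.End.mul_apply, proj_cls]
  rw [projK_t, map_smul, map_smul, bCoord_K, smul_eq_mul]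

/-- The sum of `topBottomTrace` over the two projective modules of a block. -/
def blockTrace : Uq p →ₗ[ℂ] ℂ :=
  topBottomTrace ε ha hc h + topBottomTrace (-ε) hc ha ((Nat.add_comm c a).trans h)

theorem blockTrace_mul_comm (x y : Uq p) :
    blockTrace ε ha hc h (x * y) = blockTrace ε ha hc h (y * x) := by
  refine Uq.induction (by omega)
    (P := fun x => ∀ y, blockTrace ε ha hc h (x * y) = blockTrace ε ha hc h (y * x))
    ?_ ?_ ?_ ?_ ?_ ?_ x y
  · intro y
    have h1 := topBottomTrace_mul_E ε ha hc h y
    have h2 := topBottomTrace_mul_E (-ε) hc ha ((Nat.add_comm c a).trans h) y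
    simp only [neg_neg] at h2
    rw [blockTrace, LinearMap.add_apply, LinearMap.add_apply]
    linear_combination -h1 - h2
  · intro y
    have h1 := topBottomTrace_mul_F ε ha hc h y
    have h2 := topBottomTrace_mul_F (-ε) hc ha ((Nat.add_comm c a).trans h) y
    simp only [neg_neg] at h2
    rw [blockTrace, LinearMap.add_apply, LinearMap.add_apply]
    linear_combination -h1 - h2
  · intro y
    rw [blockTrace, LinearMap.add_apply, LinearMap.add_apply, topBottomTrace_mul_K,
      topBottomTrace_mul_K]
  · intro r y
    rw [Algebra.commutes]
  · intro x y hx hy z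
    rw [add_mul, mul_add, map_add, map_add, hx, hy]
  · intro x y hx hy z
    rw [mul_assoc, hx, mul_assoc, hy, mul_assoc]

theorem trace_mul_bottomToTop (α : ℂ) (A : Module.End ℂ (ProjSpace a c)) :
    LinearMap.trace ℂ (ProjSpace a c) (A * bottomToTop α a c) =
      α * ∑ n ∈ Finset.range a, bCoord a c n (A (tVec a c n)) := by
  classical
  rw [LinearMap.trace_eq_matrix_trace ℂ Finsupp.basisSingleOne, Matrix.trace, Finset.mul_sum,
    Finset.sum_range]
  symm
  refine Finset.sum_of_injOn (fun n : Fin a => ProjIdx.b n) ?_ ?_ ?_ ?_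
  · intro i _ j _ hij
    simpa using hij
  · intro i _
    simp
  · rintro (i | i | i | i) _ hi
    · simp [LinearMap.toMatrix_apply, bottomToTop]
    · simp at hi
    · simp [LinearMap.toMatrix_apply, bottomToTop]
    · simp [LinearMap.toMatrix_apply, bottomToTop]
  · intro i _
    simp [LinearMap.toMatrix_apply, bottomToTop, bCoord, tVec_of_fin]

end trace

theorem pseudotrace_apply {p : ℕ} (a₀ : ℂ) (s : ℕ) (h1 : 1 ≤ s) (h2 : s < p) (x : Uq p) :
    pseudotrace p a₀ s h1 h2 x = alpha p a₀ s *
      blockTrace 1 (a := s) (c := p - s) (by omega) (by omega) (by omega) (K p ^ (p - 1) * x) := by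
  have e : pseudotrace p a₀ s h1 h2 x =
      LinearMap.trace ℂ (ProjSpace s (p - s) × ProjSpace (p - s) s) (LinearMap.prodMap
        (projPlus p s h1 h2 (K p ^ (p - 1) * x) * bottomToTop (alpha p a₀ s) s (p - s))
        (projMinus p s h1 h2 (K p ^ (p - 1) * x) * bottomToTop (alpha p a₀ s) (p - s) s)) := rfl
  rw [e, LinearMap.trace_prodMap', trace_mul_bottomToTop, trace_mul_bottomToTop, ← mul_add,
    blockTrace, LinearMap.add_apply, topBottomTrace_apply, topBottomTrace_apply]
  rfl

/-! ### The cointegral and the Radford map -/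

section cointegral
variable {p : ℕ}

theorem HasWeight.weightProj_mul {x : Uq p} {m : ℤ} (hx : HasWeight p x m) (k : ℤ) :
    weightProj p k * x = x * weightProj p (k - 2 * m) := by
  rw [weightProj, weightProj, smul_mul_assoc, mul_smul_comm, Finset.sum_mul, Finset.mul_sum]
  congr 1
  refine Finset.sum_congr rfl fun j _ => ?_
  rw [smul_mul_assoc, hx.K_pow_mul, mul_smul_comm, smul_smul, ← mul_pow,
    ← zpow_add₀ (qq_ne_zero p)]
  congr 3
  ring

theorem qCosh_mul_of_K_mul_zpow {y : Uq p} {k : ℤ} (hy : K p * y = qq p ^ k • y) (m : ℤ) :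
    qCosh p m * y = ((nu p)⁻¹ * (qq p ^ (m + k) + (qq p ^ (m + k))⁻¹)) • y := by
  rw [qCosh_mul_of_K_mul (zpow_ne_zero _ (qq_ne_zero p)) hy, zpow_add₀ (qq_ne_zero p), mul_inv]

theorem qq_zpow_add_two_mul (hp : 0 < p) (k : ℤ) : qq p ^ (k + 2 * p) = qq p ^ k := by
  rw [zpow_add₀ (qq_ne_zero p), (qq_zpow_eq_one_iff hp _).2 dvd_rfl, mul_one]

/-- The element `F ^ (p - 1) E ^ (p - 1) P₀`, a multiple of the cointegral. -/
def rawCointegral (p : ℕ) : Uq p := F p ^ (p - 1) * E p ^ (p - 1) * weightProj p 0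

theorem cointegral_eq (hp : 0 < p) : cointegral p =
    ((Real.sqrt ((p : ℝ) / 2) : ℂ) / qFactorial p (p - 1) ^ 2 * ((2 * p : ℕ) : ℂ)) •
      rawCointegral p := by
  have h0 : ((2 * p : ℕ) : ℂ) ≠ 0 := by exact_mod_cast (by omega : 2 * p ≠ 0)
  rw [cointegral, rawCointegral, weightProj, mul_smul_comm, smul_smul,
    mul_assoc (_ / _) _ (_ : ℂ)⁻¹, mul_inv_cancel₀ h0, mul_one]
  simp

theorem K_mul_rawCointegral : K p * rawCointegral p = rawCointegral p := by
  have h := (((hasWeight_F (p := p)).pow (p - 1)).mul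
    (hasWeight_E.pow (p - 1))).K_mul_mul_weightProj 0
  rw [rawCointegral, h]
  simp

theorem rawCointegral_mul_K : rawCointegral p * K p = rawCointegral p := by
  have h : Commute (K p) (weightProj p 0) := by
    rw [weightProj]
    exact (Commute.sum_right _ _ _ fun j _ =>
      ((Commute.refl (K p)).pow_right j).smul_right _).smul_right _
  rw [rawCointegral, mul_assoc, ← h.eq, K_mul_weightProj, zpow_zero, one_smul]

theorem F_mul_rawCointegral (hp : 0 < p) : F p * rawCointegral p = 0 := by
  rw [rawCointegral, ← mul_assoc, ← mul_assoc, ← pow_succ', Nat.sub_add_cancel hp, F_pow_self,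
    zero_mul, zero_mul]

theorem rawCointegral_mul_E (hp : 0 < p) : rawCointegral p * E p = 0 := by
  rw [rawCointegral, mul_assoc, hasWeight_E.weightProj_mul, ← mul_assoc, mul_assoc (F p ^ _),
    ← pow_succ, Nat.sub_add_cancel hp, E_pow_self, mul_zero, zero_mul]

/-- Here `E` is moved across `F ^ (p - 1)`; the two terms in `K` cancel as `q ^ (2p) = 1`. -/
theorem E_mul_rawCointegral (hp : 2 ≤ p) : E p * rawCointegral p = 0 := by
  obtain ⟨n, rfl⟩ : ∃ n, p = n + 2 := ⟨p - 2, by omega⟩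
  set y := E (n + 2) ^ (n + 1) * weightProj (n + 2) 0 with hy
  have hw := (hasWeight_E.pow (p := n + 2) (n + 1)).K_mul_mul_weightProj 0
  rw [← hy] at hw
  have h0 : F (n + 2) * E (n + 2) * y = 0 := by
    rw [hy, ← mul_assoc, mul_assoc (F _), ← pow_succ', E_pow_self, mul_zero, zero_mul]
  have h1 : E (n + 2) * rawCointegral (n + 2) =
      E (n + 2) * F (n + 2) ^ (n + 1) * y := by
    rw [rawCointegral, hy]
    simp only [mul_assoc]
    rfl
  rw [h1, E_mul_F_pow hp, mul_assoc, sub_mul, casimir, add_mul, h0, zero_add,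
    qCosh_mul_of_K_mul_zpow hw, qCosh_mul_of_K_mul_zpow hw]
  have e1 : (1 + (2 * (((n + 1 : ℕ) : ℤ) * 1) + 0)) = -1 + 2 * ((n + 2 : ℕ) : ℤ) := by
    push_cast; ring
  have e2 : (-1 - 2 * (n : ℤ) + (2 * (((n + 1 : ℕ) : ℤ) * 1) + 0)) = 1 := by
    push_cast; ring
  rw [e1, e2, qq_zpow_add_two_mul (by omega), zpow_neg, inv_inv, add_comm (qq _ ^ (1 : ℤ))⁻¹,
    sub_self, mul_zero]

theorem rawCointegral_mul_F (hp : 2 ≤ p) : rawCointegral p * F p = 0 := by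
  obtain ⟨n, rfl⟩ : ∃ n, p = n + 2 := ⟨p - 2, by omega⟩
  have hw := (hasWeight_E.pow (p := n + 2) n).K_mul_mul_weightProj 2
  have hw' := K_mul_weightProj (p := n + 2) 2
  have hc : Commute (E (n + 2) ^ n) (casimir (n + 2)) := (commute_casimir hp).1.pow_left n
  have h1 : rawCointegral (n + 2) * F (n + 2) = F (n + 2) ^ (n + 1) *
      (E (n + 2) ^ n * (E (n + 2) * F (n + 2)) * weightProj (n + 2) 2) := by
    rw [rawCointegral, mul_assoc, hasWeight_F.weightProj_mul]
    rw [show n + 2 - 1 = n + 1 by omega, pow_succ (E (n + 2))]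
    simp only [mul_assoc]
    rfl
  have h0 : F (n + 2) ^ (n + 1) * F (n + 2) = 0 := by rw [← pow_succ, F_pow_self]
  rw [h1, E_mul_F _ hp, mul_sub, sub_mul, hc.eq, mul_assoc, mul_assoc (E _ ^ n),
    qCosh_mul_of_K_mul_zpow hw', mul_smul_comm, mul_sub, casimir, add_mul, mul_add,
    mul_assoc (F _), ← mul_assoc _ (F _), h0, zero_mul, zero_add,
    qCosh_mul_of_K_mul_zpow hw, ← mul_sub]
  have e1 : (1 + (2 * ((n : ℤ) * 1) + 2)) = -1 + 2 * ((n + 2 : ℕ) : ℤ) := by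
    push_cast; ring
  have e2 : (-1 + 2 : ℤ) = 1 := by norm_num
  rw [e1, e2, qq_zpow_add_two_mul (by omega), zpow_neg, inv_inv, add_comm (qq _ ^ (1 : ℤ))⁻¹,
    sub_self, mul_zero]

end cointegral

section radford
variable {p : ℕ}

/-- The contraction `x ⊗ y ↦ β(x) y`. -/
def contractLeft (β : Uq p →ₗ[ℂ] ℂ) : Uq p ⊗[ℂ] Uq p →ₗ[ℂ] Uq p :=
  (TensorProduct.lid ℂ (Uq p)).toLinearMap ∘ₗ LinearMap.rTensor (Uq p) β

@[simp] theorem contractLeft_tmul (β : Uq p →ₗ[ℂ] ℂ) (x y : Uq p) :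
    contractLeft β (x ⊗ₜ y) = β x • y := by simp [contractLeft]

theorem radford_eq [NeZero p] (β : Uq p →ₗ[ℂ] ℂ) :
    radford p β = contractLeft β (comulHom p (cointegral p)) := rfl

theorem contractLeft_one_tmul_mul (β : Uq p →ₗ[ℂ] ℂ) (x : Uq p) (t : Uq p ⊗[ℂ] Uq p) :
    contractLeft β ((1 ⊗ₜ x) * t) = x * contractLeft β t := by
  induction t using TensorProduct.induction_on with
  | zero => simp
  | tmul a b => simp
  | add a b ha hb => rw [mul_add, map_add, map_add, ha, hb, mul_add]

theorem contractLeft_mul_one_tmul (β : Uq p →ₗ[ℂ] ℂ) (x : Uq p) (t : Uq p ⊗[ℂ] Uq p) :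
    contractLeft β (t * (1 ⊗ₜ x)) = contractLeft β t * x := by
  induction t using TensorProduct.induction_on with
  | zero => simp
  | tmul a b => simp
  | add a b ha hb => rw [add_mul, map_add, map_add, ha, hb, add_mul]

theorem contractLeft_tmul_one_mul (β : Uq p →ₗ[ℂ] ℂ) (x : Uq p) (t : Uq p ⊗[ℂ] Uq p) :
    contractLeft β ((x ⊗ₜ 1) * t) = contractLeft (β ∘ₗ LinearMap.mulLeft ℂ x) t := by
  induction t using TensorProduct.induction_on with
  | zero => simp
  | tmul a b => simp
  | add a b ha hb => rw [mul_add, map_add, map_add, ha, hb]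

theorem contractLeft_mul_tmul_one (β : Uq p →ₗ[ℂ] ℂ) (x : Uq p) (t : Uq p ⊗[ℂ] Uq p) :
    contractLeft β (t * (x ⊗ₜ 1)) = contractLeft (β ∘ₗ LinearMap.mulRight ℂ x) t := by
  induction t using TensorProduct.induction_on with
  | zero => simp
  | tmul a b => simp
  | add a b ha hb => rw [add_mul, map_add, map_add, ha, hb]

theorem comulHom_E : comulHom p (E p) = 1 ⊗ₜ E p + E p ⊗ₜ K p := lift_cls _ _ _ _
theorem comulHom_F : comulHom p (F p) = Ki p ⊗ₜ F p + F p ⊗ₜ 1 := lift_cls _ _ _ _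
theorem comulHom_K : comulHom p (K p) = K p ⊗ₜ K p := lift_cls _ _ _ _

/-- The coproduct of the (rescaled) cointegral. -/
def Dc (p : ℕ) : Uq p ⊗[ℂ] Uq p := comulHom p (rawCointegral p)

/-- Negatives in `U ⊗ U` are written as multiples by `-1`, which uses only the additive structure
of the tensor product. -/
theorem eq_neg_one_smul_of_add_eq_zero {M : Type*} [AddCommMonoid M] [Module ℂ M] {x y : M}
    (h : x + y = 0) : x = (-1 : ℂ) • y := by
  have h1 : y + (-1 : ℂ) • y = 0 := by
    conv_lhs => rw [← one_smul ℂ y, smul_smul, ← add_smul]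
    norm_num
  calc x = x + (y + (-1 : ℂ) • y) := by rw [h1, add_zero]
    _ = (-1 : ℂ) • y := by rw [← add_assoc, h, zero_add]

section move
open Algebra.TensorProduct

theorem tmul_one_mul_one_tmul (x y : Uq p) :
    (x ⊗ₜ[ℂ] (1 : Uq p)) * ((1 : Uq p) ⊗ₜ[ℂ] y) = x ⊗ₜ y := by simp

theorem one_tmul_mul_tmul_one (x y : Uq p) :
    ((1 : Uq p) ⊗ₜ[ℂ] y) * (x ⊗ₜ[ℂ] (1 : Uq p)) = x ⊗ₜ y := by simp

theorem one_tmul_mul_one_tmul (x y : Uq p) :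
    ((1 : Uq p) ⊗ₜ[ℂ] x) * ((1 : Uq p) ⊗ₜ[ℂ] y) = 1 ⊗ₜ (x * y) := by simp

theorem tmul_one_mul_tmul_one (x y : Uq p) :
    (x ⊗ₜ[ℂ] (1 : Uq p)) * (y ⊗ₜ[ℂ] (1 : Uq p)) = (x * y) ⊗ₜ 1 := by simp

theorem one_tmul_K_mul_Dc : (1 ⊗ₜ[ℂ] K p) * Dc p = (Ki p ⊗ₜ[ℂ] 1) * Dc p := by
  have h : comulHom p (K p) * Dc p = Dc p := by rw [Dc, ← map_mul, K_mul_rawCointegral]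
  conv_rhs => rw [← h, comulHom_K]
  rw [← mul_assoc, tmul_mul_tmul, Ki_mul_K, one_mul]

theorem Dc_mul_one_tmul_K : Dc p * (1 ⊗ₜ[ℂ] K p) = Dc p * (Ki p ⊗ₜ[ℂ] 1) := by
  have h : Dc p * comulHom p (K p) = Dc p := by rw [Dc, ← map_mul, rawCointegral_mul_K]
  conv_rhs => rw [← h, comulHom_K]
  rw [mul_assoc, tmul_mul_tmul, K_mul_Ki, mul_one]

theorem one_tmul_Ki_mul_Dc : (1 ⊗ₜ[ℂ] Ki p) * Dc p = (K p ⊗ₜ[ℂ] 1) * Dc p := by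
  have h : Dc p = (K p ⊗ₜ[ℂ] 1) * ((1 ⊗ₜ[ℂ] K p) * Dc p) := by
    rw [one_tmul_K_mul_Dc, ← mul_assoc, tmul_mul_tmul, K_mul_Ki, mul_one,
      ← Algebra.TensorProduct.one_def, one_mul]
  conv_lhs => rw [h]
  rw [← mul_assoc, ← mul_assoc, one_tmul_mul_tmul_one, tmul_mul_tmul, Ki_mul_K, mul_one]

/-- Multiplication of the second leg of `Δ(c)` by `E` is multiplication of the first leg by the
antipode `-E K⁻¹` of `E`, because `E c = 0`. -/
theorem one_tmul_E_mul_Dc (hp : 2 ≤ p) :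
    (1 ⊗ₜ[ℂ] E p) * Dc p = (-1 : ℂ) • (((E p * Ki p) ⊗ₜ[ℂ] 1) * Dc p) := by
  have h : comulHom p (E p) * Dc p = 0 := by
    rw [Dc, ← map_mul, E_mul_rawCointegral hp, map_zero]
  rw [comulHom_E, add_mul, ← tmul_one_mul_one_tmul (E p), mul_assoc, one_tmul_K_mul_Dc,
    ← mul_assoc, tmul_one_mul_tmul_one] at h
  exact eq_neg_one_smul_of_add_eq_zero h

theorem Dc_mul_one_tmul_E (hp : 2 ≤ p) :
    Dc p * (1 ⊗ₜ[ℂ] E p) = (-1 : ℂ) • (Dc p * ((Ki p * E p) ⊗ₜ[ℂ] 1)) := by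
  have h : Dc p * comulHom p (E p) = 0 := by
    rw [Dc, ← map_mul, rawCointegral_mul_E (by omega), map_zero]
  rw [comulHom_E, mul_add, ← one_tmul_mul_tmul_one (E p), ← mul_assoc, Dc_mul_one_tmul_K,
    mul_assoc, tmul_one_mul_tmul_one] at h
  exact eq_neg_one_smul_of_add_eq_zero h

theorem one_tmul_F_mul_Dc (hp : 2 ≤ p) :
    (1 ⊗ₜ[ℂ] F p) * Dc p = (-1 : ℂ) • (((K p * F p) ⊗ₜ[ℂ] 1) * Dc p) := by
  have h : comulHom p (F p) * Dc p = 0 := by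
    rw [Dc, ← map_mul, F_mul_rawCointegral (by omega), map_zero]
  have h1 : (K p ⊗ₜ[ℂ] 1) * (comulHom p (F p) * Dc p) = 0 := by rw [h, mul_zero]
  rw [comulHom_F, add_mul, mul_add, ← mul_assoc, ← mul_assoc, tmul_mul_tmul, tmul_mul_tmul,
    K_mul_Ki, one_mul, one_mul] at h1
  exact eq_neg_one_smul_of_add_eq_zero h1

theorem Dc_mul_one_tmul_F (hp : 2 ≤ p) :
    Dc p * (1 ⊗ₜ[ℂ] F p) = (-1 : ℂ) • (Dc p * ((F p * K p) ⊗ₜ[ℂ] 1)) := by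
  have h : Dc p * comulHom p (F p) = 0 := by
    rw [Dc, ← map_mul, rawCointegral_mul_F hp, map_zero]
  have h1 : (Dc p * comulHom p (F p)) * (K p ⊗ₜ[ℂ] 1) = 0 := by rw [h, zero_mul]
  rw [comulHom_F, mul_add, add_mul, mul_assoc, mul_assoc, tmul_mul_tmul, tmul_mul_tmul,
    Ki_mul_K, mul_one, mul_one] at h1
  exact eq_neg_one_smul_of_add_eq_zero h1

/-- The Casimir element can be moved from one leg of the coproduct of the cointegral to the other,
since it is fixed by the antipode. -/
theorem one_tmul_casimir_mul_Dc (hp : 2 ≤ p) :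
    (1 ⊗ₜ[ℂ] casimir p) * Dc p = (casimir p ⊗ₜ[ℂ] 1) * Dc p := by
  have h1 : (1 ⊗ₜ[ℂ] (F p * E p)) * Dc p = ((E p * F p) ⊗ₜ[ℂ] 1) * Dc p := by
    rw [← one_tmul_mul_one_tmul, mul_assoc, one_tmul_E_mul_Dc hp, mul_smul_comm, ← mul_assoc,
      one_tmul_mul_tmul_one, ← tmul_one_mul_one_tmul, mul_assoc, one_tmul_F_mul_Dc hp,
      mul_smul_comm, smul_smul, neg_one_mul, neg_neg, one_smul, ← mul_assoc,
      tmul_one_mul_tmul_one, mul_assoc (E p), ← mul_assoc (Ki p), Ki_mul_K, one_mul]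
  have h2 : (1 ⊗ₜ[ℂ] qCosh p 1) * Dc p = (qCosh p (-1) ⊗ₜ[ℂ] 1) * Dc p := by
    have e : (qq p ^ (-1 : ℤ))⁻¹ = qq p ^ (1 : ℤ) := by rw [zpow_neg, inv_inv]
    simp only [qCosh, TensorProduct.tmul_smul, TensorProduct.tmul_add, smul_mul_assoc, add_mul,
      one_tmul_K_mul_Dc, one_tmul_Ki_mul_Dc, ← TensorProduct.smul_tmul', TensorProduct.add_tmul, e]
    rw [zpow_neg, add_comm]
  have h3 : casimir p = E p * F p + qCosh p (-1) := by rw [E_mul_F p hp, sub_add_cancel]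
  conv_rhs => rw [h3]
  rw [casimir, TensorProduct.tmul_add, TensorProduct.add_tmul, add_mul, add_mul, h1, h2]

end move

/-- The element `K ^ p` is central, as `q ^ (2p) = 1`. -/
theorem commute_K_pow_self (hp : 0 < p) :
    Commute (K p ^ p) (E p) ∧ Commute (K p ^ p) (F p) := by
  have h2 : ∀ {m : ℤ}, (qq p ^ (2 * m)) ^ p = 1 := by
    intro m
    rw [← zpow_natCast, ← zpow_mul, qq_zpow_eq_one_iff hp]
    exact ⟨m, by ring⟩
  constructor
  · rw [Commute, SemiconjBy, hasWeight_E.K_pow_mul, h2, one_smul]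
  · rw [Commute, SemiconjBy, hasWeight_F.K_pow_mul, h2, one_smul]

/-- A functional `x ↦ τ(K ^ (p - 1) x)` with `τ` symmetric satisfies the identities of a
`q`-character, by which its image under the Radford map is central. -/
theorem contractLeft_mem_center (hp : 2 ≤ p) {β τ : Uq p →ₗ[ℂ] ℂ}
    (hβ : ∀ x, β x = τ (K p ^ (p - 1) * x)) (hτ : ∀ x y, τ (x * y) = τ (y * x)) :
    contractLeft β (Dc p) ∈ Subalgebra.center ℂ (Uq p) := by
  have hk : K p ^ p = K p ^ (p - 1) * K p := by rw [← pow_succ, Nat.sub_add_cancel (by omega)]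
  have hk' : K p ^ p = K p * K p ^ (p - 1) := by rw [← pow_succ', Nat.sub_add_cancel (by omega)]
  have hkk : K p ^ (p - 1) = K p ^ p * Ki p := by rw [hk, mul_assoc, K_mul_Ki, mul_one]
  have hkk' : K p ^ (p - 1) = Ki p * K p ^ p := by rw [hk', ← mul_assoc, Ki_mul_K, one_mul]
  obtain ⟨hcE, hcF⟩ := commute_K_pow_self (p := p) (by omega)
  -- It suffices that `K ^ (p - 1) x = y K ^ (p - 1)`.
  have key : ∀ x y : Uq p, K p ^ (p - 1) * x = y * K p ^ (p - 1) →
      β ∘ₗ LinearMap.mulLeft ℂ x = β ∘ₗ LinearMap.mulRight ℂ y := by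
    intro x y hxy
    refine LinearMap.ext fun z => ?_
    rw [LinearMap.comp_apply, LinearMap.comp_apply, LinearMap.mulLeft_apply,
      LinearMap.mulRight_apply, hβ, hβ, ← mul_assoc, hxy, mul_assoc, hτ, mul_assoc]
  -- Here `x` and `y` are the antipodes of a generator, obtained on the two sides of `Δ(c)`.
  refine (mem_center_iff (by omega)).2 ⟨?_, ?_, ?_⟩
  · rw [Commute, SemiconjBy, ← contractLeft_one_tmul_mul, ← contractLeft_mul_one_tmul,
      one_tmul_E_mul_Dc hp, Dc_mul_one_tmul_E hp, map_smul, map_smul, contractLeft_tmul_one_mul,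
      contractLeft_mul_tmul_one, key]
    rw [hkk', mul_assoc, ← mul_assoc _ (E p), hcE.eq, ← hkk', hkk]
    simp only [mul_assoc]
  · rw [Commute, SemiconjBy, ← contractLeft_one_tmul_mul, ← contractLeft_mul_one_tmul,
      one_tmul_F_mul_Dc hp, Dc_mul_one_tmul_F hp, map_smul, map_smul, contractLeft_tmul_one_mul,
      contractLeft_mul_tmul_one, key]
    rw [← mul_assoc, ← hk, mul_assoc, ← hk', hcF.eq]
  · rw [Commute, SemiconjBy, ← contractLeft_one_tmul_mul, ← contractLeft_mul_one_tmul,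
      one_tmul_K_mul_Dc, Dc_mul_one_tmul_K, contractLeft_tmul_one_mul,
      contractLeft_mul_tmul_one, key]
    rw [hkk', mul_assoc, ← hkk, hkk']

/-- A functional that vanishes on the multiples of `(C - b)²`, with `C` the Casimir element, is
mapped to an element of the generalized eigenspace of `b`. -/
theorem casimir_sub_sq_mul_contractLeft (hp : 2 ≤ p) (β : Uq p →ₗ[ℂ] ℂ) (b : ℂ)
    (hβ : ∀ x, β ((casimir p + (-b) • 1) ^ 2 * x) = 0) :
    (casimir p + (-b) • 1) ^ 2 * contractLeft β (Dc p) = 0 := by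
  set C := casimir p + (-b) • 1 with hC
  have h1 : (1 ⊗ₜ[ℂ] C) * Dc p = (C ⊗ₜ[ℂ] 1) * Dc p := by
    rw [hC, TensorProduct.tmul_add, TensorProduct.add_tmul, add_mul, add_mul,
      one_tmul_casimir_mul_Dc hp, TensorProduct.tmul_smul, TensorProduct.smul_tmul']
  have h2 : (1 ⊗ₜ[ℂ] (C ^ 2)) * Dc p = ((C ^ 2) ⊗ₜ[ℂ] 1) * Dc p := by
    rw [sq, ← one_tmul_mul_one_tmul, mul_assoc, h1, ← mul_assoc, one_tmul_mul_tmul_one,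
      ← tmul_one_mul_one_tmul, mul_assoc, h1, ← mul_assoc, tmul_one_mul_tmul_one]
  rw [← contractLeft_one_tmul_mul, h2, contractLeft_tmul_one_mul]
  have h3 : β ∘ₗ LinearMap.mulLeft ℂ (C ^ 2) = 0 := LinearMap.ext fun x => hβ x
  rw [h3]
  simp [contractLeft]

end radford

/-! ### The coproduct of the cointegral -/

section expansion
variable {p : ℕ}

theorem comulHom_F_pow (n : ℕ) : comulHom p (F p ^ n) = ∑ m ∈ Finset.range (n + 1),
    gauss (qq p ^ 2)⁻¹ n m • ((Ki p ^ m * F p ^ (n - m)) ⊗ₜ[ℂ] (F p ^ m)) := by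
  have h : F p * Ki p = (qq p ^ 2)⁻¹ • (Ki p * F p) := by
    have h1 := (hasWeight_F (p := p)).Ki_mul
    rw [h1, smul_smul, mul_neg, mul_one, zpow_neg, inv_inv, zpow_ofNat,
      inv_mul_cancel₀ (pow_ne_zero _ (qq_ne_zero p)), one_smul]
  rw [map_pow, comulHom_F]
  refine (add_pow_gauss (qq p ^ 2)⁻¹ (Ki p ⊗ₜ[ℂ] F p) (F p ⊗ₜ[ℂ] 1) ?_ n).trans ?_
  · simp only [Algebra.TensorProduct.tmul_mul_tmul, h, one_mul, mul_one,
      ← TensorProduct.smul_tmul']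
  · simp only [Algebra.TensorProduct.tmul_pow, Algebra.TensorProduct.tmul_mul_tmul, one_pow,
      mul_one]

theorem comulHom_E_pow (n : ℕ) : comulHom p (E p ^ n) = ∑ m ∈ Finset.range (n + 1),
    gauss (qq p ^ 2) n m • ((E p ^ (n - m)) ⊗ₜ[ℂ] (E p ^ m * K p ^ (n - m))) := by
  have h : K p * E p = qq p ^ 2 • (E p * K p) := (cls_satisfies p).K_E
  rw [map_pow, comulHom_E]
  refine (add_pow_gauss (qq p ^ 2) (1 ⊗ₜ[ℂ] E p) (E p ⊗ₜ[ℂ] K p) ?_ n).trans ?_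
  · simp only [Algebra.TensorProduct.tmul_mul_tmul, h, one_mul, mul_one, TensorProduct.tmul_smul]
  · simp only [Algebra.TensorProduct.tmul_pow, Algebra.TensorProduct.tmul_mul_tmul, one_pow,
      one_mul]

/-- At a primitive root `w` of order `p` the Gaussian binomial coefficient `(p - 1 choose m)` is
`± w ^ (-m (m + 1) / 2)`, so it is inverted by `w ↦ w⁻¹`. -/
theorem gauss_inv_mul_gauss {w : ℂ} (hp : 0 < p) (hw : IsPrimitiveRoot w p) {m : ℕ} (hm : m < p) :
    gauss w⁻¹ (p - 1) m * gauss w (p - 1) m = 1 := by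
  obtain ⟨n, rfl⟩ : ∃ n, p = n + 1 := ⟨p - 1, by omega⟩
  rw [Nat.add_sub_cancel]
  have hw0 : w ≠ 0 := hw.ne_zero (Nat.succ_ne_zero n)
  have hzero : ∀ {u : ℂ}, IsPrimitiveRoot u (n + 1) → ∀ k, k + 1 < n + 1 →
      gauss u n k = -(u ^ (k + 1) * gauss u n (k + 1)) := by
    intro u hu k hk
    have h1 := gauss_mul u n k
    rw [hu.pow_eq_one, sub_self, zero_mul] at h1
    have h2 : 1 - u ^ (k + 1) ≠ 0 := by
      intro h3
      have := Nat.le_of_dvd (by omega) (hu.dvd_of_pow_eq_one _ (sub_eq_zero.1 h3).symm)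
      omega
    have h4 := (mul_eq_zero.1 h1).resolve_right h2
    rw [gauss_succ] at h4
    linear_combination h4
  induction m with
  | zero => simp [gauss_zero_right]
  | succ m ih =>
    have h1 := ih (by omega)
    rw [hzero hw m hm, hzero hw.inv m hm, neg_mul_neg, mul_mul_mul_comm, ← mul_pow,
      inv_mul_cancel₀ hw0, one_pow, one_mul] at h1
    exact h1

/-- A functional `x ↦ τ(K ^ (p - 1) x)` with `τ` symmetric is invariant under conjugation by `K`,
so it vanishes on elements of nonzero weight. -/
theorem eq_zero_of_hasWeight (hp : 0 < p) {β τ : Uq p →ₗ[ℂ] ℂ}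
    (hβ : ∀ x, β x = τ (K p ^ (p - 1) * x)) (hτ : ∀ x y, τ (x * y) = τ (y * x)) {x : Uq p}
    {n : ℤ} (hx : HasWeight p x n) (hn : ¬ (p : ℤ) ∣ n) : β x = 0 := by
  have hK : HasWeight p (K p) 0 := by simp [HasWeight]
  have hKi : HasWeight p (Ki p) 0 := by simp [HasWeight, K_mul_Ki, Ki_mul_K]
  have hy := hKi.mul ((hK.pow (p - 1)).mul hx)
  rw [mul_zero, zero_add, zero_add] at hy
  have h1 : K p * (Ki p * (K p ^ (p - 1) * x)) = K p ^ (p - 1) * x := by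
    rw [← mul_assoc, K_mul_Ki, one_mul]
  have h2 : K p * (Ki p * (K p ^ (p - 1) * x)) = _ := hy
  have h3 := congrArg τ h2
  rw [map_smul, hτ (Ki p * _) (K p), h1, ← hβ, smul_eq_mul] at h3
  have h4 : qq p ^ (2 * n) ≠ 1 := by
    rw [Ne, qq_zpow_eq_one_iff hp, mul_dvd_mul_iff_left two_ne_zero]
    exact hn
  by_contra h5
  refine h4 (mul_right_cancel₀ h5 ?_)
  rw [one_mul, ← h3]

/-- The `q`-binomial expansion of `Δ(F ^ (p - 1)) Δ(E ^ (p - 1))`, of which a functional of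
weight zero sees only the diagonal terms. Their coefficients are `1`. -/
theorem contractLeft_Dc_eq (hp : 0 < p) {β τ : Uq p →ₗ[ℂ] ℂ}
    (hβ : ∀ x, β x = τ (K p ^ (p - 1) * x)) (hτ : ∀ x y, τ (x * y) = τ (y * x)) :
    contractLeft β (Dc p) = ∑ m ∈ Finset.range p, ((2 * p : ℕ) : ℂ)⁻¹ •
      ∑ j ∈ Finset.range (2 * p),
        β (Ki p ^ m * F p ^ (p - 1 - m) * E p ^ (p - 1 - m) * K p ^ j) •
          (F p ^ m * E p ^ m * K p ^ (p - 1 - m + j)) := by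
  have hP : comulHom p (weightProj p 0) = ((2 * p : ℕ) : ℂ)⁻¹ •
      ∑ j ∈ Finset.range (2 * p), (K p ^ j) ⊗ₜ[ℂ] (K p ^ j) := by
    simp [weightProj, comulHom_K, Algebra.TensorProduct.tmul_pow]
  have hp1 : p - 1 + 1 = p := by omega
  have hdiag : ∀ m ∈ Finset.range p, ∀ j ∈ Finset.range (2 * p),
      ∑ m' ∈ Finset.range p, (gauss (qq p ^ 2)⁻¹ (p - 1) m * gauss (qq p ^ 2) (p - 1) m') •
        (β (Ki p ^ m * F p ^ (p - 1 - m) * E p ^ (p - 1 - m') * K p ^ j) •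
          (F p ^ m * (E p ^ m' * K p ^ (p - 1 - m')) * K p ^ j)) =
      β (Ki p ^ m * F p ^ (p - 1 - m) * E p ^ (p - 1 - m) * K p ^ j) •
          (F p ^ m * E p ^ m * K p ^ (p - 1 - m + j)) := by
    intro m hm j _
    have hm' := Finset.mem_range.1 hm
    rw [Finset.sum_eq_single_of_mem m hm, gauss_inv_mul_gauss hp (qq_sq_primitive p hp) hm',
      one_smul, pow_add]
    · simp only [mul_assoc]
    · intro m' hm'2 hne
      have hm'3 := Finset.mem_range.1 hm'2
      have hKi : HasWeight p (Ki p) 0 := by simp [HasWeight, K_mul_Ki, Ki_mul_K]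
      have hK : HasWeight p (K p) 0 := by simp [HasWeight]
      have hw := (((hKi.pow m).mul (hasWeight_F.pow (p - 1 - m))).mul
        (hasWeight_E.pow (p - 1 - m'))).mul (hK.pow j)
      rw [eq_zero_of_hasWeight hp hβ hτ hw, zero_smul, smul_zero]
      intro hd
      have h0 := Int.eq_zero_of_abs_lt_dvd hd (abs_lt.2 ⟨by omega, by omega⟩)
      omega
  have hsum : Dc p = ∑ m ∈ Finset.range p, ∑ m' ∈ Finset.range p,
      ((2 * p : ℕ) : ℂ)⁻¹ • ∑ j ∈ Finset.range (2 * p),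
        (gauss (qq p ^ 2)⁻¹ (p - 1) m * gauss (qq p ^ 2) (p - 1) m') •
          ((Ki p ^ m * F p ^ (p - 1 - m) * E p ^ (p - 1 - m') * K p ^ j) ⊗ₜ[ℂ]
            (F p ^ m * (E p ^ m' * K p ^ (p - 1 - m')) * K p ^ j)) := by
    rw [Dc, rawCointegral, map_mul, map_mul, comulHom_F_pow, comulHom_E_pow, hP, hp1,
      Finset.sum_mul_sum, Finset.sum_mul]
    refine Finset.sum_congr rfl fun m _ => ?_
    rw [Finset.sum_mul]
    refine Finset.sum_congr rfl fun m' _ => ?_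
    rw [mul_smul_comm, Finset.mul_sum]
    simp only [smul_mul_assoc, mul_smul_comm, smul_smul, Algebra.TensorProduct.tmul_mul_tmul]
    simp only [mul_comm (gauss (qq p ^ 2) _ _)]
  rw [hsum, map_sum]
  refine Finset.sum_congr rfl fun m hm => ?_
  simp only [map_sum, map_smul, contractLeft_tmul]
  rw [← Finset.smul_sum, Finset.sum_comm]
  exact congrArg _ (Finset.sum_congr rfl (hdiag m hm))

end expansion

/-! ### The Radford image of a pseudotrace on a highest weight vector -/

section highestWeight
variable {p a c : ℕ} {ε : ℤˣ}

theorem wt_zero_mul_wt_eq_one_iff (hp : 0 < p) (n : ℕ) :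
    wt p ε a 0 * wt p ε a n = 1 ↔ (p : ℤ) ∣ a - 1 - n := by
  have h : wt p ε a 0 * wt p ε a n = qq p ^ (2 * ((a : ℤ) - 1 - n)) := by
    rw [wt, wt, mul_mul_mul_comm, sgn_mul_self, one_mul, ← zpow_add₀ (qq_ne_zero p)]
    congr 1
    push_cast
    ring
  rw [h, qq_zpow_eq_one_iff hp, mul_dvd_mul_iff_left two_ne_zero]

theorem wt_pow_two_mul (hp : 0 < p) (n : ℕ) : wt p ε a n ^ (2 * p) = 1 := weight_pow p hp ε _

theorem proj_K_pow_tVec (ha : 0 < a) (hc : 0 < c) (h : a + c = p) (n j : ℕ) :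
    proj p ε a c ha hc h (K p ^ j) (tVec a c n) = wt p ε a n ^ j • tVec a c n := by
  induction j with
  | zero => simp
  | succ j ih =>
    rw [pow_succ', map_mul, Module.End.mul_apply, ih, map_smul, proj_cls, projK_t, smul_smul,
      pow_succ]

theorem bCoord_K_pow (v : ProjSpace a c) (ha : 0 < a) (hc : 0 < c) (h : a + c = p) (n i : ℕ) :
    bCoord a c n (proj p ε a c ha hc h (K p ^ i) v) = wt p ε a n ^ i * bCoord a c n v := by
  induction i with
  | zero => simp
  | succ i ih =>
    rw [pow_succ', map_mul, Module.End.mul_apply, proj_cls, bCoord_K, ih, pow_succ', mul_assoc]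

/-- Summation over the powers of `K` selects the vectors `t_n` of weight `d⁻¹`. -/
theorem sum_topBottomTrace (ha : 0 < a) (hc : 0 < c) (h : a + c = p) {d : ℂ}
    (hd : d ^ (2 * p) = 1) {i m : ℕ} (him : i + m = p - 1) :
    ((2 * p : ℕ) : ℂ)⁻¹ * ∑ j ∈ Finset.range (2 * p),
      topBottomTrace ε ha hc h (K p ^ (p - 1) * (Ki p ^ m * F p ^ i * E p ^ i * K p ^ j)) *
        d ^ (i + j) =
      ∑ n ∈ Finset.range a, if d * wt p ε a n = 1 then
        derivProd (fun j => kappa p ε a (n - j)) (Finset.range i) else 0 := by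
  have h2p : ((2 * p : ℕ) : ℂ) ≠ 0 := by exact_mod_cast (by omega : 2 * p ≠ 0)
  have hK : K p ^ (p - 1) * Ki p ^ m = K p ^ i := by
    have hc : Commute (K p) (Ki p) := by rw [Commute, SemiconjBy, K_mul_Ki, Ki_mul_K]
    rw [← him, pow_add, mul_assoc, ← hc.mul_pow, K_mul_Ki, one_pow, mul_one]
  have hterm : ∀ n j, bCoord a c n (proj p ε a c ha hc h
      (K p ^ (p - 1) * (Ki p ^ m * F p ^ i * E p ^ i * K p ^ j)) (tVec a c n)) * d ^ (i + j) =
      (d * wt p ε a n) ^ (i + j) *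
        if n < a then derivProd (fun j => kappa p ε a (n - j)) (Finset.range i) else 0 := by
    intro n j
    have e : K p ^ (p - 1) * (Ki p ^ m * F p ^ i * E p ^ i * K p ^ j) =
        K p ^ i * (F p ^ i * E p ^ i) * K p ^ j := by
      rw [← hK]
      simp only [mul_assoc]
    rw [e, map_mul, Module.End.mul_apply, proj_K_pow_tVec, map_smul, map_smul, map_mul,
      Module.End.mul_apply, bCoord_K_pow, proj_F_pow_mul_E_pow_t, map_add, map_smul, map_smul, bCoord_t,
      bCoord_b, mul_pow, pow_add (wt p ε a n)]
    simp only [smul_eq_mul, true_and]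
    split_ifs <;> ring
  simp only [topBottomTrace_apply, Finset.sum_mul, hterm]
  rw [Finset.sum_comm, Finset.mul_sum]
  refine Finset.sum_congr rfl fun n hn => ?_
  have hw : (d * wt p ε a n) ^ (2 * p) = 1 := by
    rw [mul_pow, hd, wt_pow_two_mul (by omega), one_mul]
  rw [if_pos (Finset.mem_range.1 hn), ← Finset.sum_mul]
  simp only [pow_add _ i]
  rw [← Finset.mul_sum, geom_sum_root hw]
  split_ifs with h1
  · rw [h1, one_pow, one_mul, inv_mul_cancel_left₀ h2p]
  · ring

/-- Only the lowest vector `t_(a - 1)` of the top of the first module of the block has the inverse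
of the weight of `t_0`. -/
theorem sum_blockTrace (ha : 0 < a) (hc : 0 < c) (h : a + c = p) {i m : ℕ} (him : i + m = p - 1) :
    ((2 * p : ℕ) : ℂ)⁻¹ * ∑ j ∈ Finset.range (2 * p),
      blockTrace ε ha hc h (K p ^ (p - 1) * (Ki p ^ m * F p ^ i * E p ^ i * K p ^ j)) *
        wt p ε a 0 ^ (i + j) =
      derivProd (fun j => kappa p ε a (j + 1)) (Finset.range i) := by
  simp only [blockTrace, LinearMap.add_apply, add_mul, Finset.sum_add_distrib, mul_add]
  rw [sum_topBottomTrace _ _ _ (wt_pow_two_mul (by omega) 0) him,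
    sum_topBottomTrace _ _ _ (wt_pow_two_mul (by omega) 0) him,
    Finset.sum_eq_single_of_mem (a - 1) (Finset.mem_range.2 (by omega)), if_pos,
    Finset.sum_eq_zero, add_zero]
  · congr 1
    funext j
    rw [← kappa_sub]
    congr 1
    omega
  · intro k hk
    have hk' := Finset.mem_range.1 hk
    rw [if_neg]
    rw [wt_cross p (by omega) ε a c k h, wt_zero_mul_wt_eq_one_iff (by omega)]
    intro hd
    have := Int.eq_zero_of_abs_lt_dvd hd (abs_lt.2 ⟨by omega, by omega⟩)
    omega
  · rw [wt_zero_mul_wt_eq_one_iff (by omega)]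
    exact ⟨0, by omega⟩
  · intro n hn hne
    have hn' := Finset.mem_range.1 hn
    rw [if_neg]
    rw [wt_zero_mul_wt_eq_one_iff (by omega)]
    intro hd
    have := Int.eq_zero_of_abs_lt_dvd hd (abs_lt.2 ⟨by omega, by omega⟩)
    omega

/-- The Radford image of a multiple of `blockTrace` on the top vector `t_0`. -/
theorem proj_contractLeft_Dc (ha : 0 < a) (hc : 0 < c) (h : a + c = p) {β : Uq p →ₗ[ℂ] ℂ} {α : ℂ}
    (hβ : ∀ x, β x = α * blockTrace ε ha hc h (K p ^ (p - 1) * x)) :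
    proj p ε a c ha hc h (contractLeft β (Dc p)) (tVec a c 0) =
      α • ∑ m ∈ Finset.range p,
        derivProd (fun j => kappa p ε a (j + 1)) (Finset.range (p - 1 - m)) •
          ((∏ j ∈ Finset.range m, kappa p ε a (-j)) • tVec a c 0 +
            derivProd (fun j => kappa p ε a (-j)) (Finset.range m) • bVec a c 0) := by
  have hβ' : ∀ x, β x = (α • blockTrace ε ha hc h) (K p ^ (p - 1) * x) := hβ
  rw [contractLeft_Dc_eq (by omega) hβ'
    (fun x y => by rw [LinearMap.smul_apply, LinearMap.smul_apply, blockTrace_mul_comm]), map_sum,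
    LinearMap.sum_apply, Finset.smul_sum]
  refine Finset.sum_congr rfl fun m hm => ?_
  have hm' := Finset.mem_range.1 hm
  have hF := proj_F_pow_mul_E_pow_t (ε := ε) ha hc h 0 m
  simp only [Nat.cast_zero, zero_sub] at hF
  rw [← hF, ← sum_blockTrace ha hc h (show p - 1 - m + m = p - 1 by omega)]
  simp only [map_smul, map_sum, map_mul _ (F p ^ m * E p ^ m), LinearMap.smul_apply,
    LinearMap.sum_apply, Module.End.mul_apply, proj_K_pow_tVec, smul_smul, hβ]
  rw [← Finset.sum_smul, smul_smul]
  congr 1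
  rw [Finset.mul_sum, Finset.mul_sum, Finset.mul_sum]
  refine Finset.sum_congr rfl fun j _ => ?_
  ring

end highestWeight

/-! ### Products and harmonic sums of `q`-numbers -/

section derivProd
variable (f : ℕ → ℂ)

theorem derivProd_image (g : ℕ → ℕ) (s : Finset ℕ) (hg : Set.InjOn g s) :
    derivProd f (s.image g) = derivProd (fun j => f (g j)) s := by
  rw [derivProd, derivProd, Finset.sum_image hg]
  refine Finset.sum_congr rfl fun k hk => ?_
  have e : (s.image g).erase (g k) = (s.erase k).image g := by
    ext i
    simp only [Finset.mem_erase, Finset.mem_image]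
    constructor
    · rintro ⟨hi, j, hj, rfl⟩
      exact ⟨j, ⟨fun h => hi (by rw [h]), hj⟩, rfl⟩
    · rintro ⟨j, ⟨hjk, hj⟩, rfl⟩
      exact ⟨fun h => hjk (hg hj hk h), j, hj, rfl⟩
  rw [e, Finset.prod_image fun i hi j hj => hg (Finset.mem_of_mem_erase hi)
    (Finset.mem_of_mem_erase hj)]

theorem prod_Ico_erase {a m b : ℕ} (h1 : a ≤ m) (h2 : m < b) :
    ∏ j ∈ (Finset.Ico a b).erase m, f j =
      (∏ j ∈ Finset.Ico a m, f j) * ∏ j ∈ Finset.Ico (m + 1) b, f j := by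
  have e : (Finset.Ico a b).erase m = Finset.Ico a m ∪ Finset.Ico (m + 1) b := by
    ext j
    simp only [Finset.mem_erase, Finset.mem_union, Finset.mem_Ico]
    omega
  rw [e, Finset.prod_union]
  rw [Finset.disjoint_left]
  intro j
  simp only [Finset.mem_Ico]
  omega

variable {p c : ℕ} {f}

/-- Only the term of index `0` is nonzero. -/
theorem sum_derivProd_mul_prod (h0 : f 0 = 0) (hfc : f c = 0) (hc : 0 < c) (hcp : c < p) :
    ∑ m ∈ Finset.range p, derivProd f (Finset.Ico (m + 1) p) * ∏ j ∈ Finset.range m, f j =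
      ∏ j ∈ (Finset.Ico 1 p).erase c, f j := by
  rw [Finset.sum_eq_single_of_mem 0 (Finset.mem_range.2 (by omega)), Finset.range_zero,
    Finset.prod_empty, mul_one, zero_add,
    derivProd_eq_prod_erase f _ (Finset.mem_Ico.2 ⟨hc, hcp⟩) hfc]
  intro m _ hm
  rw [Finset.prod_eq_zero (Finset.mem_range.2 (Nat.pos_of_ne_zero hm)) h0, mul_zero]

theorem sum_derivProd_mul_derivProd (h0 : f 0 = 0) (hfc : f c = 0) (hc : 0 < c) (hcp : c < p) :
    ∑ m ∈ Finset.range p, derivProd f (Finset.Ico (m + 1) p) * derivProd f (Finset.range m) =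
      derivProd f ((Finset.Ico 1 p).erase c) := by
  -- The term of index `m < c` is the product over the indices different from `0`, `m` and `c`,
  -- the term of index `c` is the sum of these products for `m > c`, the other terms vanish.
  have hr : ∀ m, 0 < m → derivProd f (Finset.range m) = ∏ j ∈ Finset.Ico 1 m, f j := by
    intro m hm
    rw [derivProd_eq_prod_erase f _ (Finset.mem_range.2 hm) h0, Finset.range_eq_Ico,
      prod_Ico_erase f le_rfl hm, Finset.Ico_self, Finset.prod_empty, one_mul]
  have hS : (Finset.Ico 1 p).erase c = Finset.Ico 1 c ∪ Finset.Ico (c + 1) p := by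
    ext j
    simp only [Finset.mem_erase, Finset.mem_union, Finset.mem_Ico]
    omega
  have hdisj : Disjoint (Finset.Ico 1 c) (Finset.Ico (c + 1) p) := by
    rw [Finset.disjoint_left]
    intro j
    simp only [Finset.mem_Ico]
    omega
  have hR : derivProd f ((Finset.Ico 1 p).erase c) =
      (∑ m ∈ Finset.Ico 1 c, ∏ j ∈ ((Finset.Ico 1 p).erase c).erase m, f j) +
      ∑ m ∈ Finset.Ico (c + 1) p, ∏ j ∈ ((Finset.Ico 1 p).erase c).erase m, f j := by
    rw [derivProd]
    conv_lhs => rw [hS]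
    rw [Finset.sum_union hdisj, ← hS]
  have hL : ∑ m ∈ Finset.range p,
      derivProd f (Finset.Ico (m + 1) p) * derivProd f (Finset.range m) =
      (∑ m ∈ Finset.Ico 1 c,
        derivProd f (Finset.Ico (m + 1) p) * derivProd f (Finset.range m)) +
      derivProd f (Finset.Ico (c + 1) p) * derivProd f (Finset.range c) := by
    rw [← Finset.sum_Ico_succ_top (by omega : 1 ≤ c)]
    symm
    refine Finset.sum_subset (fun j => ?_) fun m hm hm' => ?_
    · simp only [Finset.mem_Ico, Finset.mem_range]
      omega
    · simp only [Finset.mem_Ico, Finset.mem_range] at hm hm'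
      rcases Nat.eq_zero_or_pos m with rfl | hm0
      · simp [derivProd]
      · rw [hr m hm0, Finset.prod_eq_zero (Finset.mem_Ico.2 ⟨hc, by omega⟩) hfc, mul_zero]
  rw [hL, hR]
  congr 1
  · refine Finset.sum_congr rfl fun m hm => ?_
    obtain ⟨hm1, hm2⟩ := Finset.mem_Ico.1 hm
    have e : ((Finset.Ico 1 p).erase c).erase m =
        (Finset.Ico 1 c).erase m ∪ Finset.Ico (c + 1) p := by
      ext j
      simp only [Finset.mem_erase, Finset.mem_union, Finset.mem_Ico]
      omega
    rw [hr m hm1, derivProd_eq_prod_erase f _ (Finset.mem_Ico.2 ⟨hm2, hcp⟩) hfc,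
      prod_Ico_erase f hm2 hcp, e,
      Finset.prod_union (Finset.disjoint_of_subset_left (Finset.erase_subset _ _) hdisj),
      prod_Ico_erase f hm1 hm2]
    ring
  · rw [hr c hc, derivProd, Finset.sum_mul]
    refine Finset.sum_congr rfl fun m hm => ?_
    obtain ⟨hm1, hm2⟩ := Finset.mem_Ico.1 hm
    have e : ((Finset.Ico 1 p).erase c).erase m =
        Finset.Ico 1 c ∪ (Finset.Ico (c + 1) p).erase m := by
      ext j
      simp only [Finset.mem_erase, Finset.mem_union, Finset.mem_Ico]
      omega
    rw [e, Finset.prod_union (Finset.disjoint_of_subset_right (Finset.erase_subset _ _) hdisj),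
      mul_comm]

end derivProd

section qNumbers
variable {p a c : ℕ} (ε : ℤˣ)

/-- The numbers `ε [j + 1] [a - j - 1]` are the numbers `ε [-k] [a + k]` for `k = p - 1 - j`. -/
theorem derivProd_kappa_reflect (hp : 0 < p) (m : ℕ) :
    derivProd (fun j => kappa p ε a (j + 1)) (Finset.range (p - 1 - m)) =
      derivProd (fun j => kappa p ε a (-j)) (Finset.Ico (m + 1) p) := by
  have e : Finset.Ico (m + 1) p = (Finset.range (p - 1 - m)).image fun j => p - 1 - j := by
    ext j
    simp only [Finset.mem_image, Finset.mem_range, Finset.mem_Ico]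
    constructor
    · intro h
      exact ⟨p - 1 - j, by omega, by omega⟩
    · rintro ⟨k, hk, rfl⟩
      omega
  rw [e, derivProd_image _ _ _ fun i hi j hj hij => ?_]
  · rw [derivProd, derivProd]
    refine Finset.sum_congr rfl fun k _ => Finset.prod_congr rfl fun j hj => ?_
    have hj' := Finset.mem_range.1 (Finset.mem_of_mem_erase hj)
    rw [← kappa_add_self hp ε a (-_)]
    congr 1
    omega
  · simp only [Finset.coe_range, Set.mem_Iio] at hi hj hij
    omega

theorem kappa_neg_ne_zero (hp : 2 ≤ p) (h : a + c = p) {k : ℕ}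
    (hk : k ∈ (Finset.Ico 1 p).erase c) : kappa p ε a (-k) ≠ 0 := by
  simp only [Finset.mem_erase, Finset.mem_Ico] at hk
  refine kappa_ne_zero hp ε a (fun hd => ?_) fun hd => ?_
  · have := Int.eq_zero_of_abs_lt_dvd hd (abs_lt.2 ⟨by omega, by omega⟩)
    omega
  · have := Int.eq_zero_of_abs_lt_dvd (dvd_sub_self_right.2 hd)
      (abs_lt.2 (show -(p : ℤ) < (a - -k) - p ∧ (a - -k) - p < (p : ℤ) by omega))
    omega

/-- The `q`-analogue `q ^ (-n) / [n]` of `1 / n`, whose differences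
`q ^ (-k) / [k] - q ^ (-a - k) / [a + k]` equal `[a] / ([k] [a + k])`. -/
def qHarm (p : ℕ) (n : ℤ) : ℂ := qq p ^ (-n) / qInt p n

theorem qHarm_add_self (hp : 0 < p) (n : ℤ) : qHarm p (n + p) = qHarm p n := by
  rw [qHarm, qHarm, qInt_add_self hp, neg_add, zpow_add₀ (qq_ne_zero p), zpow_neg _ (p : ℤ),
    qq_zpow_self hp]
  norm_num [neg_div_neg_eq]

theorem sum_qHarm_add (hp : 0 < p) (a : ℕ) :
    ∑ k ∈ Finset.range p, qHarm p (a + k) = ∑ k ∈ Finset.range p, qHarm p k := by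
  induction a with
  | zero => simp
  | succ a ih =>
    rw [← ih]
    have h1 := Finset.sum_range_succ (fun k : ℕ => qHarm p (a + k)) p
    rw [Finset.sum_range_succ', qHarm_add_self hp, Nat.cast_zero, add_zero] at h1
    rw [← add_right_cancel h1]
    refine Finset.sum_congr rfl fun k _ => ?_
    congr 1
    push_cast
    ring

theorem qHarm_sub {k : ℤ} (h1 : qInt p k ≠ 0) (h2 : qInt p (a + k) ≠ 0) :
    qHarm p k - qHarm p (a + k) = qInt p a * (qInt p k * qInt p (a + k))⁻¹ := by
  have h3 : qq p ^ (-k) * qInt p (a + k) - qInt p k * qq p ^ (-(a + k)) = qInt p a := by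
    have h0 := qq_ne_zero p
    have hk : qq p ^ k ≠ 0 := zpow_ne_zero _ h0
    have ha : qq p ^ (a : ℤ) ≠ 0 := zpow_ne_zero _ h0
    simp only [qInt, neg_add, zpow_add₀ h0, zpow_neg, ← sub_div, mul_div_assoc', div_mul_eq_mul_div]
    congr 1
    field_simp
    ring
  rw [qHarm, qHarm, div_sub_div _ _ h1 h2, h3, div_eq_mul_inv]

/-- The partial fraction decomposition of `[a] / ([k] [a + k])` makes the sum telescope modulo
`p`; what is left are the two terms excluded by `k ≠ 0` and `k ≠ c`. -/
theorem sum_inv_kappa (ha : 0 < a) (hc : 0 < c) (h : a + c = p) :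
    ∑ k ∈ (Finset.Ico 1 p).erase c, (kappa p ε a (-k))⁻¹ =
      -(sgn ε * ((qq p ^ (a : ℤ) + (qq p ^ (a : ℤ))⁻¹) / qInt p a ^ 2)) := by
  have hp : 2 ≤ p := by omega
  have ha0 : qInt p a ≠ 0 := qInt_ne_zero_of_lt hp (by omega) (by omega)
  have hterm : ∀ k ∈ (Finset.Ico 1 p).erase c, (kappa p ε a (-k))⁻¹ =
      -(sgn ε * (qInt p a)⁻¹) * (qHarm p k - qHarm p (a + k)) := by
    intro k hk
    have h1 := kappa_neg_ne_zero ε hp h hk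
    rw [kappa, qInt_neg, sub_neg_eq_add] at h1 ⊢
    obtain ⟨h2, h3⟩ := mul_ne_zero_iff.1 h1
    rw [qHarm_sub (neg_ne_zero.1 (right_ne_zero_of_mul h2)) h3, mul_inv, mul_inv, mul_inv,
      sgn_inv, inv_neg]
    field_simp
  have hsum : ∀ g : ℕ → ℂ, ∑ k ∈ (Finset.Ico 1 p).erase c, g k =
      ∑ k ∈ Finset.range p, g k - g 0 - g c := by
    intro g
    rw [Finset.sum_erase_eq_sub (Finset.mem_Ico.2 ⟨hc, by omega⟩), Finset.range_eq_Ico,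
      Finset.sum_eq_sum_Ico_succ_bot (by omega : 0 < p)]
    ring
  -- A junk value: `q ^ 0 / [0]` is `0` by convention, so the index `0` may be included in the sum.
  have hz : qHarm p 0 = 0 := by simp [qHarm, qInt_zero]
  have hac : ((a : ℤ) + (c : ℕ)) = 0 + p := by omega
  have hc' : qHarm p c = -(qq p ^ (a : ℤ) / qInt p a) := by
    have e : (c : ℤ) = -a + p := by omega
    rw [e, qHarm_add_self (by omega), qHarm, qInt_neg, neg_neg, div_neg]
  rw [Finset.sum_congr rfl hterm, ← Finset.mul_sum, Finset.sum_sub_distrib, hsum, hsum,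
    sum_qHarm_add (by omega), hac, qHarm_add_self (by omega), Nat.cast_zero, add_zero, hz, hc',
    qHarm, zpow_neg, sq, div_mul_eq_div_div, div_eq_mul_inv, div_eq_mul_inv, div_eq_mul_inv,
    div_eq_mul_inv]
  ring

theorem qFactorial_eq_prod_Ico :
    qFactorial p (p - 1) = ∏ k ∈ Finset.Ico 1 p, qInt p k := by
  rw [qFactorial, Finset.prod_Ico_eq_prod_range]
  refine Finset.prod_congr rfl fun k _ => ?_
  congr 1
  push_cast
  ring

/-- Both `[k]` and, up to sign, `[a + k]` run through `[1], …, [p - 1]` with one factor `[a] = [c]`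
missing. -/
theorem prod_kappa (ha : 0 < a) (hc : 0 < c) (h : a + c = p) :
    qInt p a ^ 2 * ∏ k ∈ (Finset.Ico 1 p).erase c, kappa p 1 a (-k) =
      (-1) ^ (c - 1) * qFactorial p (p - 1) ^ 2 := by
  have hp0 : 0 < p := by omega
  have hk : ∀ k : ℕ, kappa p 1 a (-k) = -1 * (qInt p k * qInt p (a + k)) := by
    intro k
    rw [kappa, qInt_neg, sub_neg_eq_add]
    simp [sgn]
  have hA : ∏ k ∈ Finset.Ico 1 c, qInt p (a + k) = ∏ k ∈ Finset.Ico (a + 1) p, qInt p k := by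
    have e := Finset.prod_Ico_add (fun k : ℕ => qInt p k) 1 c a
    rw [add_comm 1 a, add_comm c a, h] at e
    simpa using e
  have hB : ∏ k ∈ Finset.Ico (c + 1) p, qInt p (a + k) =
      (-1) ^ (a - 1) * ∏ k ∈ Finset.Ico 1 a, qInt p k := by
    have e := Finset.prod_Ico_add (fun k : ℕ => qInt p (a + k)) 1 a c
    rw [add_comm 1 c, h] at e
    rw [← e, ← Nat.card_Ico, ← Finset.prod_const, ← Finset.prod_mul_distrib]
    refine Finset.prod_congr rfl fun k _ => ?_
    rw [neg_one_mul, ← qInt_add_self hp0]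
    congr 1
    omega
  have hsplit : ∀ m, 0 < m → m < p → qFactorial p (p - 1) =
      (∏ k ∈ Finset.Ico 1 m, qInt p k) * qInt p m * ∏ k ∈ Finset.Ico (m + 1) p, qInt p k := by
    intro m h1 h2
    rw [qFactorial_eq_prod_Ico, ← Finset.prod_Ico_succ_top h1,
      Finset.prod_Ico_consecutive _ (by omega) (by omega)]
  have hca : qInt p c = qInt p a := by
    rw [← qInt_self_sub hp0]
    congr 1
    omega
  have hsq : ((-1 : ℂ) ^ (a - 1)) ^ 2 = 1 := by rw [← pow_mul, mul_comm, pow_mul]; norm_num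
  have e1 : p - (c + 1) = a - 1 := by omega
  rw [prod_Ico_erase _ hc (by omega)]
  simp only [hk, Finset.prod_mul_distrib, Finset.prod_const, Nat.card_Ico, hA, hB, e1]
  rw [sq (qFactorial p _)]
  nth_rw 1 [hsplit a ha (by omega)]
  rw [hsplit c hc (by omega), hca]
  linear_combination (qInt p a ^ 2 * (-1) ^ (c - 1) * (∏ k ∈ Finset.Ico 1 c, qInt p k) *
    (∏ k ∈ Finset.Ico (a + 1) p, qInt p k) * (∏ k ∈ Finset.Ico (c + 1) p, qInt p k) *
    ∏ k ∈ Finset.Ico 1 a, qInt p k) * hsq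

end qNumbers

/-! ### The Radford image of a pseudotrace -/

section image
variable {p a c : ℕ} {ε : ℤˣ}

theorem blockTrace_neg (ha : 0 < a) (hc : 0 < c) (h : a + c = p) (h' : c + a = p) :
    blockTrace (-ε) hc ha h' = blockTrace ε ha hc h := by
  rw [blockTrace, blockTrace, add_comm]
  simp only [neg_neg]

/-- The product of the nonzero numbers among `ε [-k] [a + k]`, `0 < k < p`. -/
def kappaProd (p : ℕ) (ε : ℤˣ) (a c : ℕ) : ℂ :=
  ∏ k ∈ (Finset.Ico 1 p).erase c, kappa p ε a (-k)

/-- The image of the functional sends `t_0` to `α R (t_0 + H b_0)`, where `R` is the product of the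
nonzero numbers among `ε [-k] [a + k]`, `0 < k < p`, and `H` the sum of their inverses. -/
theorem proj_contractLeft_Dc_tVec_zero (ha : 0 < a) (hc : 0 < c) (h : a + c = p)
    {β : Uq p →ₗ[ℂ] ℂ} {α : ℂ} (hβ : ∀ x, β x = α * blockTrace ε ha hc h (K p ^ (p - 1) * x)) :
    proj p ε a c ha hc h (contractLeft β (Dc p)) (tVec a c 0) =
      (α * kappaProd p ε a c) • tVec a c 0 +
      (α * kappaProd p ε a c *
        -(sgn ε * ((qq p ^ (a : ℤ) + (qq p ^ (a : ℤ))⁻¹) / qInt p a ^ 2))) • bVec a c 0 := by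
  have h0 : kappa p ε a (-((0 : ℕ) : ℤ)) = 0 := by simp [kappa_zero]
  have hfc : kappa p ε a (-(c : ℤ)) = 0 := by
    rw [← kappa_add_self (by omega), show -(c : ℤ) + p = a by omega, kappa_self]
  rw [proj_contractLeft_Dc ha hc h hβ, ← sum_inv_kappa ε ha hc h, mul_assoc, kappaProd,
    ← derivProd_eq_mul_sum_inv _ _ fun k hk => kappa_neg_ne_zero ε (by omega) h hk,
    ← sum_derivProd_mul_prod (f := fun k => kappa p ε a (-k)) h0 hfc hc (by omega),
    ← sum_derivProd_mul_derivProd (f := fun k => kappa p ε a (-k)) h0 hfc hc (by omega),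
    mul_smul, mul_smul, ← smul_add, Finset.sum_smul, Finset.sum_smul, ← Finset.sum_add_distrib]
  congr 1
  refine Finset.sum_congr rfl fun m _ => ?_
  rw [derivProd_kappa_reflect ε (by omega), smul_add, smul_smul, smul_smul]

theorem proj_casimir_sub_sq (ha : 0 < a) (hc : 0 < c) (h : a + c = p) {b : ℂ}
    (hb : b = casimirEig p ε a) :
    proj p ε a c ha hc h ((casimir p + (-b) • 1) ^ 2) = 0 := by
  have e : proj p ε a c ha hc h (casimir p + (-b) • 1) = topToBottom a c := by
    rw [map_add, map_smul, proj_casimir, map_one, hb]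
    module
  rw [map_pow, e, sq, topToBottom_mul_self]

/-- The Casimir element has a single eigenvalue `b` on the two modules of a block, and `C - b`
squares to zero there. -/
theorem blockTrace_casimir_sub_sq_mul (ha : 0 < a) (hc : 0 < c) (h : a + c = p) (y x : Uq p) :
    blockTrace ε ha hc h (y * ((casimir p + (-casimirEig p ε a) • 1) ^ 2 * x)) = 0 := by
  rw [blockTrace, LinearMap.add_apply, topBottomTrace_apply, topBottomTrace_apply]
  simp only [map_mul, proj_casimir_sub_sq ha hc h rfl,
    proj_casimir_sub_sq (ε := -ε) hc ha ((Nat.add_comm c a).trans h)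
      (casimirEig_cross ε a c h (by omega)).symm, zero_mul, mul_zero, LinearMap.zero_apply,
    map_zero, Finset.sum_const_zero, add_zero]

/-- The eigenvalues of the Casimir element separate the blocks. -/
theorem ActsBy.eq_zero_of_casimir_sub_sq {hp : 2 ≤ p} {z : Uq p} {x yp ym : ℕ → ℂ}
    (hz : ActsBy hp z x yp ym) {s : ℕ} (hs : s ≤ p)
    (h : (casimir p + (-casimirEig p 1 s) • 1) ^ 2 * z = 0) :
    (∀ t, t ≤ p → t ≠ s → x t = 0) ∧ (∀ t, 1 ≤ t → t < p → t ≠ s → yp t = 0) ∧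
      ∀ t, 1 ≤ t → t < p → t ≠ s → ym t = 0 := by
  have hD := (actsBy_casimir (hp := hp)).add ((ActsBy.one (hp := hp)).smul (-casimirEig p 1 s))
  have h1 := (hD.mul hD).mul hz
  rw [← sq, h] at h1
  obtain ⟨hx, hyp, hym⟩ := h1.unique ActsBy.zero
  have hd : ∀ t, t ≤ p → t ≠ s → casimirEig p 1 t + -casimirEig p 1 s ≠ 0 := by
    intro t ht hts h2
    exact hts (casimirEig_injOn hp ht hs (by linear_combination h2))
  have hx0 : ∀ t, t ≤ p → t ≠ s → x t = 0 := by
    intro t ht hts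
    have h2 := hx t ht
    simp only [Pi.mul_apply, Pi.add_apply, Pi.smul_apply, Pi.one_apply, smul_eq_mul, mul_one,
      Pi.zero_apply] at h2
    exact (mul_eq_zero.1 h2).resolve_left (mul_ne_zero (hd t ht hts) (hd t ht hts))
  refine ⟨hx0, fun t h2 h3 hts => ?_, fun t h2 h3 hts => ?_⟩
  · have h4 := hyp t h2 h3
    simp only [Pi.mul_apply, Pi.add_apply, Pi.smul_apply, Pi.one_apply, smul_eq_mul, mul_one,
      Pi.zero_apply, hx0 t h3.le hts, mul_zero, add_zero] at h4
    exact (mul_eq_zero.1 h4).resolve_left (mul_ne_zero (hd t h3.le hts) (hd t h3.le hts))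
  · have h4 := hym t h2 h3
    simp only [Pi.mul_apply, Pi.add_apply, Pi.smul_apply, Pi.one_apply, smul_eq_mul, mul_one,
      Pi.zero_apply, hx0 t h3.le hts, mul_zero, add_zero] at h4
    exact (mul_eq_zero.1 h4).resolve_left (mul_ne_zero (hd t h3.le hts) (hd t h3.le hts))

/-- Up to the normalization of the cointegral, the Radford image of the pseudotrace `γ(s)`. -/
theorem actsBy_contractLeft_Dc (hp : 2 ≤ p) (a₀ : ℂ) {s : ℕ} (h1 : 1 ≤ s) (h2 : s < p) :
    ActsBy hp (contractLeft (pseudotrace p a₀ s h1 h2) (Dc p))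
      ((alpha p a₀ s * kappaProd p 1 s (p - s)) • Pi.single s 1)
      ((alpha p a₀ s * kappaProd p 1 s (p - s) *
        -((qq p ^ s + (qq p ^ s)⁻¹) / qInt p s ^ 2)) • Pi.single s 1)
      ((alpha p a₀ s * kappaProd p 1 s (p - s) *
        -((qq p ^ s + (qq p ^ s)⁻¹) / qInt p s ^ 2)) • Pi.single s 1) := by
  have hc : 0 < p - s := by omega
  have hβ := pseudotrace_apply (p := p) a₀ s h1 h2
  set β := pseudotrace p a₀ s h1 h2
  set α := alpha p a₀ s
  set z := contractLeft β (Dc p)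
  have hz : z ∈ Subalgebra.center ℂ (Uq p) := contractLeft_mem_center hp
    (τ := α • blockTrace 1 (a := s) (c := p - s) h1 hc (by omega)) hβ
    fun x y => by rw [LinearMap.smul_apply, LinearMap.smul_apply, blockTrace_mul_comm]
  obtain ⟨x, yp, ym, hA⟩ := exists_actsBy (hp := hp) hz
  have hblock : (casimir p + (-casimirEig p 1 s) • 1) ^ 2 * z = 0 :=
    casimir_sub_sq_mul_contractLeft hp β _ fun x => by
      rw [hβ, blockTrace_casimir_sub_sq_mul, mul_zero]
  obtain ⟨hx, hyp, hym⟩ := hA.eq_zero_of_casimir_sub_sq h2.le hblock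
  have hP := proj_contractLeft_Dc_tVec_zero (ε := 1) h1 hc (by omega) hβ
  have hP' : proj p 1 s (p - s) h1 hc (by omega) z = _ := hA.plus s h1 h2
  have hβ' : ∀ x, β x = α * blockTrace (-1) hc h1 (by omega) (K p ^ (p - 1) * x) := by
    intro x
    rw [hβ, blockTrace_neg]
  have hM := proj_contractLeft_Dc_tVec_zero (ε := -1) hc h1 (by omega) hβ'
  have hM' : proj p (-1) (p - s) s hc h1 (by omega) z = _ := hA.minus s h1 h2
  rw [hP', LinearMap.add_apply, LinearMap.smul_apply, LinearMap.smul_apply, Module.End.one_apply,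
    topToBottom_t] at hP
  rw [hM', LinearMap.add_apply, LinearMap.smul_apply, LinearMap.smul_apply, Module.End.one_apply,
    topToBottom_t] at hM
  obtain ⟨hxs, hyps⟩ := smul_tVec_add_smul_bVec_injective h1 hP
  obtain ⟨hxs', hyms⟩ := smul_tVec_add_smul_bVec_injective hc hM
  have hsgn : sgn 1 = 1 := by simp [sgn]
  -- The harmonic sums of the two modules agree: `q ^ (p - s) = -q ^ (-s)` and `[p - s] = [s]`.
  have hpq : -(sgn (-1) * ((qq p ^ ((p - s : ℕ) : ℤ) + (qq p ^ ((p - s : ℕ) : ℤ))⁻¹) /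
      qInt p ((p - s : ℕ) : ℤ) ^ 2)) = -((qq p ^ s + (qq p ^ s)⁻¹) / qInt p s ^ 2) := by
    rw [Nat.cast_sub h2.le, qInt_self_sub (by omega), zpow_sub₀ (qq_ne_zero p),
      qq_zpow_self (by omega), sgn_neg, hsgn, zpow_natCast, inv_div, div_neg, div_eq_mul_inv]
    ring
  rw [hsgn, one_mul, zpow_natCast] at hyps
  rw [← hxs', hpq, hxs] at hyms
  refine hA.congr (fun t ht => ?_) (fun t ht1 ht2 => ?_) fun t ht1 ht2 => ?_
  · by_cases hts : t = s
    · subst hts; simp [hxs]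
    · simp [hx t ht hts, hts]
  · by_cases hts : t = s
    · subst hts; simp [hyps]
    · simp [hyp t ht1 ht2 hts, hts]
  · by_cases hts : t = s
    · subst hts; simp [hyms]
    · simp [hym t ht1 ht2 hts, hts]

theorem two_mul_sqrt_half (p : ℕ) :
    2 * (Real.sqrt ((p : ℝ) / 2) : ℂ) = (Real.sqrt (2 * (p : ℝ)) : ℂ) := by
  have h : 2 * Real.sqrt ((p : ℝ) / 2) = Real.sqrt (2 * (p : ℝ)) := by
    rw [show 2 * (p : ℝ) = 2 ^ 2 * (p / 2) by ring, Real.sqrt_mul (by positivity),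
      Real.sqrt_sq (by norm_num)]
  exact_mod_cast h

theorem cointegral_mul_alpha_mul_kappaProd (hp : 2 ≤ p) (a₀ : ℂ) {s : ℕ} (h1 : 1 ≤ s)
    (h2 : s < p) :
    (Real.sqrt ((p : ℝ) / 2) : ℂ) / qFactorial p (p - 1) ^ 2 * ((2 * p : ℕ) : ℂ) *
        (alpha p a₀ s * kappaProd p 1 s (p - s)) =
      a₀ * (-1) ^ (p - s) * ((Real.sqrt (2 * (p : ℝ)) : ℂ) / (qq p ^ s - (qq p ^ s)⁻¹)) := by
  have hp0 : (p : ℂ) ≠ 0 := by exact_mod_cast (by omega : p ≠ 0)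
  have hq := qq_sub_inv_ne p hp
  have hs0 : qInt p s ≠ 0 := qInt_ne_zero_of_lt hp (by omega) (by omega)
  have hfac : qFactorial p (p - 1) ≠ 0 := Finset.prod_ne_zero_iff.2 fun k hk => by
    have := Finset.mem_range.1 hk
    exact qInt_ne_zero_of_lt hp (by omega) (by omega)
  have hden : qq p ^ s - (qq p ^ s)⁻¹ = qInt p s * (qq p - (qq p)⁻¹) := by
    rw [qInt, div_mul_cancel₀ _ hq, zpow_neg, zpow_natCast]
  have hprod := prod_kappa (p := p) h1 (show 0 < p - s by omega) (by omega)
  have hR : kappaProd p 1 s (p - s) =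
      (-1) ^ (p - s - 1) * qFactorial p (p - 1) ^ 2 / qInt p s ^ 2 := by
    rw [kappaProd, eq_div_iff (pow_ne_zero _ hs0), mul_comm]
    exact hprod
  have hsign : (-1 : ℂ) ^ (p - s) = -(-1) ^ (p - s - 1) := by
    conv_lhs => rw [show p - s = p - s - 1 + 1 by omega, pow_succ]
    ring
  rw [hR, hden, hsign, ← two_mul_sqrt_half, alpha]
  push_cast
  field_simp

end image

end RestrictedQuantumGroup

end

/-- For `1 ≤ s ≤ p - 1`, the canonical central elements exist and are unique, and the Radford image
of the pseudotrace `γ(s)` decomposes as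
`φ(s) = a₀ (-1)^(p-s) √(2p) / (q^s - q^(-s)) (e_s - (q^s + q^(-s)) / [s]² (w⁺_s + w⁻_s))`. -/
theorem mainTheorem5 (p : ℕ) [NeZero p] (hp : 2 ≤ p) (a₀ : ℂ) :
    (∃! C : RestrictedQuantumGroup.Family p, C.IsCanonical hp) ∧
    ∀ C : RestrictedQuantumGroup.Family p, C.IsCanonical hp →
      ∀ (s : ℕ) (h1 : 1 ≤ s) (h2 : s < p),
        RestrictedQuantumGroup.radford p (RestrictedQuantumGroup.pseudotrace p a₀ s h1 h2) =
          (a₀ * (-1) ^ (p - s) * ((Real.sqrt (2 * (p : ℝ)) : ℂ) /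
            (RestrictedQuantumGroup.qq p ^ s - (RestrictedQuantumGroup.qq p ^ s)⁻¹))) •
          (C.e ⟨s, Nat.lt_succ_of_lt h2⟩ -
            ((RestrictedQuantumGroup.qq p ^ s + (RestrictedQuantumGroup.qq p ^ s)⁻¹) /
              RestrictedQuantumGroup.qInt p s ^ 2) •
            (C.wPlus ⟨s, h1, h2⟩ + C.wMinus ⟨s, h1, h2⟩)) := by
  refine ⟨RestrictedQuantumGroup.existsUnique_isCanonical hp, fun C hC s h1 h2 => ?_⟩
  have hS := hC.isStandard
  have hφ := (RestrictedQuantumGroup.actsBy_contractLeft_Dc hp a₀ h1 h2).smul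
    ((Real.sqrt ((p : ℝ) / 2) : ℂ) / RestrictedQuantumGroup.qFactorial p (p - 1) ^ 2 *
      ((2 * p : ℕ) : ℂ))
  have hR := ((hS.e ⟨s, Nat.lt_succ_of_lt h2⟩).sub
    (((hS.wPlus ⟨s, h1, h2⟩).add (hS.wMinus ⟨s, h1, h2⟩)).smul
      ((RestrictedQuantumGroup.qq p ^ s + (RestrictedQuantumGroup.qq p ^ s)⁻¹) /
        RestrictedQuantumGroup.qInt p s ^ 2))).smul
    (a₀ * (-1) ^ (p - s) * ((Real.sqrt (2 * (p : ℝ)) : ℂ) /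
      (RestrictedQuantumGroup.qq p ^ s - (RestrictedQuantumGroup.qq p ^ s)⁻¹)))
  rw [← RestrictedQuantumGroup.cointegral_mul_alpha_mul_kappaProd hp a₀ h1 h2] at hR ⊢
  rw [RestrictedQuantumGroup.radford_eq, RestrictedQuantumGroup.cointegral_eq (by omega), map_smul,
    map_smul]
  refine hφ.ext hR (fun t _ => ?_) (fun t _ _ => ?_) fun t _ _ => ?_ <;>
    simp only [Pi.smul_apply, Pi.sub_apply, Pi.add_apply, Pi.zero_apply, smul_eq_mul] <;> ring
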